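/- Let $(\xi,A,B,\eta)$ be a linear representation over the alphabet $\{a,b\}$, i.e. $\xi,\eta$ are vectors and $A,B\neq 0$ are square matrices, all with nonnegative real entries. Let $\mu$ be the monoid morphism on $\{a,b\}^*$ with $\mu(a)=A$, $\mu(b)=B$, and assume that for every $n\ge 1$ some word $w$ of length $n$ satisfies $\xi'\mu(w)\eta>0$. Let $Y_n=|w|_a$ be the number of occurrences of $a$ in a random word $w\in\{a,b\}^n$ chosen with probability $$\Pr(w)=\frac{\xi'\mu(w)\eta}{\sum_{x\in\{a,b\}^n}\xi'\mu(x)\eta}.$$ Assume that this is an equipotent communicating bicomponent model, that is, $$\xi'=(\xi_1',\xi_2'),\quad A=\begin{pmatrix}A_1&A_0\\0&A_2\end{pmatrix},\quad B=\begin{pmatrix}B_1&B_0\\0&B_2\end{pmatrix},\quad \eta=\begin{pmatrix}\eta_1\\ \eta_2\end{pmatrix},$$ where $M_1=A_1+B_1$ and $M_2=A_2+B_2$ are irreducible and aperiodic (hence primitive) and have the same Perron–Frobenius eigenvalue $\lambda$, and $\xi_1\ne 0$, $\eta_2\neq 0$, $A_0+B_0\neq 0$. For $j=1,2$ let $u_j(z)$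 be the function analytic near $z=0$ with $\det(u_j(z)I-A_je^z-B_j)=0$ and $u_j(0)=\lambda$, and set $$\beta_j=\frac{u_j'(0)}{\lambda},\qquad \gamma_j=\frac{u_j''(0)}{\lambda}-\Big(\frac{u_j'(0)}{\lambda}\Big)^2 .$$ Assume also that for $j=1,2$ the pair $(A_j,B_j)$ is aperiodic: in the directed graph that has an edge $p\to q$ labelled $a$ whenever $(A_j)_{pq}>0$ and an edge $p\to q$ labelled $b$ whenever $(B_j)_{pq}>0$, the greatest common divisor of all differences $|\ell(C)|_a-|\ell(C')|_a$ is $1$, where $C,C'$ range over the cycles (closed walks) of equal length and $\ell(C)$ is the word of labels along $C$. Suppose $\beta_1=\beta_2=\beta$ and $\gamma_1\ne\gamma_2$, and set $\gamma=(\gamma_1+\gamma_2)/2$. Then, as $n\to+\infty$, $$\left|\sqrt{\gamma n}\,\Pr(Y_n=k)-f_T\!\left(\frac{k-\beta n}{\sqrt{\gamma n}}\right)\right|=O\!\left(n^{-1/2}\right)$$ uniformly for $k\in\{0,1,\dots,n\}$, where $$f_T(x)=\frac{\gamma}{\gamma_2-\gamma_1}\int_{\gamma_1/\gamma}^{\gamma_2/\gamma}\frac{e^{-x^2/(2s)}}{\sqrt{2\pi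 s}}\,ds\qquad(x\in\mathbb R).$$ -/

import Mathlib

namespace SymbolStatistics

/-- The binary alphabet `{a, b}`. -/
inductive Letter : Type
  | a : Letter
  | b : Letter
  deriving DecidableEq

instance : Fintype Letter where
  elems := {Letter.a, Letter.b}
  complete := by intro x; cases x <;> simp

/-- A linear representation `(ξ, A, B, η)` with nonnegative real entries, with rows and columns
indexed by the finite type `ι`. -/
structure LinearRepresentation (ι : Type*) where
  xi : ι → ℝ
  A : Matrix ι ι ℝ
  B : Matrix ι ι ℝ
  eta : ι → ℝ
  xi_nonneg : ∀ i, 0 ≤ xi i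
  A_nonneg : ∀ i j, 0 ≤ A i j
  B_nonneg : ∀ i j, 0 ≤ B i j
  eta_nonneg : ∀ i, 0 ≤ eta i

/-- `IsWalk A B i j w`: in the labelled graph having an edge `i → j` with label `a`
(with label `b`) whenever `0 < A i j` (whenever `0 < B i j`), there is a walk from `i` to `j`
whose sequence of labels is the word `w`. -/
inductive IsWalk {ι : Type*} (A B : Matrix ι ι ℝ) : ι → ι → List Letter → Prop
  | nil (i : ι) : IsWalk A B i i []
  | consA {i j k : ι} {w : List Letter} (h : 0 < A i j) (hw : IsWalk A B j k w) :
      IsWalk A B i k (Letter.a :: w)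
  | consB {i j k : ι} {w : List Letter} (h : 0 < B i j) (hw : IsWalk A B j k w) :
      IsWalk A B i k (Letter.b :: w)

/-- The set of the differences `|ℓ(C₁)|_a - |ℓ(C₂)|_a`, where `C₁`, `C₂` are cycles (closed walks)
of equal length. -/
def cycleDifferences {ι : Type*} (A B : Matrix ι ι ℝ) : Set ℤ :=
  {z | ∃ (i j : ι) (w₁ w₂ : List Letter), IsWalk A B i i w₁ ∧ IsWalk A B j j w₂ ∧
    w₁.length = w₂.length ∧ z = (w₁.count Letter.a : ℤ) - (w₂.count Letter.a : ℤ)}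

/-- The pair `(A, B)` is aperiodic: the gcd of `cycleDifferences A B` is `1`, that is, `1` is the
only natural number that divides all its elements. -/
def IsAperiodicPair {ι : Type*} (A B : Matrix ι ι ℝ) : Prop :=
  ∀ d : ℕ, (∀ z ∈ cycleDifferences A B, (d : ℤ) ∣ z) → d = 1

/-- A nonnegative square matrix is aperiodic if every index `i` has period `1`, where the period
is the gcd of the `k ≥ 1` with `(M ^ k) i i > 0`. -/
def IsAperiodicMatrix {ι : Type*} [Fintype ι] [DecidableEq ι] (M : Matrix ι ι ℝ) : Prop :=
  ∀ i : ι, ∀ d : ℕ, (∀ k : ℕ, 0 < k → 0 < (M ^ k) i i → d ∣ k) → d = 1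

/-- The Perron-Frobenius eigenvalue of a nonnegative square matrix: its spectral radius. -/
noncomputable def perronEigenvalue {ι : Type*} [Fintype ι] [DecidableEq ι]
    (M : Matrix ι ι ℝ) : ℝ :=
  (spectralRadius ℂ (M.map Complex.ofReal)).toReal

namespace LinearRepresentation

section Model

variable {ι : Type*} [Fintype ι] [DecidableEq ι] (R : LinearRepresentation ι)

/-- The matrix `M = A + B`. -/
def M : Matrix ι ι ℝ := R.A + R.B

/-- The matrix of a letter. -/
def letterMatrix : Letter → Matrix ι ι ℝ
  | Letter.a => R.A
  | Letter.b => R.B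

/-- The monoid morphism `μ` generated by `μ(a) = A` and `μ(b) = B`. -/
def wordMatrix (w : List Letter) : Matrix ι ι ℝ := (w.map R.letterMatrix).prod

/-- The value `(r, w) = ξ' μ(w) η` of the rational series `r` at the word `w`. -/
def series (w : List Letter) : ℝ := R.xi ⬝ᵥ (R.wordMatrix w).mulVec R.eta

/-- `Pr(w) = (r, w) / ∑_{|x| = n} (r, x)` for a word `w` of length `n`. -/
noncomputable def wordProb {n : ℕ} (w : Fin n → Letter) : ℝ :=
  R.series (List.ofFn w) / ∑ x : Fin n → Letter, R.series (List.ofFn x)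

/-- `Pr(Y_n = k)`, where `Y_n = |w|_a` for a random word `w` of length `n`. -/
noncomputable def prob (n k : ℕ) : ℝ :=
  ∑ w : Fin n → Letter with (List.ofFn w).count Letter.a = k, R.wordProb w

/-- `(ξ, A, B, η)` defines a sequence `Y_n`: `A ≠ 0 ≠ B` and for every `n ≥ 1` some word of
length `n` has positive weight. -/
structure IsRationalModel : Prop where
  A_ne_zero : R.A ≠ 0
  B_ne_zero : R.B ≠ 0
  exists_pos : ∀ n : ℕ, 1 ≤ n → ∃ w : Fin n → Letter, 0 < R.series (List.ofFn w)

/-- `u` is analytic at `0`, `u(0) = λ` and `det (u(z) I - A e^z - B) = 0` for `z` near `0`. -/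
def IsEigenvalueBranch (u : ℂ → ℂ) : Prop :=
  AnalyticAt ℂ u 0 ∧ u 0 = (perronEigenvalue R.M : ℂ) ∧
    ∀ᶠ z in nhds (0 : ℂ),
      (u z • (1 : Matrix ι ι ℂ) - Complex.exp z • R.A.map Complex.ofReal
        - R.B.map Complex.ofReal).det = 0

open Classical in
/-- The function `u(z)` implicitly defined near `0` by `det (u I - A e^z - B) = 0`, `u(0) = λ`.
If `A + B` is primitive, it exists and its germ at `0` is unique. -/
noncomputable def u : ℂ → ℂ :=
  if h : ∃ u : ℂ → ℂ, R.IsEigenvalueBranch u then h.choose else 0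

/-- `β = u'(0) / λ` (a real number). -/
noncomputable def beta : ℝ := (deriv R.u 0).re / perronEigenvalue R.M

/-- `γ = u''(0) / λ - (u'(0) / λ)²` (a real number). -/
noncomputable def gamma : ℝ :=
  (iteratedDeriv 2 R.u 0).re / perronEigenvalue R.M - R.beta ^ 2

end Model

/-- The linear representation with `ξ = (ξ₁, ξ₂)`, `A = (A₁ A₀; 0 A₂)`, `B = (B₁ B₀; 0 B₂)`,
`η = (η₁, η₂)`. -/
def bicomponent {ι₁ ι₂ : Type*} (R₁ : LinearRepresentation ι₁) (R₂ : LinearRepresentation ι₂)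
    (A₀ B₀ : Matrix ι₁ ι₂ ℝ) (hA₀ : ∀ i j, 0 ≤ A₀ i j) (hB₀ : ∀ i j, 0 ≤ B₀ i j) :
    LinearRepresentation (ι₁ ⊕ ι₂) where
  xi := Sum.elim R₁.xi R₂.xi
  A := Matrix.fromBlocks R₁.A A₀ 0 R₂.A
  B := Matrix.fromBlocks R₁.B B₀ 0 R₂.B
  eta := Sum.elim R₁.eta R₂.eta
  xi_nonneg := by
    rintro (i | i)
    · exact R₁.xi_nonneg i
    · exact R₂.xi_nonneg i
  A_nonneg := by
    rintro (i | i) (j | j)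
    · exact R₁.A_nonneg i j
    · exact hA₀ i j
    · exact le_refl _
    · exact R₂.A_nonneg i j
  B_nonneg := by
    rintro (i | i) (j | j)
    · exact R₁.B_nonneg i j
    · exact hB₀ i j
    · exact le_refl _
    · exact R₂.B_nonneg i j
  eta_nonneg := by
    rintro (i | i)
    · exact R₁.eta_nonneg i
    · exact R₂.eta_nonneg i

end LinearRepresentation

/-- Equipotent communicating bicomponent model with components `R₁`, `R₂` and connecting
matrices `A₀`, `B₀`. -/
structure IsEquipotentCommunicating {ι₁ ι₂ : Type*} [Fintype ι₁] [DecidableEq ι₁]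
    [Fintype ι₂] [DecidableEq ι₂] (R₁ : LinearRepresentation ι₁) (R₂ : LinearRepresentation ι₂)
    (A₀ B₀ : Matrix ι₁ ι₂ ℝ) (hA₀ : ∀ i j, 0 ≤ A₀ i j) (hB₀ : ∀ i j, 0 ≤ B₀ i j) : Prop where
  isRationalModel : (R₁.bicomponent R₂ A₀ B₀ hA₀ hB₀).IsRationalModel
  irreducible₁ : R₁.M.IsIrreducible
  irreducible₂ : R₂.M.IsIrreducible
  xi₁_ne_zero : R₁.xi ≠ 0
  eta₂_ne_zero : R₂.eta ≠ 0
  M₀_ne_zero : A₀ + B₀ ≠ 0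
  eigenvalue_eq : perronEigenvalue R₁.M = perronEigenvalue R₂.M
  aperiodic₁ : IsAperiodicMatrix R₁.M
  aperiodic₂ : IsAperiodicMatrix R₂.M

/-- With `γ = (γ₁ + γ₂) / 2`, the density
`f_T(x) = γ / (γ₂ - γ₁) * ∫_{γ₁/γ}^{γ₂/γ} exp (-x² / (2 s)) / √(2 π s) ds`. -/
noncomputable def mixtureDensity (γ₁ γ₂ x : ℝ) : ℝ :=
  ((γ₁ + γ₂) / 2) / (γ₂ - γ₁) *
    ∫ s in (γ₁ / ((γ₁ + γ₂) / 2))..(γ₂ / ((γ₁ + γ₂) / 2)),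
      Real.exp (-x ^ 2 / (2 * s)) / √(2 * Real.pi * s)

end SymbolStatistics

open SymbolStatistics

/-! ### Sums over words and labelled walks. -/

namespace SymbolStatistics

open Matrix Filter Topology

/-! For `z = e^{it}` the quantity `ξ' (zA + B)^n η` is the Fourier polynomial whose `k`-th
coefficient is the total weight of the words of length `n` with `k` letters `a`. The matrices are
block triangular, so the polynomial splits into two pure terms, of size `O(λ^n)`, and `n` transition
terms `ξ₁' (zA₁ + B₁)^i (zA₀ + B₀) (zA₂ + B₂)^j η₂` with `i + j = n - 1`.

After division by `λ^{n-1}`, a transition term is close to a constant `g > 0` times the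
characteristic function of a normal law with mean `β n` and variance `γ₁ i + γ₂ j`. The law of `Y_n`
is therefore nearly the average of normal laws of variance `γ₁ s + γ₂ (n - s)` over a transition
time `s` uniform in `[0, n]`. An affine substitution in `s` turns this average into `f_T`.

Three facts about each component support this. Perron–Frobenius theory with a spectral gap gives an
analytic eigenvalue branch and `(e^z A + B)^n = u(z)^n E(z) + O(r^n)` with `r < λ`
(`exists_spectral_expansion`). The function `u(z)/λ` agrees with `exp (βz + γz²/2)` up to `O(z³)`
(`u_div_sub_exp_isBigO`). Aperiodicity of the pair gives the bound `C e^{-cnt²} λ^n` on all of `[-π,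
π]` (`exists_norm_charMatrix_pow_le`), so that no separate treatment of intermediate `t` is needed;
it also forces `γ > 0`.

The errors add up as follows. A transition term contributes to a Fourier coefficient an error `O(ρ^i
+ ρ^j + 1/n)`, hence `O(1)` after summation over the `n` terms
(`exists_norm_sum_fourierCoeff_sub_le`). The total mass is `n g + O(√n)`. Dividing, and multiplying
by `√(γn)`, leaves `O(n^{-1/2})` (`exists_abs_sqrt_mul_div_sub_le`). -/

lemma map_ofReal_mul {l m n : Type*} [Fintype m] (A : Matrix l m ℝ) (B : Matrix m n ℝ) :
    (A * B).map Complex.ofReal = A.map Complex.ofReal * B.map Complex.ofReal :=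
  Matrix.map_mul (f := Complex.ofRealHom)

lemma map_ofReal_pow {m : Type*} [Fintype m] [DecidableEq m] (A : Matrix m m ℝ) (n : ℕ) :
    (A ^ n).map Complex.ofReal = A.map Complex.ofReal ^ n :=
  Matrix.map_pow A Complex.ofRealHom n

namespace LinearRepresentation

variable {ι : Type*} [Fintype ι] [DecidableEq ι] (R : LinearRepresentation ι)

/-- The matrix `z A + B` with complex entries. -/
noncomputable def charMatrix (z : ℂ) : Matrix ι ι ℂ :=
  z • R.A.map Complex.ofReal + R.B.map Complex.ofReal

omit [Fintype ι] [DecidableEq ι] in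
lemma charMatrix_apply (z : ℂ) (i j : ι) :
    R.charMatrix z i j = z * (R.A i j : ℂ) + (R.B i j : ℂ) := by
  simp [charMatrix]

omit [Fintype ι] [DecidableEq ι] in
lemma charMatrix_one : R.charMatrix 1 = R.M.map Complex.ofReal := by
  ext i j
  simp [charMatrix_apply, M]

lemma wordMatrix_cons (l : Letter) (w : List Letter) :
    R.wordMatrix (l :: w) = R.letterMatrix l * R.wordMatrix w := by
  simp [wordMatrix]

lemma wordMatrix_nonneg (w : List Letter) (i j : ι) : 0 ≤ R.wordMatrix w i j := by
  induction w generalizing i with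
  | nil =>
    simp only [wordMatrix, List.map_nil, List.prod_nil, Matrix.one_apply]
    split_ifs <;> simp
  | cons l w ih =>
    rw [wordMatrix_cons, Matrix.mul_apply]
    refine Finset.sum_nonneg fun k _ => mul_nonneg ?_ (ih k)
    cases l
    · exact R.A_nonneg i k
    · exact R.B_nonneg i k

lemma sum_letter {α : Type*} [AddCommMonoid α] (f : Letter → α) :
    ∑ l, f l = f Letter.a + f Letter.b := by
  have : (Finset.univ : Finset Letter) = {Letter.a, Letter.b} := rfl
  rw [this, Finset.sum_pair (by decide)]

/-- Expanding the product of `n` factors `zA + B` produces one term per word, in which each letter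
`a` contributes a factor `z`. The induction splits off the first letter. -/
lemma sum_words_eq_pow (z : ℂ) (n : ℕ) :
    ∑ w : Fin n → Letter, z ^ ((List.ofFn w).count Letter.a) •
      (R.wordMatrix (List.ofFn w)).map Complex.ofReal = R.charMatrix z ^ n := by
  induction n with
  | zero => simp [wordMatrix]
  | succ n ih =>
    rw [← (Fin.consEquiv (fun _ : Fin (n + 1) => Letter)).sum_comp, Fintype.sum_prod_type,
      sum_letter, pow_succ', ← ih, charMatrix, add_mul, Finset.mul_sum, Finset.mul_sum]
    congr 1
    · refine Finset.sum_congr rfl fun w _ => ?_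
      simp only [Fin.consEquiv, Equiv.coe_fn_mk, List.ofFn_cons, wordMatrix_cons,
        List.count_cons_self, letterMatrix]
      rw [map_ofReal_mul, smul_mul_smul_comm, pow_succ']
    · refine Finset.sum_congr rfl fun w _ => ?_
      simp only [Fin.consEquiv, Equiv.coe_fn_mk, List.ofFn_cons, wordMatrix_cons, letterMatrix]
      rw [map_ofReal_mul, mul_smul_comm, List.count_cons_of_ne (by decide)]

lemma charMatrix_pow_apply (z : ℂ) (n : ℕ) (i j : ι) :
    (R.charMatrix z ^ n) i j = ∑ w : Fin n → Letter, z ^ ((List.ofFn w).count Letter.a) *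
      (R.wordMatrix (List.ofFn w) i j : ℂ) := by
  rw [← sum_words_eq_pow]
  simp [Matrix.sum_apply]

lemma charMatrix_one_pow (n : ℕ) : R.charMatrix 1 ^ n = (R.M ^ n).map Complex.ofReal := by
  rw [charMatrix_one, map_ofReal_pow]

lemma M_pow_apply (n : ℕ) (i j : ι) :
    (R.M ^ n) i j = ∑ w : Fin n → Letter, R.wordMatrix (List.ofFn w) i j := by
  have h := R.charMatrix_pow_apply 1 n i j
  rw [charMatrix_one_pow] at h
  simp only [Matrix.map_apply, one_pow, one_mul] at h
  exact_mod_cast h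

omit [Fintype ι] [DecidableEq ι] in
lemma M_nonneg (i j : ι) : 0 ≤ R.M i j := add_nonneg (R.A_nonneg i j) (R.B_nonneg i j)

lemma M_pow_nonneg (n : ℕ) (i j : ι) : 0 ≤ (R.M ^ n) i j := pow_apply_nonneg R.M_nonneg n i j

/-- The expansion over words has nonnegative coefficients, so this is the triangle inequality. The
deficiency estimates below quantify how far it is from equality. -/
lemma norm_charMatrix_pow_apply_le {z : ℂ} (hz : ‖z‖ = 1) (n : ℕ) (i j : ι) :
    ‖(R.charMatrix z ^ n) i j‖ ≤ (R.M ^ n) i j := by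
  rw [charMatrix_pow_apply, M_pow_apply]
  refine (norm_sum_le _ _).trans (Finset.sum_le_sum fun w _ => ?_)
  simp [hz, abs_of_nonneg (R.wordMatrix_nonneg (List.ofFn w) i j)]

/-- Nonnegative entries cannot cancel. This links the combinatorial aperiodicity hypothesis to the
sizes of matrix entries. -/
lemma wordMatrix_pos_iff (w : List Letter) (i j : ι) :
    0 < R.wordMatrix w i j ↔ IsWalk R.A R.B i j w := by
  induction w generalizing i with
  | nil =>
    constructor
    · intro h
      by_cases hij : i = j
      · subst hij; exact IsWalk.nil i
      · simp [wordMatrix, hij] at h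
    · rintro ⟨⟩
      simp [wordMatrix]
  | cons l w ih =>
    have hl : ∀ i k, 0 ≤ R.letterMatrix l i k := by
      intro i k
      cases l
      · exact R.A_nonneg i k
      · exact R.B_nonneg i k
    rw [wordMatrix_cons, Matrix.mul_apply, Finset.sum_pos_iff_of_nonneg
      (fun k _ => mul_nonneg (hl i k) (R.wordMatrix_nonneg w k j))]
    constructor
    · rintro ⟨k, _, hk⟩
      have h1 := pos_of_mul_pos_left hk (R.wordMatrix_nonneg w k j)
      have h2 := (ih k).1 (pos_of_mul_pos_right hk (hl i k))
      cases l
      · exact IsWalk.consA h1 h2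
      · exact IsWalk.consB h1 h2
    · intro h
      cases h with
      | consA h hw => exact ⟨_, Finset.mem_univ _, mul_pos h ((ih _).2 hw)⟩
      | consB h hw => exact ⟨_, Finset.mem_univ _, mul_pos h ((ih _).2 hw)⟩

lemma M_pow_pos_iff (n : ℕ) (i j : ι) :
    0 < (R.M ^ n) i j ↔ ∃ w : List Letter, w.length = n ∧ IsWalk R.A R.B i j w := by
  rw [M_pow_apply, Finset.sum_pos_iff_of_nonneg (fun w _ => R.wordMatrix_nonneg _ i j)]
  constructor
  · rintro ⟨w, _, hw⟩
    exact ⟨List.ofFn w, by simp, (R.wordMatrix_pos_iff _ i j).1 hw⟩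
  · rintro ⟨w, rfl, hw⟩
    refine ⟨fun k => w[k], Finset.mem_univ _, ?_⟩
    rw [wordMatrix_pos_iff]
    simpa using hw

end LinearRepresentation

lemma IsWalk.append {ι : Type*} {A B : Matrix ι ι ℝ} {i j k : ι} {w w' : List Letter}
    (h : IsWalk A B i j w) (h' : IsWalk A B j k w') : IsWalk A B i k (w ++ w') := by
  induction h with
  | nil => exact h'
  | consA h _ ih => exact IsWalk.consA h (ih h')
  | consB h _ ih => exact IsWalk.consB h (ih h')

/-! ### Positivity of large powers. -/

section Primitive

variable {ι : Type*} [Fintype ι] [DecidableEq ι]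

lemma pow_add_apply_pos {M : Matrix ι ι ℝ} (hM : ∀ i j, 0 ≤ M i j) {m n : ℕ} {i j k : ι}
    (h₁ : 0 < (M ^ m) i j) (h₂ : 0 < (M ^ n) j k) : 0 < (M ^ (m + n)) i k := by
  rw [pow_add, Matrix.mul_apply]
  exact Finset.sum_pos' (fun l _ => mul_nonneg (pow_apply_nonneg hM m i l)
    (pow_apply_nonneg hM n l k)) ⟨j, Finset.mem_univ _, mul_pos h₁ h₂⟩

/-- All large powers of an irreducible aperiodic matrix are entrywise positive. -/
lemma exists_forall_pow_pos {M : Matrix ι ι ℝ} (hirr : M.IsIrreducible)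
    (hap : IsAperiodicMatrix M) : ∃ N, ∀ n, N ≤ n → ∀ i j, 0 < (M ^ n) i j := by
  have hM := hirr.nonneg
  have hirr' := (isIrreducible_iff_exists_pow_pos hM).1 hirr
  have hdiag : ∀ i, ∃ N, ∀ n, N ≤ n → 0 < (M ^ n) i i := by
    intro i
    -- All large multiples of the gcd lie in the additive monoid generated by the return times.
    -- Return times are closed under addition, and `M ^ 0` has diagonal entry `1`, so the whole
    -- monoid consists of exponents with a positive diagonal entry.
    obtain ⟨N, hN⟩ := Nat.exists_mem_closure_of_ge {k : ℕ | 0 < k ∧ 0 < (M ^ k) i i}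
    have h1 : Nat.setGcd {k : ℕ | 0 < k ∧ 0 < (M ^ k) i i} = 1 :=
      hap i _ fun k hk hk' => Nat.setGcd_dvd_of_mem ⟨hk, hk'⟩
    refine ⟨N, fun n hn => ?_⟩
    have := hN n hn (by rw [h1]; exact one_dvd n)
    clear hn
    induction this using AddSubmonoid.closure_induction with
    | mem x hx => exact hx.2
    | zero => simp
    | add x y _ _ hx hy => exact pow_add_apply_pos hM hx hy
  choose D hD using hdiag
  choose K _ hK using hirr'
  -- A walk of length `n` from `i` to `j` loops at `i` for `n - K i j` steps, at least `D i`, and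
  -- then takes the `K i j` steps to `j`.
  refine ⟨∑ i, D i + ∑ i, ∑ j, K i j, fun n hn i j => ?_⟩
  have h1 : D i ≤ ∑ i, D i := Finset.single_le_sum (fun _ _ => Nat.zero_le _) (Finset.mem_univ i)
  have h2 : K i j ≤ ∑ j, K i j :=
    Finset.single_le_sum (fun _ _ => Nat.zero_le _) (Finset.mem_univ j)
  have h3 : ∑ j, K i j ≤ ∑ i, ∑ j, K i j :=
    Finset.single_le_sum (f := fun i => ∑ j, K i j) (fun _ _ => Nat.zero_le _) (Finset.mem_univ i)
  have := pow_add_apply_pos hM (hD i (n - K i j) (by omega)) (hK i j)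
  rwa [Nat.sub_add_cancel (by omega)] at this

end Primitive

end SymbolStatistics

/-! ### Perron–Frobenius theory and the spectral gap. -/

namespace SymbolStatistics

open Matrix Filter Topology
open scoped Matrix.Norms.Operator

section OperatorNorm

variable {m n : Type*} [Fintype m] [Fintype n]

lemma norm_le_card_mul (A : Matrix m n ℂ) {c : ℝ} (hc : 0 ≤ c) (h : ∀ i j, ‖A i j‖ ≤ c) :
    ‖A‖ ≤ Fintype.card n * c := by
  rw [Matrix.linfty_opNorm_def]
  lift c to NNReal using hc
  have : (Finset.univ.sup fun i => ∑ j, ‖A i j‖₊) ≤ (Fintype.card n : NNReal) * c := by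
    refine Finset.sup_le fun i _ => ?_
    have := Finset.sum_le_card_nsmul (Finset.univ : Finset n) (fun j => ‖A i j‖₊) c
      (fun j _ => by exact_mod_cast h i j)
    simpa using this
  exact_mod_cast this

end OperatorNorm

/-- If some power of `a` is bounded by `r ^ m`, then all powers of `a` are `O(r ^ n)`, with a
constant that depends only on `m`, `r` and a bound of `‖a‖`. -/
lemma norm_pow_le_of_norm_pow_le {A : Type*} [NormedRing A] {a : A} {m : ℕ} (hm : 0 < m)
    {r K : ℝ} (hr : 0 < r) (hrK : r ≤ K) (ha : ‖a‖ ≤ K) (ham : ‖a ^ m‖ ≤ r ^ m) (n : ℕ) :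
    ‖a ^ n‖ ≤ ‖(1 : A)‖ * (K / r) ^ m * r ^ n := by
  have hpow : ∀ (b : A) (k : ℕ), ‖b ^ k‖ ≤ ‖(1 : A)‖ * ‖b‖ ^ k := by
    intro b k
    induction k with
    | zero => simp
    | succ k ih =>
      rw [pow_succ, pow_succ, ← mul_assoc]
      exact (norm_mul_le _ _).trans (mul_le_mul_of_nonneg_right ih (norm_nonneg _))
  have h1 : ∀ k j : ℕ, ‖(a ^ m) ^ k * a ^ j‖ ≤ ‖(1 : A)‖ * (r ^ m) ^ k * K ^ j := by
    intro k j
    induction j with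
    | zero =>
      rw [pow_zero, pow_zero, mul_one, mul_one]
      refine (hpow _ k).trans ?_
      gcongr
    | succ j ih =>
      rw [pow_succ, pow_succ, ← mul_assoc, ← mul_assoc]
      refine (norm_mul_le _ _).trans ?_
      exact mul_le_mul ih ha (norm_nonneg _) (by have := hr.le.trans hrK; positivity)
  have hK : 0 < K := hr.trans_le hrK
  -- Write `n = m q + s` with `s < m`: the power `q` of `a ^ m` is controlled by `r`, and the
  -- remaining `s` factors cost at most `(K / r) ^ m`.
  rw [← Nat.div_add_mod n m, pow_add, pow_mul, pow_add, pow_mul]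
  refine (h1 _ _).trans ?_
  have h2 : K ^ (n % m) ≤ (K / r) ^ m * r ^ (n % m) := by
    have : K ^ (n % m) = (K / r) ^ (n % m) * r ^ (n % m) := by
      rw [← mul_pow, div_mul_cancel₀ _ hr.ne']
    rw [this]
    gcongr
    · exact (one_le_div hr).2 hrK
    · exact (Nat.mod_lt _ hm).le
  calc ‖(1 : A)‖ * (r ^ m) ^ (n / m) * K ^ (n % m)
      ≤ ‖(1 : A)‖ * (r ^ m) ^ (n / m) * ((K / r) ^ m * r ^ (n % m)) := by gcongr
    _ = _ := by ring

section Perron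

variable {ι : Type*} [Fintype ι] [DecidableEq ι]

omit [Fintype ι] [DecidableEq ι] in
lemma mulVec_pos_of_pos {κ : Type*} [Fintype κ] {A : Matrix ι κ ℝ} (hA : ∀ i j, 0 < A i j)
    {x : κ → ℝ} (hx : ∀ i, 0 ≤ x i) (hx0 : x ≠ 0) (i : ι) : 0 < (A *ᵥ x) i := by
  obtain ⟨j, hj⟩ := Function.ne_iff.1 hx0
  exact Finset.sum_pos' (fun k _ => mul_nonneg (hA i k).le (hx k))
    ⟨j, Finset.mem_univ _, mul_pos (hA i j) (lt_of_le_of_ne (hx j) (Ne.symm hj))⟩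

omit [DecidableEq ι] in
lemma mulVec_mono {A : Matrix ι ι ℝ} (hA : ∀ i j, 0 ≤ A i j) {x y : ι → ℝ} (h : ∀ i, x i ≤ y i)
    (i : ι) : (A *ᵥ x) i ≤ (A *ᵥ y) i :=
  Finset.sum_le_sum fun k _ => mul_le_mul_of_nonneg_left (h k) (hA i k)

lemma pow_mulVec_of_eigen {𝕜 : Type*} [CommRing 𝕜] {A : Matrix ι ι 𝕜} {x : ι → 𝕜} {l : 𝕜}
    (h : A *ᵥ x = l • x) (n : ℕ) : A ^ n *ᵥ x = l ^ n • x := by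
  induction n with
  | zero => simp
  | succ n ih => rw [pow_succ, ← Matrix.mulVec_mulVec, h, Matrix.mulVec_smul, ih, smul_smul,
      pow_succ, mul_comm]

/-- A nonnegative matrix that expands a positive vector by a factor `c` has spectral radius
at least `c`. -/
lemma le_perronEigenvalue_of_mulVec {M : Matrix ι ι ℝ} (hM : ∀ i j, 0 ≤ M i j) {b : ι → ℝ}
    (hb : ∀ i, 0 ≤ b i) (hb0 : b ≠ 0) {c : ℝ} (hc : 0 ≤ c) (h : ∀ i, c * b i ≤ (M *ᵥ b) i) :
    c ≤ perronEigenvalue M := by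
  have hpow : ∀ n i, c ^ n * b i ≤ ((M ^ n) *ᵥ b) i := by
    intro n
    induction n with
    | zero => simp
    | succ n ih =>
      intro i
      have h1 := mulVec_mono (pow_apply_nonneg hM n) h i
      rw [Matrix.mulVec_mulVec, ← pow_succ] at h1
      refine le_trans ?_ h1
      have : (M ^ n *ᵥ fun i => c * b i) i = c * (M ^ n *ᵥ b) i := by
        exact congrFun (Matrix.mulVec_smul (M ^ n) c b) i
      rw [this, pow_succ']
      have := mul_le_mul_of_nonneg_left (ih i) hc
      linarith
  have hbn : 0 < ‖b‖ := norm_pos_iff.2 hb0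
  -- Since `M ^ n` expands `b` by at least `c ^ n`, so does its operator norm; Gelfand's formula
  -- then passes this to the spectral radius.
  have hnorm : ∀ n, c ^ n ≤ ‖(M.map Complex.ofReal) ^ n‖ := by
    intro n
    have h1 : c ^ n * ‖b‖ ≤ ‖(M.map Complex.ofReal) ^ n‖ * ‖b‖ := by
      have hbc : ‖fun i => (b i : ℂ)‖ = ‖b‖ := by simp [Pi.norm_def]
      have h2 := Matrix.linfty_opNorm_mulVec ((M.map Complex.ofReal) ^ n) (fun i => (b i : ℂ))
      rw [hbc] at h2
      refine le_trans ?_ h2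
      rw [← abs_of_nonneg (pow_nonneg hc n), ← Real.norm_eq_abs, ← norm_smul]
      refine (pi_norm_le_iff_of_nonneg (norm_nonneg _)).2 fun i => ?_
      refine le_trans ?_ (norm_le_pi_norm _ i)
      have h3 : ((M.map Complex.ofReal) ^ n *ᵥ fun i => (b i : ℂ)) i = (((M ^ n) *ᵥ b) i : ℝ) := by
        rw [← map_ofReal_pow]
        simp [Matrix.mulVec, dotProduct]
      rw [h3, Complex.norm_real, Pi.smul_apply, smul_eq_mul, Real.norm_eq_abs, Real.norm_eq_abs,
        abs_of_nonneg (mul_nonneg (pow_nonneg hc n) (hb i))]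
      exact (hpow n i).trans (le_abs_self _)
    exact le_of_mul_le_mul_right h1 hbn
  have hlim := spectrum.pow_norm_pow_one_div_tendsto_nhds_spectralRadius (M.map Complex.ofReal)
  have hle : ENNReal.ofReal c ≤ spectralRadius ℂ (M.map Complex.ofReal) := by
    refine ge_of_tendsto hlim ?_
    filter_upwards [eventually_gt_atTop 0] with n hn
    refine ENNReal.ofReal_le_ofReal ?_
    calc c = (c ^ n) ^ (1 / n : ℝ) := by
          rw [one_div, Real.pow_rpow_inv_natCast hc hn.ne']
      _ ≤ _ := Real.rpow_le_rpow (pow_nonneg hc n) (hnorm n) (by positivity)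
  -- Finiteness matters because `toReal` would send an infinite radius to `0`.
  have hfin : spectralRadius ℂ (M.map Complex.ofReal) ≠ ⊤ := by
    refine ne_top_of_le_ne_top ?_ (spectrum.spectralRadius_le_pow_nnnorm_pow_one_div ℂ _ 0)
    simpa using ENNReal.mul_ne_top ENNReal.coe_ne_top ENNReal.coe_ne_top
  rw [perronEigenvalue]
  exact (ENNReal.ofReal_le_iff_le_toReal hfin).1 hle

/-- Wielandt's argument. For an eigenvector `x` of an eigenvalue of maximal modulus, `a = |x|`
satisfies `l a ≤ M a`. If this were not an equality, applying the positive matrix `M ^ N` would make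
it strict in every coordinate, and `M` would expand a positive vector by a factor larger than its
spectral radius. Positivity of `a` and of `l` then follows from `M ^ (N + 1) a = l ^ (N + 1) a`. -/
lemma exists_perron_right [Nonempty ι] {M : Matrix ι ι ℝ} (hM : ∀ i j, 0 ≤ M i j)
    (hpos : ∃ N, ∀ n, N ≤ n → ∀ i j, 0 < (M ^ n) i j) :
    0 < perronEigenvalue M ∧ ∃ v : ι → ℝ, (∀ i, 0 < v i) ∧ M *ᵥ v = perronEigenvalue M • v := by
  obtain ⟨N, hN⟩ := hpos
  obtain ⟨z, hz, hzr⟩ := spectrum.exists_nnnorm_eq_spectralRadius (M.map Complex.ofReal)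
  have hlam : perronEigenvalue M = ‖z‖ := by
    rw [perronEigenvalue, ← hzr]; simp
  set l := perronEigenvalue M with hl
  have hl0 : 0 ≤ l := hlam ▸ norm_nonneg z
  obtain ⟨x, hx0, hx⟩ : ∃ x ≠ 0, (M.map Complex.ofReal) *ᵥ x = z • x := by
    rw [spectrum.mem_iff, Matrix.isUnit_iff_isUnit_det, isUnit_iff_ne_zero, not_not] at hz
    obtain ⟨x, hx0, hx⟩ := Matrix.exists_mulVec_eq_zero_iff.2 hz
    refine ⟨x, hx0, ?_⟩
    rw [Matrix.sub_mulVec, sub_eq_zero, Algebra.algebraMap_eq_smul_one, Matrix.smul_mulVec,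
      Matrix.one_mulVec] at hx
    exact hx.symm
  set a : ι → ℝ := fun i => ‖x i‖ with ha
  have ha0 : ∀ i, 0 ≤ a i := fun i => norm_nonneg _
  have hane : a ≠ 0 := by
    intro h
    apply hx0
    ext i
    simpa [ha] using congrFun h i
  have hsub : ∀ i, l * a i ≤ (M *ᵥ a) i := by
    intro i
    have h1 := congrFun hx i
    have h2 : l * a i = ‖(M.map Complex.ofReal *ᵥ x) i‖ := by
      rw [h1, hlam, Pi.smul_apply, norm_smul]
    rw [h2]
    refine (norm_sum_le _ _).trans (le_of_eq ?_)
    refine Finset.sum_congr rfl fun j _ => ?_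
    simp [ha, abs_of_nonneg (hM i j)]
  have hNpos := hN N le_rfl
  have heq : M *ᵥ a = l • a := by
    by_contra hne
    have hd0 : M *ᵥ a - l • a ≠ 0 := sub_ne_zero.2 hne
    have hd := mulVec_pos_of_pos hNpos (x := M *ᵥ a - l • a)
      (fun i => by simpa using hsub i) hd0
    have hb := mulVec_pos_of_pos hNpos ha0 hane
    set b := M ^ N *ᵥ a with hbdef
    have hMb : ∀ i, l * b i < (M *ᵥ b) i := by
      intro i
      have h1 := hd i
      rw [Matrix.mulVec_sub, Matrix.mulVec_smul, Matrix.mulVec_mulVec, ← pow_succ, pow_succ',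
        ← Matrix.mulVec_mulVec] at h1
      exact sub_pos.1 h1
    -- The smallest ratio `(M b)_i / b_i` is the expansion factor of `b`; it exceeds `l` because
    -- every ratio does.
    obtain ⟨i₀, -, hi₀⟩ := Finset.exists_min_image (Finset.univ : Finset ι)
      (fun i => (M *ᵥ b) i / b i) Finset.univ_nonempty
    have h1 : l < (M *ᵥ b) i₀ / b i₀ := (lt_div_iff₀ (hb i₀)).2 (hMb i₀)
    have h2 := le_perronEigenvalue_of_mulVec hM (fun i => (hb i).le)
      (fun h => (hb i₀).ne' (congrFun h i₀)) (hl0.trans h1.le)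
      (fun i => (le_div_iff₀ (hb i)).1 (hi₀ i (Finset.mem_univ i)))
    exact absurd (h1.trans_le h2) (lt_irrefl _)
  have hbig : ∀ i, 0 < l ^ (N + 1) * a i := by
    intro i
    have h1 := mulVec_pos_of_pos (hN (N + 1) (Nat.le_succ N)) ha0 hane i
    rw [pow_mulVec_of_eigen heq] at h1
    simpa using h1
  have hlpos : 0 < l := by
    obtain ⟨i⟩ := ‹Nonempty ι›
    refine lt_of_le_of_ne hl0 fun h => ?_
    have := hbig i
    rw [← h] at this
    simp at this
  exact ⟨hlpos, a, fun i => pos_of_mul_pos_right (hbig i) (pow_nonneg hl0 _), heq⟩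

/-- The left vector is a right Perron vector of the transpose. Evaluating `w' M v` in two ways shows
that both eigenvalues coincide, since `w ⬝ᵥ v > 0`; rescaling `w` normalises the pair. -/
lemma exists_perron_vectors [Nonempty ι] {M : Matrix ι ι ℝ} (hM : ∀ i j, 0 ≤ M i j)
    (hpos : ∃ N, ∀ n, N ≤ n → ∀ i j, 0 < (M ^ n) i j) :
    ∃ v w : ι → ℝ, (∀ i, 0 < v i) ∧ (∀ i, 0 < w i) ∧ M *ᵥ v = perronEigenvalue M • v ∧
      w ᵥ* M = perronEigenvalue M • w ∧ w ⬝ᵥ v = 1 := by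
  obtain ⟨-, v, hv, hMv⟩ := exists_perron_right hM hpos
  obtain ⟨-, w, hw, hMw⟩ := exists_perron_right (M := Mᵀ) (fun i j => hM j i) (by
    obtain ⟨N, hN⟩ := hpos
    refine ⟨N, fun n hn i j => ?_⟩
    rw [← Matrix.transpose_pow]
    exact hN n hn j i)
  rw [Matrix.mulVec_transpose] at hMw
  have hwv : 0 < w ⬝ᵥ v :=
    Finset.sum_pos (fun i _ => mul_pos (hw i) (hv i)) Finset.univ_nonempty
  have h1 : w ⬝ᵥ (M *ᵥ v) = (w ᵥ* M) ⬝ᵥ v := Matrix.dotProduct_mulVec _ _ _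
  rw [hMv, hMw, dotProduct_smul, smul_dotProduct, smul_eq_mul, smul_eq_mul] at h1
  have h2 := mul_right_cancel₀ hwv.ne' h1
  rw [← h2] at hMw
  refine ⟨v, (w ⬝ᵥ v)⁻¹ • w, hv, fun i => mul_pos (inv_pos.2 hwv) (hw i), hMv, ?_, ?_⟩
  · rw [Matrix.smul_vecMul, hMw, smul_comm]
  · rw [smul_dotProduct, smul_eq_mul, inv_mul_cancel₀ hwv.ne']

lemma pow_apply_le_of_eigen {S : Matrix ι ι ℝ} (hS : ∀ i j, 0 ≤ S i j) {v : ι → ℝ}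
    (hv : ∀ i, 0 < v i) {c : ℝ} (h : S *ᵥ v = c • v) (n : ℕ) (i j : ι) :
    (S ^ n) i j ≤ c ^ n * (v i / v j) := by
  have h1 := congrFun (pow_mulVec_of_eigen h n) i
  have h2 : (S ^ n) i j * v j ≤ (S ^ n *ᵥ v) i :=
    Finset.single_le_sum (f := fun j => (S ^ n) i j * v j)
      (fun k _ => mul_nonneg (pow_apply_nonneg hS n i k) (hv k).le) (Finset.mem_univ j)
  rw [h1, Pi.smul_apply, smul_eq_mul] at h2
  rw [← mul_div_assoc, le_div_iff₀ (hv j)]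
  exact h2

/-- Powers of `S - c • Q`, where `Q` is a projection with `S Q = Q S = c Q`. -/
lemma sub_smul_pow_mul {𝕜 : Type*} [CommRing 𝕜] {S Q : Matrix ι ι 𝕜} {c : 𝕜} (hQ : Q * Q = Q)
    (hSQ : S * Q = c • Q) (hQS : Q * S = c • Q) (n : ℕ) :
    (S - c • Q) ^ n * (1 - Q) = S ^ n - c ^ n • Q := by
  have hS : ∀ n, S ^ n * Q = c ^ n • Q := by
    intro n
    induction n with
    | zero => simp
    | succ n ih => rw [pow_succ, mul_assoc, hSQ, mul_smul_comm, ih, smul_smul, pow_succ']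
  induction n with
  | zero => simp
  | succ n ih =>
    rw [pow_succ', mul_assoc, ih, sub_mul, mul_sub, mul_sub, mul_smul_comm, hSQ, ← pow_succ',
      smul_mul_assoc, smul_mul_assoc, mul_smul_comm, hQ]
    have : Q * S ^ n = c ^ n • Q := by
      clear ih
      induction n with
      | zero => simp
      | succ n ih => rw [pow_succ, ← mul_assoc, ih, smul_mul_assoc, hQS, smul_smul, pow_succ]
    rw [this, smul_smul, ← pow_succ, sub_self, sub_zero]

/-- One factor `S - c Q` already annihilates `Q`, so the factor `1 - Q` of `sub_smul_pow_mul`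
disappears. At `n = 0` it would not: the two sides would be `1` and `1 - Q`. -/
lemma sub_smul_pow {𝕜 : Type*} [CommRing 𝕜] {S Q : Matrix ι ι 𝕜} {c : 𝕜} (hQ : Q * Q = Q)
    (hSQ : S * Q = c • Q) (hQS : Q * S = c • Q) {n : ℕ} (hn : n ≠ 0) :
    (S - c • Q) ^ n = S ^ n - c ^ n • Q := by
  have h : (S - c • Q) * Q = 0 := by
    rw [sub_mul, hSQ, smul_mul_assoc, hQ, sub_self]
  obtain ⟨k, rfl⟩ := Nat.exists_eq_succ_of_ne_zero hn
  rw [← sub_smul_pow_mul hQ hSQ hQS, mul_sub, mul_one, Nat.succ_eq_add_one, pow_succ,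
    mul_assoc _ _ Q, h, mul_zero,
    sub_zero]

/-- Spectral gap of a primitive matrix: a power of `M - λ v w'` has norm less than the
corresponding power of `λ`. -/
lemma exists_norm_pow_lt [Nonempty ι] {M : Matrix ι ι ℝ}
    (hpos : ∃ N, ∀ n, N ≤ n → ∀ i j, 0 < (M ^ n) i j) {v w : ι → ℝ} (hv : ∀ i, 0 < v i)
    (hw : ∀ i, 0 < w i) {l : ℝ} (hl : 0 < l) (hMv : M *ᵥ v = l • v) (hwM : w ᵥ* M = l • w)
    (hwv : w ⬝ᵥ v = 1) :
    ∃ m, 0 < m ∧ ‖((M - l • vecMulVec v w) ^ m).map Complex.ofReal‖ < l ^ m := by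
  obtain ⟨N₀, hN₀⟩ := hpos
  -- The shift makes the exponent nonzero, as `sub_smul_pow` requires.
  set N := N₀ + 1 with hNdef
  have hN := hN₀ N (Nat.le_succ _)
  set Q := vecMulVec v w with hQdef
  have hQ : Q * Q = Q := by
    rw [hQdef, vecMulVec_mul_vecMulVec, hwv, one_smul]
  have hMQ : M * Q = l • Q := by
    rw [hQdef, mul_vecMulVec, hMv, smul_vecMulVec]
  have hQM : Q * M = l • Q := by
    rw [hQdef, vecMulVec_mul, hwM, vecMulVec_smul]
  -- Doeblin minorisation: the positive matrix `M ^ N` dominates a multiple of the rank-one limit `l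
  -- ^ N Q`. Removing this multiple leaves a nonnegative matrix `S` with the positive eigenvector
  -- `v` and the smaller eigenvalue `(1 - ε) l ^ N`.
  obtain ⟨ε, hε0, hε1, hε⟩ : ∃ ε : ℝ, 0 < ε ∧ ε < 1 ∧
      ∀ i j, ε * l ^ N * (v i * w j) ≤ (M ^ N) i j := by
    obtain ⟨p, -, hp⟩ := Finset.exists_min_image (Finset.univ : Finset (ι × ι))
      (fun p => (M ^ N) p.1 p.2 / (l ^ N * (v p.1 * w p.2))) Finset.univ_nonempty
    have hq : ∀ p : ι × ι, 0 < l ^ N * (v p.1 * w p.2) := fun p =>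
      mul_pos (pow_pos hl N) (mul_pos (hv _) (hw _))
    refine ⟨min (1 / 2) ((M ^ N) p.1 p.2 / (l ^ N * (v p.1 * w p.2))),
      lt_min (by norm_num) (div_pos (hN _ _) (hq p)),
      (min_le_left _ _).trans_lt (by norm_num), fun i j => ?_⟩
    have h1 := hp (i, j) (Finset.mem_univ _)
    have h2 := (le_div_iff₀ (hq (i, j))).1 ((min_le_right (1 / 2 : ℝ) _).trans h1)
    linarith
  set S := M ^ N - (ε * l ^ N) • Q with hSdef
  have hS : ∀ i j, 0 ≤ S i j := by
    intro i j
    simp only [hSdef, Matrix.sub_apply, Matrix.smul_apply, hQdef, vecMulVec_apply, smul_eq_mul]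
    linarith [hε i j]
  set μ := (1 - ε) * l ^ N with hμ
  have hQv : Q *ᵥ v = v := by
    rw [hQdef, vecMulVec_mulVec, hwv]; ext i; simp
  have hSv : S *ᵥ v = μ • v := by
    rw [hSdef, Matrix.sub_mulVec, Matrix.smul_mulVec, hQv, pow_mulVec_of_eigen hMv, ← sub_smul]
    congr 1
    rw [hμ]; ring
  have hMNQ : M ^ N * Q = l ^ N • Q := by
    rw [hQdef, mul_vecMulVec, pow_mulVec_of_eigen hMv, smul_vecMulVec]
  have hQMN : Q * M ^ N = l ^ N • Q := by
    have : ∀ n, Q * M ^ n = l ^ n • Q := by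
      intro n
      induction n with
      | zero => simp
      | succ n ih => rw [pow_succ, ← mul_assoc, ih, smul_mul_assoc, hQM, smul_smul, pow_succ]
    exact this N
  have hSQ : S * Q = μ • Q := by
    rw [hSdef, sub_mul, hMNQ, smul_mul_assoc, hQ, ← sub_smul, hμ]; congr 1; ring
  have hQS : Q * S = μ • Q := by
    rw [hSdef, mul_sub, hQMN, mul_smul_comm, hQ, ← sub_smul, hμ]; congr 1; ring
  -- `(M - l Q) ^ N = M ^ N - l ^ N Q = S - μ Q`, so the powers of `M - l Q` grow only like those of
  -- `μ`.
  have hkey : ∀ k, k ≠ 0 → (M - l • Q) ^ (N * k) = S ^ k - μ ^ k • Q := by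
    intro k hk
    rw [pow_mul, sub_smul_pow hQ hMQ hQM (by omega), ← sub_smul_pow hQ hSQ hQS hk]
    congr 1
    rw [hSdef, hμ, sub_sub, ← add_smul]
    congr 2
    ring
  set C := ∑ i, ∑ j, (v i / v j + v i * w j) with hC
  have hterm : ∀ i j, 0 < v i / v j + v i * w j := fun i j =>
    add_pos (div_pos (hv i) (hv j)) (mul_pos (hv i) (hw j))
  have hCle : ∀ i j, v i / v j + v i * w j ≤ C := by
    intro i j
    refine (Finset.single_le_sum (f := fun j => v i / v j + v i * w j)
      (fun j _ => (hterm i j).le) (Finset.mem_univ j)).trans ?_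
    exact Finset.single_le_sum (f := fun i => ∑ j, (v i / v j + v i * w j))
      (fun i _ => Finset.sum_nonneg fun j _ => (hterm i j).le) (Finset.mem_univ i)
  have hμ0 : 0 < μ := mul_pos (by linarith) (pow_pos hl N)
  have hC0 : 0 < C := by
    obtain ⟨i⟩ := ‹Nonempty ι›
    exact (hterm i i).trans_le (hCle i i)
  have hbound : ∀ k, k ≠ 0 → ‖((M - l • Q) ^ (N * k)).map Complex.ofReal‖ ≤
      Fintype.card ι * (μ ^ k * C) := by
    intro k hk
    refine norm_le_card_mul _ (by positivity) fun i j => ?_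
    rw [hkey k hk, Matrix.map_apply, Complex.norm_real, Matrix.sub_apply, Matrix.smul_apply,
      smul_eq_mul, Real.norm_eq_abs]
    have h1 := pow_apply_le_of_eigen hS hv hSv k i j
    have h2 := pow_apply_nonneg hS k i j
    have h3 : Q i j = v i * w j := rfl
    have h4 := mul_le_mul_of_nonneg_left (hCle i j) (pow_pos hμ0 k).le
    have h5 : 0 < μ ^ k * (v i * w j) := mul_pos (pow_pos hμ0 k) (mul_pos (hv i) (hw j))
    rw [h3, abs_le]
    constructor <;> nlinarith
  -- Take `k` so large that the geometric gain beats the constant `card ι * C` of the norm bound.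
  obtain ⟨k, hk⟩ : ∃ k, (1 - ε) ^ k < (Fintype.card ι * C + 1)⁻¹ :=
    exists_pow_lt_of_lt_one (by positivity) (by linarith)
  refine ⟨N * (k + 1), by positivity, (hbound (k + 1) (Nat.succ_ne_zero k)).trans_lt ?_⟩
  have h1 : (1 - ε) ^ (k + 1) < (Fintype.card ι * C + 1)⁻¹ := by
    refine lt_of_le_of_lt ?_ hk
    exact pow_le_pow_of_le_one (by linarith) (by linarith) (Nat.le_succ k)
  have h2 : (1 - ε) ^ (k + 1) * (Fintype.card ι * C) < 1 := by
    have h3 : 0 < Fintype.card ι * C + 1 := by positivity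
    have h4 := (mul_lt_mul_iff_of_pos_right h3).2 h1
    rw [inv_mul_cancel₀ h3.ne'] at h4
    have : 0 < (1 - ε) ^ (k + 1) := pow_pos (by linarith) _
    linarith
  have h3 : 0 < l ^ (N * (k + 1)) := pow_pos hl _
  calc (Fintype.card ι : ℝ) * (μ ^ (k + 1) * C)
      = ((1 - ε) ^ (k + 1) * (Fintype.card ι * C)) * l ^ (N * (k + 1)) := by
        rw [hμ, mul_pow, ← pow_mul]; ring
    _ < 1 * l ^ (N * (k + 1)) := (mul_lt_mul_iff_of_pos_right h3).2 h2
    _ = _ := one_mul _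

end Perron

end SymbolStatistics

/-! ### Aperiodicity of the pair and Gaussian decay on the unit circle. -/

namespace SymbolStatistics

open Matrix Filter Topology
open scoped Matrix.Norms.Operator

section Deficiency

/-- The parallelogram law gives `|x + y|² = 4 - d²` with `d = |x - y|`, and `√(4 - d²) ≤ 2 - d²/4`.
-/
lemma norm_add_le_two_sub {x y : ℂ} (hx : ‖x‖ = 1) (hy : ‖y‖ = 1) :
    ‖x + y‖ ≤ 2 - ‖x - y‖ ^ 2 / 4 := by
  have h := parallelogram_law_with_norm ℝ x y
  have h2 : ‖x - y‖ ≤ 2 := (norm_sub_le x y).trans (by rw [hx, hy]; norm_num)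
  have h3 := norm_nonneg (x - y)
  rw [hx, hy] at h
  refine abs_le_of_sq_le_sq' ?_ (by nlinarith) |>.2
  nlinarith [sq_nonneg (‖x - y‖ ^ 2)]

/-- Only the common mass `a` of the two terms is used for cancellation; the surplus is estimated by
the triangle inequality. -/
lemma norm_mul_add_mul_le {x y : ℂ} (hx : ‖x‖ = 1) (hy : ‖y‖ = 1) {f g a : ℝ} (ha : 0 ≤ a)
    (hf : a ≤ f) (hg : a ≤ g) :
    ‖x * f + y * g‖ ≤ f + g - a / 4 * ‖x - y‖ ^ 2 := by
  have h1 : x * f + y * g = (x + y) * (a : ℂ) + (x * ((f - a : ℝ) : ℂ) + y * ((g - a : ℝ) : ℂ)) := by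
    push_cast; ring
  have h2 : ‖(x + y) * (a : ℂ)‖ ≤ (2 - ‖x - y‖ ^ 2 / 4) * a := by
    rw [norm_mul, Complex.norm_real, Real.norm_eq_abs, abs_of_nonneg ha]
    exact mul_le_mul_of_nonneg_right (norm_add_le_two_sub hx hy) ha
  have h3 : ‖x * ((f - a : ℝ) : ℂ)‖ = f - a := by
    rw [norm_mul, hx, one_mul, Complex.norm_real, Real.norm_eq_abs, abs_of_nonneg (by linarith)]
  have h4 : ‖y * ((g - a : ℝ) : ℂ)‖ = g - a := by
    rw [norm_mul, hy, one_mul, Complex.norm_real, Real.norm_eq_abs, abs_of_nonneg (by linarith)]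
  rw [h1]
  have h5 := norm_add_le ((x + y) * (a : ℂ)) (x * ((f - a : ℝ) : ℂ) + y * ((g - a : ℝ) : ℂ))
  have h6 := norm_add_le (x * ((f - a : ℝ) : ℂ)) (y * ((g - a : ℝ) : ℂ))
  linarith

/-- Two terms with different phases make a sum of complex numbers smaller than the sum of their
moduli. -/
lemma norm_sum_mul_le {α : Type*} [Fintype α] {x : α → ℂ} (hx : ∀ w, ‖x w‖ = 1)
    {f : α → ℝ} (hf : ∀ w, 0 ≤ f w) (w₁ w₂ : α) {a : ℝ} (ha : 0 ≤ a) (h₁ : a ≤ f w₁)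
    (h₂ : a ≤ f w₂) :
    ‖∑ w, x w * f w‖ ≤ ∑ w, f w - a / 4 * ‖x w₁ - x w₂‖ ^ 2 := by
  classical
  have hterm : ∀ w, ‖x w * f w‖ = f w := fun w => by
    rw [norm_mul, hx, one_mul, Complex.norm_real, Real.norm_eq_abs, abs_of_nonneg (hf w)]
  by_cases hw : w₁ = w₂
  · subst hw
    simpa using (norm_sum_le _ _).trans (Finset.sum_le_sum fun w _ => (hterm w).le)
  · have hsplit : ∀ {β : Type} [AddCommMonoid β] (g : α → β),
        ∑ w, g w = g w₁ + g w₂ + ∑ w ∈ (Finset.univ.erase w₁).erase w₂, g w := by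
      intro β _ g
      rw [← Finset.add_sum_erase Finset.univ g (Finset.mem_univ w₁),
        ← Finset.add_sum_erase (Finset.univ.erase w₁) g
          (Finset.mem_erase.2 ⟨Ne.symm hw, Finset.mem_univ _⟩), add_assoc]
    rw [hsplit, hsplit]
    refine (norm_add_le _ _).trans ?_
    have h3 := norm_mul_add_mul_le (hx w₁) (hx w₂) ha h₁ h₂
    have h4 : ‖∑ w ∈ (Finset.univ.erase w₁).erase w₂, x w * (f w : ℂ)‖ ≤
        ∑ w ∈ (Finset.univ.erase w₁).erase w₂, f w :=
      (norm_sum_le _ _).trans (Finset.sum_le_sum fun w _ => (hterm w).le)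
    linarith

lemma norm_mul_apply_le {ι : Type*} [Fintype ι] {A B : Matrix ι ι ℂ} {M N : Matrix ι ι ℝ}
    {a b : ℝ} (ha : 0 ≤ a) (hM : ∀ i j, 0 ≤ M i j) (hA : ∀ i j, ‖A i j‖ ≤ a * M i j)
    (hB : ∀ i j, ‖B i j‖ ≤ b * N i j) (i j : ι) : ‖(A * B) i j‖ ≤ a * b * (M * N) i j := by
  rw [Matrix.mul_apply, Matrix.mul_apply, Finset.mul_sum]
  refine (norm_sum_le _ _).trans (Finset.sum_le_sum fun k _ => ?_)
  rw [norm_mul]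
  calc ‖A i k‖ * ‖B k j‖ ≤ (a * M i k) * (b * N k j) :=
        mul_le_mul (hA i k) (hB k j) (norm_nonneg _) (mul_nonneg ha (hM i k))
    _ = _ := by ring

/-- The chord has length `2 |sin (t/2)|`, and Jordan's inequality bounds the sine from below. -/
lemma two_div_pi_mul_abs_le_norm {t : ℝ} (ht : |t| ≤ Real.pi) :
    2 / Real.pi * |t| ≤ ‖1 - Complex.exp (t * Complex.I)‖ := by
  rw [norm_sub_rev, mul_comm (t : ℂ), Complex.norm_exp_I_mul_ofReal_sub_one, norm_mul,
    Real.norm_eq_abs, Real.norm_eq_abs, abs_two]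
  have h1 : |Real.sin (t / 2)| = Real.sin (|t| / 2) := by
    rcases abs_cases t with ⟨h, h'⟩ | ⟨h, h'⟩
    · rw [h, abs_of_nonneg (Real.sin_nonneg_of_nonneg_of_le_pi (by linarith)
        (by rw [h] at ht; linarith))]
    · rw [h, neg_div, Real.sin_neg, abs_of_nonpos]
      exact Real.sin_nonpos_of_nonpos_of_neg_pi_le (by linarith) (by rw [h] at ht; linarith)
  rw [h1]
  have h2 := Real.mul_le_sin (x := |t| / 2) (by positivity) (by linarith)
  linarith

end Deficiency

namespace LinearRepresentation

variable {ι : Type*} [Fintype ι] [DecidableEq ι] (R : LinearRepresentation ι)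

/-- For all large `m`, the entries of `(e^{it} A + B) ^ m` are smaller than those of `M ^ m` by a
multiple of `|1 - e^{izt}|²`. -/
def HasDeficiency (z : ℤ) : Prop :=
  ∃ m₀ : ℕ, ∀ m, m₀ ≤ m → ∃ c : ℝ, 0 < c ∧ ∀ (t : ℝ) (i j : ι),
    ‖(R.charMatrix (Complex.exp (t * Complex.I)) ^ m) i j‖ ≤
      (R.M ^ m) i j - c * ‖1 - Complex.exp (t * Complex.I) ^ z‖ ^ 2

variable {R}

/-- Together with `HasDeficiency.neg` and `HasDeficiency.add`, this makes the integers with a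
deficiency a subgroup of `ℤ`, so it suffices to treat generators. -/
lemma HasDeficiency.zero : R.HasDeficiency 0 :=
  ⟨0, fun m _ => ⟨1, one_pos, fun t i j => by
    simpa using R.norm_charMatrix_pow_apply_le (Complex.norm_exp_ofReal_mul_I t) m i j⟩⟩

lemma HasDeficiency.neg {z : ℤ} (h : R.HasDeficiency z) : R.HasDeficiency (-z) := by
  obtain ⟨m₀, h⟩ := h
  refine ⟨m₀, fun m hm => ?_⟩
  obtain ⟨c, hc, h⟩ := h m hm
  refine ⟨c, hc, fun t i j => ?_⟩
  have h1 : ‖1 - Complex.exp (t * Complex.I) ^ (-z)‖ = ‖1 - Complex.exp (t * Complex.I) ^ z‖ := by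
    have h0 := Complex.exp_ne_zero (t * Complex.I)
    have h2 : 1 - Complex.exp (t * Complex.I) ^ (-z) =
        -(Complex.exp (t * Complex.I) ^ (-z) * (1 - Complex.exp (t * Complex.I) ^ z)) := by
      rw [mul_sub, ← zpow_add₀ h0]; simp
    rw [h2, norm_neg, norm_mul, norm_zpow, Complex.norm_exp_ofReal_mul_I, _root_.one_zpow, one_mul]
  rw [h1]
  exact h t i j

lemma HasDeficiency.add {z z' : ℤ} (h : R.HasDeficiency z) (h' : R.HasDeficiency z') :
    R.HasDeficiency (z + z') := by
  obtain ⟨m₀, h⟩ := h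
  obtain ⟨m₁, h'⟩ := h'
  refine ⟨max m₀ m₁, fun m hm => ?_⟩
  obtain ⟨c, hc, h⟩ := h m ((le_max_left _ _).trans hm)
  obtain ⟨c', hc', h'⟩ := h' m ((le_max_right _ _).trans hm)
  -- Averaging the two deficiencies gives a factor `1/2`; the inequality `|1 - e^{z+z'}|² ≤ 2|1 -
  -- e^z|² + 2|1 - e^{z'}|²` costs another `1/2`.
  refine ⟨min c c' / 4, by positivity, fun t i j => ?_⟩
  have h1 := h t i j
  have h2 := h' t i j
  set e := Complex.exp (t * Complex.I) with he
  have he0 : e ≠ 0 := Complex.exp_ne_zero _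
  have h3 : ‖1 - e ^ (z + z')‖ ≤ ‖1 - e ^ z‖ + ‖1 - e ^ z'‖ := by
    have h4 : 1 - e ^ (z + z') = (1 - e ^ z) + e ^ z * (1 - e ^ z') := by
      rw [mul_sub, ← zpow_add₀ he0]; ring
    rw [h4]
    refine (norm_add_le _ _).trans ?_
    rw [norm_mul, norm_zpow, he, Complex.norm_exp_ofReal_mul_I, _root_.one_zpow, one_mul]
  have h5 : ‖1 - e ^ (z + z')‖ ^ 2 ≤ 2 * ‖1 - e ^ z‖ ^ 2 + 2 * ‖1 - e ^ z'‖ ^ 2 := by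
    nlinarith [norm_nonneg (1 - e ^ (z + z')), sq_nonneg (‖1 - e ^ z‖ - ‖1 - e ^ z'‖)]
  have h6 : min c c' * ‖1 - e ^ z‖ ^ 2 ≤ c * ‖1 - e ^ z‖ ^ 2 := by gcongr; exact min_le_left _ _
  have h7 : min c c' * ‖1 - e ^ z'‖ ^ 2 ≤ c' * ‖1 - e ^ z'‖ ^ 2 := by
    gcongr; exact min_le_right _ _
  have h8 : min c c' / 4 * ‖1 - e ^ (z + z')‖ ^ 2 ≤
      min c c' / 4 * (2 * ‖1 - e ^ z‖ ^ 2 + 2 * ‖1 - e ^ z'‖ ^ 2) := by gcongr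
  linarith

/-- Two closed walks of equal length at `p`, with a common path from `i` before and a common path to
`j` after, yield two words of length `m` of positive weight at `(i, j)`. Their phases differ by `|1
- e^{izt}|`, where `z` is the difference of the counts, so `norm_sum_mul_le` applies. -/
lemma hasDeficiency_of_walks [Nonempty ι] (hpos : ∃ N, ∀ n, N ≤ n → ∀ i j, 0 < (R.M ^ n) i j)
    {p : ι} {w₁ w₂ : List Letter} (h₁ : IsWalk R.A R.B p p w₁) (h₂ : IsWalk R.A R.B p p w₂)
    (hlen : w₁.length = w₂.length) :
    R.HasDeficiency ((w₁.count Letter.a : ℤ) - (w₂.count Letter.a : ℤ)) := by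
  obtain ⟨N, hN⟩ := hpos
  -- The path to `p` takes exactly `N` steps, which leaves at least `N` steps for the path to `j`.
  refine ⟨N + w₁.length + N, fun m hm => ?_⟩
  have hentry : ∀ q : ι × ι, ∃ c : ℝ, 0 < c ∧ ∀ t : ℝ,
      ‖(R.charMatrix (Complex.exp (t * Complex.I)) ^ m) q.1 q.2‖ ≤ (R.M ^ m) q.1 q.2 - c *
        ‖1 - Complex.exp (t * Complex.I) ^
          ((w₁.count Letter.a : ℤ) - (w₂.count Letter.a : ℤ))‖ ^ 2 := by
    rintro ⟨i, j⟩
    obtain ⟨α, hα, hα'⟩ := (R.M_pow_pos_iff N i p).1 (hN N le_rfl i p)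
    obtain ⟨β, hβ, hβ'⟩ := (R.M_pow_pos_iff (m - N - w₁.length) p j).1 (hN _ (by omega) p j)
    have hW : ∀ w : List Letter, w.length = w₁.length → IsWalk R.A R.B p p w →
        ∃ W : Fin m → Letter, List.ofFn W = α ++ w ++ β ∧
          0 < R.wordMatrix (List.ofFn W) i j := by
      intro w hw hw'
      have hlen : (α ++ w ++ β).length = m := by
        rw [List.length_append, List.length_append]; omega
      refine ⟨fun k => (α ++ w ++ β)[k], ?_, ?_⟩
      · apply List.ext_getElem <;> simp
        omega
      · rw [wordMatrix_pos_iff]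
        convert (hα'.append hw').append hβ'
        apply List.ext_getElem <;> simp
        omega
    obtain ⟨W₁, hW₁, hp₁⟩ := hW w₁ rfl h₁
    obtain ⟨W₂, hW₂, hp₂⟩ := hW w₂ hlen.symm h₂
    refine ⟨min (R.wordMatrix (List.ofFn W₁) i j) (R.wordMatrix (List.ofFn W₂) i j) / 4,
      by positivity, fun t => ?_⟩
    set e := Complex.exp (t * Complex.I) with he
    have he0 : e ≠ 0 := Complex.exp_ne_zero _
    have he1 : ‖e‖ = 1 := Complex.norm_exp_ofReal_mul_I t
    have h3 := norm_sum_mul_le (α := Fin m → Letter)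
      (x := fun w => e ^ ((List.ofFn w).count Letter.a)) (fun w => by simp [he1])
      (fun w => R.wordMatrix_nonneg (List.ofFn w) i j) W₁ W₂
      (a := min (R.wordMatrix (List.ofFn W₁) i j) (R.wordMatrix (List.ofFn W₂) i j))
      (by positivity) (min_le_left _ _) (min_le_right _ _)
    rw [charMatrix_pow_apply, M_pow_apply]
    refine h3.trans (le_of_eq ?_)
    congr 3
    rw [hW₁, hW₂]
    simp only [List.count_append]
    rw [zpow_sub₀ he0, zpow_natCast, zpow_natCast, pow_add, pow_add, pow_add, pow_add]
    have h4 : e ^ α.count Letter.a * e ^ w₁.count Letter.a * e ^ β.count Letter.a -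
        e ^ α.count Letter.a * e ^ w₂.count Letter.a * e ^ β.count Letter.a =
        -(e ^ α.count Letter.a * e ^ w₂.count Letter.a * e ^ β.count Letter.a *
          (1 - e ^ w₁.count Letter.a / e ^ w₂.count Letter.a)) := by
      field_simp
      ring
    rw [h4, norm_neg, norm_mul]
    simp [he1]
  choose c hc h using hentry
  obtain ⟨q, -, hq⟩ := Finset.exists_min_image (Finset.univ : Finset (ι × ι)) c
    Finset.univ_nonempty
  refine ⟨c q, hc q, fun t i j => (h (i, j) t).trans ?_⟩
  have := hq (i, j) (Finset.mem_univ _)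
  gcongr

lemma hasDeficiency_one [Nonempty ι] (hpos : ∃ N, ∀ n, N ≤ n → ∀ i j, 0 < (R.M ^ n) i j)
    (hap : IsAperiodicPair R.A R.B) : R.HasDeficiency 1 := by
  have hcyc : ∀ z ∈ cycleDifferences R.A R.B, R.HasDeficiency z := by
    rintro z ⟨i, j, w₁, w₂, h₁, h₂, hlen, rfl⟩
    have hpath : ∀ p q, ∃ w, IsWalk R.A R.B p q w := by
      intro p q
      obtain ⟨N, hN⟩ := hpos
      obtain ⟨w, -, hw⟩ := (R.M_pow_pos_iff N p q).1 (hN N le_rfl p q)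
      exact ⟨w, hw⟩
    obtain ⟨α, hα⟩ := hpath i j
    obtain ⟨β, hβ⟩ := hpath j i
    -- The cycles may have different base points `i` and `j`. With `α` from `i` to `j` and `β` back,
    -- `w₁αβ` and `αw₂β` are closed at `i`, of equal length, and have the same difference of counts.
    have := hasDeficiency_of_walks hpos (h₁.append (hα.append hβ)) (hα.append (h₂.append hβ))
      (by simp only [List.length_append]; omega)
    convert this using 1
    simp only [List.count_append]
    push_cast
    ring
  -- The differences generate a cyclic subgroup whose generator divides all of them; aperiodicity
  -- makes it `±1`, so `1` is in the subgroup.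
  obtain ⟨g, hg⟩ := Int.subgroup_cyclic (AddSubgroup.closure (cycleDifferences R.A R.B))
  have hg1 : g.natAbs = 1 := by
    refine hap _ fun z hz => ?_
    have : z ∈ AddSubgroup.closure ({g} : Set ℤ) := hg ▸ AddSubgroup.subset_closure hz
    rw [Int.natAbs_dvd]
    exact Int.mem_zmultiples_iff.1 (by rwa [AddSubgroup.zmultiples_eq_closure])
  have h1 : (1 : ℤ) ∈ AddSubgroup.closure (cycleDifferences R.A R.B) := by
    rw [hg, ← AddSubgroup.zmultiples_eq_closure, Int.mem_zmultiples_iff]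
    exact Int.natAbs_dvd_natAbs.1 (by rw [hg1]; simp)
  generalize (1 : ℤ) = z at h1
  induction h1 using AddSubgroup.closure_induction with
  | mem x hx => exact hcyc x hx
  | zero => exact HasDeficiency.zero
  | add x y _ _ hx hy => exact hx.add hy
  | neg x _ hx => exact hx.neg

/-- Gaussian decay of the powers of `e^{it} A + B`. -/
lemma exists_norm_charMatrix_pow_le [Nonempty ι]
    (hpos : ∃ N, ∀ n, N ≤ n → ∀ i j, 0 < (R.M ^ n) i j) (hap : IsAperiodicPair R.A R.B) :
    ∃ C c : ℝ, 0 < C ∧ 0 < c ∧ ∀ (n : ℕ) (t : ℝ), |t| ≤ Real.pi →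
      ‖R.charMatrix (Complex.exp (t * Complex.I)) ^ n‖ ≤
        C * Real.exp (-c * n * t ^ 2) * perronEigenvalue R.M ^ n := by
  obtain ⟨hl, v, hv, hMv⟩ := exists_perron_right R.M_nonneg hpos
  set l := perronEigenvalue R.M with hldef
  obtain ⟨m₀, hm₀⟩ := hasDeficiency_one hpos hap
  obtain ⟨N, hN⟩ := hpos
  set m := max m₀ N + 1 with hm
  have hNm := hN m (by omega)
  obtain ⟨c, hc, h⟩ := hm₀ m (by omega)
  obtain ⟨q, -, hq⟩ := Finset.exists_max_image (Finset.univ : Finset (ι × ι))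
    (fun q => (R.M ^ m) q.1 q.2) Finset.univ_nonempty
  set K := (R.M ^ m) q.1 q.2 with hK
  have hK0 : 0 < K := hNm _ _
  -- Division by the largest entry `K` of `M ^ m` makes the deficiency relative: each entry is at
  -- most `(1 - d t²) ≤ e^{-d t²}` times that of `M ^ m`.
  set d := c * (2 / Real.pi) ^ 2 / K with hd
  have hd0 : 0 < d := by have := Real.pi_pos; positivity
  have hstep : ∀ t : ℝ, |t| ≤ Real.pi → ∀ i j,
      ‖(R.charMatrix (Complex.exp (t * Complex.I)) ^ m) i j‖ ≤
        Real.exp (-d * t ^ 2) * (R.M ^ m) i j := by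
    intro t ht i j
    have h1 := h t i j
    rw [zpow_one] at h1
    have h2 := two_div_pi_mul_abs_le_norm ht
    have h3 : (2 / Real.pi) ^ 2 * t ^ 2 ≤ ‖1 - Complex.exp (t * Complex.I)‖ ^ 2 := by
      rw [← sq_abs t, ← mul_pow]
      have := Real.pi_pos
      gcongr
    have h4 : d * t ^ 2 * (R.M ^ m) i j ≤ d * t ^ 2 * K :=
      mul_le_mul_of_nonneg_left (hq (i, j) (Finset.mem_univ _)) (by positivity)
    have h5 : d * t ^ 2 * K = c * ((2 / Real.pi) ^ 2 * t ^ 2) := by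
      rw [hd]; field_simp
    have h6 : c * ((2 / Real.pi) ^ 2 * t ^ 2) ≤ c * ‖1 - Complex.exp (t * Complex.I)‖ ^ 2 := by
      gcongr
    have h7 := Real.add_one_le_exp (-d * t ^ 2)
    have h8 := mul_le_mul_of_nonneg_right h7 (hNm i j).le
    linarith
  have hpow : ∀ t : ℝ, |t| ≤ Real.pi → ∀ k : ℕ, ∀ i j,
      ‖((R.charMatrix (Complex.exp (t * Complex.I)) ^ m) ^ k) i j‖ ≤
        Real.exp (-d * t ^ 2) ^ k * ((R.M ^ m) ^ k) i j := by
    intro t ht k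
    induction k with
    | zero =>
      intro i j
      by_cases hij : i = j
      · simp [hij]
      · simp [hij]
    | succ k ih =>
      intro i j
      rw [pow_succ, pow_succ, pow_succ]
      exact norm_mul_apply_le (by positivity)
        (fun i j => by rw [← pow_mul]; exact R.M_pow_nonneg _ i j) ih (hstep t ht) i j
  obtain ⟨p, -, hp⟩ := Finset.exists_max_image (Finset.univ : Finset (ι × ι))
    (fun q => v q.1 / v q.2) Finset.univ_nonempty
  set V := v p.1 / v p.2 with hV
  have hV0 : 0 < V := div_pos (hv _) (hv _)
  have hcard : 0 < (Fintype.card ι : ℝ) := by exact_mod_cast Fintype.card_pos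
  have hm0 : 0 < (m : ℝ) := by exact_mod_cast Nat.succ_pos _
  -- The decay is gained once per block of `m` factors; `exp (d π²)` pays for the incomplete last
  -- block.
  refine ⟨Fintype.card ι * (Real.exp (d * Real.pi ^ 2) * V), d / m, by positivity,
    by positivity, fun n t ht => ?_⟩
  have hb : ∀ i j, ‖(R.charMatrix (Complex.exp (t * Complex.I)) ^ n) i j‖ ≤
      Real.exp (d * Real.pi ^ 2) * V * Real.exp (-(d / m) * n * t ^ 2) * l ^ n := by
    intro i j
    have h1 : ‖(R.charMatrix (Complex.exp (t * Complex.I)) ^ n) i j‖ ≤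
        Real.exp (-d * t ^ 2) ^ (n / m) * (R.M ^ n) i j := by
      have h2 := norm_mul_apply_le (by positivity)
        (fun i j => by rw [← pow_mul]; exact R.M_pow_nonneg _ i j) (hpow t ht (n / m))
        (b := 1) (fun i j => by
          rw [one_mul]
          exact R.norm_charMatrix_pow_apply_le (Complex.norm_exp_ofReal_mul_I t) (n % m) i j) i j
      rwa [← pow_mul, ← pow_mul, ← pow_add, ← pow_add, Nat.div_add_mod, mul_one] at h2
    have h3 : (R.M ^ n) i j ≤ l ^ n * V :=
      (pow_apply_le_of_eigen R.M_nonneg hv hMv n i j).trans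
        (mul_le_mul_of_nonneg_left (hp (i, j) (Finset.mem_univ _)) (by positivity))
    have h4 : Real.exp (-d * t ^ 2) ^ (n / m) ≤
        Real.exp (d * Real.pi ^ 2) * Real.exp (-(d / m) * n * t ^ 2) := by
      rw [← Real.exp_nat_mul, ← Real.exp_add]
      refine Real.exp_le_exp.2 ?_
      have h5 : (n : ℝ) / m ≤ (n / m : ℕ) + 1 := by
        rw [div_le_iff₀ hm0]
        have := Nat.lt_mul_div_succ n (show 0 < m from Nat.succ_pos _)
        have h6 : (n : ℝ) ≤ m * ((n / m : ℕ) + 1) := by exact_mod_cast this.le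
        linarith
      have h6 : t ^ 2 ≤ Real.pi ^ 2 := sq_le_sq' (by linarith [abs_le.1 ht]) (abs_le.1 ht).2
      have h7 : -(d / m) * n * t ^ 2 = -(d * t ^ 2) * (n / m) := by ring
      rw [h7]
      nlinarith [mul_le_mul_of_nonneg_left h5 (show 0 ≤ d * t ^ 2 by positivity),
        mul_le_mul_of_nonneg_left h6 hd0.le]
    calc _ ≤ Real.exp (-d * t ^ 2) ^ (n / m) * (R.M ^ n) i j := h1
      _ ≤ (Real.exp (d * Real.pi ^ 2) * Real.exp (-(d / m) * n * t ^ 2)) * (l ^ n * V) :=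
        mul_le_mul h4 h3 (R.M_pow_nonneg n i j) (by positivity)
      _ = _ := by ring
  refine (norm_le_card_mul _ (by positivity) hb).trans (le_of_eq ?_)
  ring

end LinearRepresentation

end SymbolStatistics

/-! ### The eigenvalue branch and its eigenvectors, by a bordered matrix. -/

namespace SymbolStatistics

open Matrix Filter Topology
open scoped Matrix.Norms.Operator

lemma contDiff_matrix_apply {ι : Type*} [Fintype ι] [DecidableEq ι] (i j : ι) :
    ContDiff ℂ ⊤ fun A : Matrix ι ι ℂ => A i j :=
  (LinearMap.toContinuousLinearMap (Matrix.entryLinearMap ℂ ℂ i j)).contDiff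

lemma contDiff_mulVec {ι : Type*} [Fintype ι] [DecidableEq ι] (x : ι → ℂ) :
    ContDiff ℂ ⊤ fun A : Matrix ι ι ℂ => A *ᵥ x :=
  contDiff_pi.2 fun i => ContDiff.sum fun j _ => (contDiff_matrix_apply i j).mul contDiff_const

lemma contDiff_vecMul {ι : Type*} [Fintype ι] [DecidableEq ι] (x : ι → ℂ) :
    ContDiff ℂ ⊤ fun A : Matrix ι ι ℂ => x ᵥ* A :=
  contDiff_pi.2 fun j => ContDiff.sum fun i _ => contDiff_const.mul (contDiff_matrix_apply i j)

lemma contDiff_dotProduct_mulVec {ι : Type*} [Fintype ι] [DecidableEq ι] (x y : ι → ℂ) :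
    ContDiff ℂ ⊤ fun A : Matrix ι ι ℂ => y ⬝ᵥ (A *ᵥ x) :=
  ContDiff.sum fun i _ => contDiff_const.mul (contDiff_pi.1 (contDiff_mulVec x) i)

namespace LinearRepresentation

variable {ι : Type*} [Fintype ι] [DecidableEq ι] (R : LinearRepresentation ι)

/-- `v` and `w` are normalised right and left Perron eigenvectors of `M`, and `M` has a spectral
gap. -/
structure IsPerronPair (v w : ι → ℝ) : Prop where
  pos : 0 < perronEigenvalue R.M
  right_pos : ∀ i, 0 < v i
  left_pos : ∀ i, 0 < w i
  right_eigen : R.M *ᵥ v = perronEigenvalue R.M • v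
  left_eigen : w ᵥ* R.M = perronEigenvalue R.M • w
  normalised : w ⬝ᵥ v = 1
  gap : ∃ m, 0 < m ∧ ‖((R.M - perronEigenvalue R.M • vecMulVec v w) ^ m).map Complex.ofReal‖ <
    perronEigenvalue R.M ^ m

lemma exists_isPerronPair [Nonempty ι] (hpos : ∃ N, ∀ n, N ≤ n → ∀ i j, 0 < (R.M ^ n) i j) :
    ∃ v w, R.IsPerronPair v w := by
  have hl := (exists_perron_right R.M_nonneg hpos).1
  obtain ⟨v, w, hv, hw, hMv, hwM, hwv⟩ := exists_perron_vectors R.M_nonneg hpos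
  exact ⟨v, w, hl, hv, hw, hMv, hwM, hwv, exists_norm_pow_lt hpos hv hw hl hMv hwM hwv⟩

/-- The matrix `s I - (e^z A + B) + v w'`. -/
noncomputable def bordered (v w : ι → ℝ) (z s : ℂ) : Matrix ι ι ℂ :=
  s • 1 - R.charMatrix (Complex.exp z) + vecMulVec (Complex.ofReal ∘ v) (Complex.ofReal ∘ w)

lemma contDiff_bordered (v w : ι → ℝ) :
    ContDiff ℂ ⊤ fun p : ℂ × ℂ => R.bordered v w p.1 p.2 := by
  unfold bordered charMatrix
  fun_prop

variable {R} {v w : ι → ℝ}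

namespace IsPerronPair

variable (h : R.IsPerronPair v w)

include h

lemma dotProduct_ofReal : (Complex.ofReal ∘ w) ⬝ᵥ (Complex.ofReal ∘ v) = 1 := by
  have := congrArg Complex.ofReal h.normalised
  simpa [dotProduct] using this

lemma charMatrix_one_mulVec :
    R.charMatrix 1 *ᵥ (Complex.ofReal ∘ v) =
      (perronEigenvalue R.M : ℂ) • (Complex.ofReal ∘ v) := by
  ext i
  have := congrArg Complex.ofReal (congrFun h.right_eigen i)
  rw [charMatrix_one]
  simpa [mulVec, dotProduct] using this

lemma vecMul_charMatrix_one :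
    (Complex.ofReal ∘ w) ᵥ* R.charMatrix 1 =
      (perronEigenvalue R.M : ℂ) • (Complex.ofReal ∘ w) := by
  ext i
  have := congrArg Complex.ofReal (congrFun h.left_eigen i)
  rw [charMatrix_one]
  simpa [vecMul, dotProduct] using this

lemma bordered_zero_mulVec (s : ℂ) : R.bordered v w 0 s *ᵥ (Complex.ofReal ∘ v) =
    (s - perronEigenvalue R.M + 1) • (Complex.ofReal ∘ v) := by
  rw [bordered, Matrix.add_mulVec, Matrix.sub_mulVec, Complex.exp_zero, h.charMatrix_one_mulVec,
    Matrix.smul_mulVec, Matrix.one_mulVec, vecMulVec_mulVec, h.dotProduct_ofReal, add_smul,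
    sub_smul]
  ext i
  simp

lemma vecMul_bordered_zero (s : ℂ) : (Complex.ofReal ∘ w) ᵥ* R.bordered v w 0 s =
    (s - perronEigenvalue R.M + 1) • (Complex.ofReal ∘ w) := by
  rw [bordered, Matrix.vecMul_add, Matrix.vecMul_sub, Complex.exp_zero, h.vecMul_charMatrix_one,
    Matrix.vecMul_smul, Matrix.vecMul_one, vecMul_vecMulVec, h.dotProduct_ofReal, add_smul,
    sub_smul]

/-- The rank-one term removes the kernel of `λ I - M`. Indeed, pairing a kernel vector `x` with `w`
gives `w ⬝ᵥ x = 0`, so `x` would be an eigenvector of `M - λ v w'` for the eigenvalue `λ`, against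
the gap. Invertibility persists near `(0, λ)` and makes the eigenvalue equation a smooth scalar
equation. -/
lemma isUnit_bordered : IsUnit (R.bordered v w 0 (perronEigenvalue R.M)) := by
  rw [Matrix.isUnit_iff_isUnit_det, isUnit_iff_ne_zero]
  intro hdet
  obtain ⟨x, hx0, hx⟩ := Matrix.exists_mulVec_eq_zero_iff.2 hdet
  have hwx : (Complex.ofReal ∘ w) ⬝ᵥ x = 0 := by
    have h1 := Matrix.dotProduct_mulVec (Complex.ofReal ∘ w)
      (R.bordered v w 0 (perronEigenvalue R.M)) x
    rw [hx, h.vecMul_bordered_zero] at h1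
    simpa using h1.symm
  obtain ⟨m, -, hm⟩ := h.gap
  set l := perronEigenvalue R.M with hl
  have hRx : (R.M - l • vecMulVec v w).map Complex.ofReal *ᵥ x = (l : ℂ) • x := by
    have h1 : (R.M - l • vecMulVec v w).map Complex.ofReal =
        R.charMatrix 1 - (l : ℂ) • vecMulVec (Complex.ofReal ∘ v) (Complex.ofReal ∘ w) := by
      rw [charMatrix_one]
      ext i j
      simp [vecMulVec_apply]
    rw [bordered, Matrix.add_mulVec, Matrix.sub_mulVec, Complex.exp_zero, Matrix.smul_mulVec,
      Matrix.one_mulVec, vecMulVec_mulVec, hwx] at hx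
    rw [h1, Matrix.sub_mulVec, Matrix.smul_mulVec, vecMulVec_mulVec, hwx]
    simp only [MulOpposite.op_zero, zero_smul, add_zero, smul_zero, sub_zero] at hx ⊢
    exact (sub_eq_zero.1 hx).symm
  have h2 := Matrix.linfty_opNorm_mulVec (((R.M - l • vecMulVec v w) ^ m).map Complex.ofReal) x
  rw [map_ofReal_pow, pow_mulVec_of_eigen hRx, norm_smul, norm_pow, Complex.norm_real,
    Real.norm_eq_abs, abs_of_pos h.pos, ← map_ofReal_pow] at h2
  exact absurd (le_of_mul_le_mul_right h2 (norm_pos_iff.2 hx0)) (not_le.2 hm)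

lemma inverse_bordered_mulVec :
    Ring.inverse (R.bordered v w 0 (perronEigenvalue R.M)) *ᵥ (Complex.ofReal ∘ v) =
      Complex.ofReal ∘ v := by
  have h1 := h.bordered_zero_mulVec (perronEigenvalue R.M)
  rw [sub_self, zero_add, one_smul] at h1
  conv_lhs => rw [← h1]
  rw [Matrix.mulVec_mulVec, Ring.inverse_mul_cancel _ h.isUnit_bordered, Matrix.one_mulVec]

lemma vecMul_inverse_bordered :
    (Complex.ofReal ∘ w) ᵥ* Ring.inverse (R.bordered v w 0 (perronEigenvalue R.M)) =
      Complex.ofReal ∘ w := by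
  have h1 := h.vecMul_bordered_zero (perronEigenvalue R.M)
  rw [sub_self, zero_add, one_smul] at h1
  conv_lhs => rw [← h1]
  rw [Matrix.vecMul_vecMul, Ring.mul_inverse_cancel _ h.isUnit_bordered, Matrix.vecMul_one]

lemma contDiffAt_inverse_bordered :
    ContDiffAt ℂ ⊤ (fun p : ℂ × ℂ => Ring.inverse (R.bordered v w p.1 p.2))
      (0, (perronEigenvalue R.M : ℂ)) := by
  obtain ⟨U, hU⟩ := h.isUnit_bordered
  have h1 : ContDiffAt ℂ ⊤ (Ring.inverse : Matrix ι ι ℂ → Matrix ι ι ℂ)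
      (R.bordered v w 0 (perronEigenvalue R.M)) := hU ▸ contDiffAt_ringInverse ℂ U
  exact ContDiffAt.comp (0, (perronEigenvalue R.M : ℂ)) (g := Ring.inverse) h1
    (R.contDiff_bordered v w).contDiffAt

lemma eventually_isUnit_bordered :
    ∀ᶠ p in 𝓝 ((0 : ℂ), (perronEigenvalue R.M : ℂ)), IsUnit (R.bordered v w p.1 p.2) :=
  ((R.contDiff_bordered v w).continuous.continuousAt (x := ((0 : ℂ), (perronEigenvalue R.M : ℂ)))).eventually
    (Units.isOpen.mem_nhds h.isUnit_bordered)

/-- The eigenvalue branch exists. -/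
lemma exists_isEigenvalueBranch : ∃ u, R.IsEigenvalueBranch u := by
  set l := perronEigenvalue R.M with hl
  -- If `w' x = 1` for `x = bordered⁻¹ v`, then `(s I - e^z A - B) x = v - v (w' x) = 0`. So the
  -- equation `F = 1` produces eigenvalues. On `z = 0` it reads `1 / (s - λ + 1) = 1`, with nonzero
  -- derivative `-1` at `s = λ`, and the implicit function theorem applies.
  set F : ℂ × ℂ → ℂ := fun p =>
    (Complex.ofReal ∘ w) ⬝ᵥ (Ring.inverse (R.bordered v w p.1 p.2) *ᵥ (Complex.ofReal ∘ v)) with hF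
  have hcd : ContDiffAt ℂ ⊤ F (0, (l : ℂ)) := by
    have h1 := h.contDiffAt_inverse_bordered
    exact ContDiffAt.comp (0, (l : ℂ))
      (g := fun A : Matrix ι ι ℂ => (Complex.ofReal ∘ w) ⬝ᵥ (A *ᵥ (Complex.ofReal ∘ v)))
      (contDiff_dotProduct_mulVec _ _).contDiffAt h1
  have hF0 : F (0, (l : ℂ)) = 1 := by
    simp only [hF]
    rw [h.inverse_bordered_mulVec, h.dotProduct_ofReal]
  have hFs : (fun s => F (0, s)) =ᶠ[𝓝 (l : ℂ)] fun s => (s - l + 1)⁻¹ := by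
    have h1 : ∀ᶠ s in 𝓝 (l : ℂ), IsUnit (R.bordered v w 0 s) := by
      have h2 : Tendsto (fun s : ℂ => ((0 : ℂ), s)) (𝓝 (l : ℂ)) (𝓝 ((0 : ℂ), (l : ℂ))) :=
        (Continuous.prodMk_right (0 : ℂ)).tendsto _
      exact h2.eventually h.eventually_isUnit_bordered
    have h3 : ∀ᶠ s : ℂ in 𝓝 (l : ℂ), s - l + 1 ≠ 0 := by
      have : ContinuousAt (fun s : ℂ => s - l + 1) l := by fun_prop
      have h0 : (l : ℂ) - l + 1 ≠ 0 := by simp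
      exact this.eventually_ne h0
    filter_upwards [h1, h3] with s hs hs0
    have h4 := congrArg (Ring.inverse (R.bordered v w 0 s) *ᵥ ·) (h.bordered_zero_mulVec s)
    simp only [Matrix.mulVec_mulVec, Ring.inverse_mul_cancel _ hs, Matrix.one_mulVec,
      Matrix.mulVec_smul] at h4
    have h5 := congrArg ((Complex.ofReal ∘ w) ⬝ᵥ ·) h4
    simp only [h.dotProduct_ofReal, dotProduct_smul, smul_eq_mul] at h5
    exact eq_inv_of_mul_eq_one_right h5.symm
  have hderiv : (fderiv ℂ F (0, (l : ℂ)) ∘L .inr ℂ ℂ ℂ) 1 = -1 := by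
    have h1 : HasDerivAt (fun s => F (0, s)) (fderiv ℂ F (0, (l : ℂ)) (0, 1)) (l : ℂ) := by
      have h2 := (hcd.differentiableAt (by simp)).hasFDerivAt
      have h3 : HasDerivAt (fun s : ℂ => ((0 : ℂ), s)) (0, 1) (l : ℂ) :=
        (hasDerivAt_const _ _).prodMk (hasDerivAt_id _)
      exact h2.comp_hasDerivAt (l : ℂ) h3
    have h2 : HasDerivAt (fun s : ℂ => (s - l + 1)⁻¹) (-1) (l : ℂ) := by
      have := (((hasDerivAt_id (l : ℂ)).sub_const (l : ℂ)).add_const 1).inv (by simp)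
      simp only [id_eq, sub_self, zero_add, one_pow, div_one] at this
      exact this
    simpa using h1.unique (h2.congr_of_eventuallyEq hFs)
  have hinv : (fderiv ℂ F (0, (l : ℂ)) ∘L .inr ℂ ℂ ℂ).IsInvertible := by
    refine ⟨ContinuousLinearEquiv.neg ℂ, ?_⟩
    ext
    rw [hderiv]
    simp
  set φ := hcd.implicitFunction (by simp) hinv with hφ
  have hφ0 : φ 0 = l := hcd.implicitFunction_apply_self (by simp) hinv
  have hφcd : ContDiffAt ℂ ⊤ φ 0 := hcd.contDiffAt_implicitFunction (by simp) hinv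
  refine ⟨φ, hφcd.analyticAt, hφ0, ?_⟩
  have hunit : ∀ᶠ z in 𝓝 (0 : ℂ), IsUnit (R.bordered v w z (φ z)) := by
    have h2 : Tendsto (fun z : ℂ => (z, φ z)) (𝓝 0) (𝓝 ((0 : ℂ), (l : ℂ))) := by
      have := (continuousAt_id (x := (0 : ℂ))).prodMk hφcd.continuousAt
      simp only [ContinuousAt, id_eq] at this
      rwa [hφ0] at this
    exact h2.eventually h.eventually_isUnit_bordered
  filter_upwards [hunit, hcd.eventually_apply_implicitFunction (by simp) hinv] with z hz hz'
  rw [sub_sub]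
  change (φ z • (1 : Matrix ι ι ℂ) - R.charMatrix (Complex.exp z)).det = 0
  rw [hF0] at hz'
  set x := Ring.inverse (R.bordered v w z (φ z)) *ᵥ (Complex.ofReal ∘ v) with hx
  have hwx : (Complex.ofReal ∘ w) ⬝ᵥ x = 1 := hz'
  refine Matrix.exists_mulVec_eq_zero_iff.1 ⟨x, ?_, ?_⟩
  · rintro h0
    rw [h0] at hwx
    simp at hwx
  · have h1 : R.bordered v w z (φ z) *ᵥ x = Complex.ofReal ∘ v := by
      rw [hx, Matrix.mulVec_mulVec, Ring.mul_inverse_cancel _ hz, Matrix.one_mulVec]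
    rw [bordered, Matrix.add_mulVec, vecMulVec_mulVec, hwx] at h1
    simpa using h1

/-- Existence guarantees that `u` is a genuine branch and not the default value `0`. -/
lemma isEigenvalueBranch_u : R.IsEigenvalueBranch R.u := by
  have := h.exists_isEigenvalueBranch
  rw [u, dif_pos this]
  exact this.choose_spec

/-- Right and left eigenvectors along the eigenvalue branch. -/
lemma exists_eigenvectors : ∃ x y : ℂ → ι → ℂ, DifferentiableAt ℂ x 0 ∧ DifferentiableAt ℂ y 0 ∧
    x 0 = Complex.ofReal ∘ v ∧ y 0 = Complex.ofReal ∘ w ∧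
    ∀ᶠ z in 𝓝 (0 : ℂ), R.charMatrix (Complex.exp z) *ᵥ x z = R.u z • x z ∧
      y z ᵥ* R.charMatrix (Complex.exp z) = R.u z • y z := by
  obtain ⟨hu, hu0, hdet⟩ := h.isEigenvalueBranch_u
  set l := perronEigenvalue R.M with hl
  have hd : DifferentiableAt ℂ (fun z => Ring.inverse (R.bordered v w z (R.u z))) 0 := by
    have h1 : DifferentiableAt ℂ (fun p : ℂ × ℂ => Ring.inverse (R.bordered v w p.1 p.2)) (0, R.u 0) := by
      rw [hu0]
      exact h.contDiffAt_inverse_bordered.differentiableAt (by simp)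
    exact DifferentiableAt.comp (0 : ℂ) h1
      (differentiableAt_id.prodMk hu.differentiableAt : DifferentiableAt ℂ (fun z => (z, R.u z)) 0)
  -- The bordered inverse turns the fixed vectors `v` and `w` into eigenvectors that depend
  -- differentiably on `z`.
  refine ⟨fun z => Ring.inverse (R.bordered v w z (R.u z)) *ᵥ (Complex.ofReal ∘ v),
    fun z => (Complex.ofReal ∘ w) ᵥ* Ring.inverse (R.bordered v w z (R.u z)), ?_, ?_, ?_, ?_, ?_⟩
  · exact DifferentiableAt.comp (0 : ℂ) (g := fun A : Matrix ι ι ℂ => A *ᵥ (Complex.ofReal ∘ v))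
      ((contDiff_mulVec _).contDiffAt.differentiableAt (by simp)) hd
  · exact DifferentiableAt.comp (0 : ℂ) (g := fun A : Matrix ι ι ℂ => (Complex.ofReal ∘ w) ᵥ* A)
      ((contDiff_vecMul _).contDiffAt.differentiableAt (by simp)) hd
  · simp only [hu0]
    exact h.inverse_bordered_mulVec
  · simp only [hu0]
    exact h.vecMul_inverse_bordered
  · have hunit : ∀ᶠ z in 𝓝 (0 : ℂ), IsUnit (R.bordered v w z (R.u z)) := by
      have h2 : Tendsto (fun z : ℂ => (z, R.u z)) (𝓝 0) (𝓝 ((0 : ℂ), (l : ℂ))) := by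
        have := (continuousAt_id (x := (0 : ℂ))).prodMk hu.continuousAt
        simp only [ContinuousAt, id_eq] at this
        rwa [hu0] at this
      exact h2.eventually h.eventually_isUnit_bordered
    filter_upwards [hunit, hdet] with z hz hdz
    rw [sub_sub] at hdz
    change (R.u z • (1 : Matrix ι ι ℂ) - R.charMatrix (Complex.exp z)).det = 0 at hdz
    constructor
    -- A kernel vector `k` satisfies `bordered k = (w' k) v`, hence `k = (w' k) bordered⁻¹ v`. Since
    -- `k ≠ 0`, also `w' k ≠ 0`, so `bordered⁻¹ v` is itself in the kernel.
    · obtain ⟨k, hk0, hk⟩ := Matrix.exists_mulVec_eq_zero_iff.2 hdz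
      set a := (Complex.ofReal ∘ w) ⬝ᵥ k with ha
      have h1 : R.bordered v w z (R.u z) *ᵥ k = a • (Complex.ofReal ∘ v) := by
        rw [bordered, Matrix.add_mulVec, vecMulVec_mulVec, hk, zero_add]
        ext i
        simp [ha, mul_comm]
      have h2 := congrArg (Ring.inverse (R.bordered v w z (R.u z)) *ᵥ ·) h1
      simp only [Matrix.mulVec_mulVec, Ring.inverse_mul_cancel _ hz, Matrix.one_mulVec,
        Matrix.mulVec_smul] at h2
      have ha0 : a ≠ 0 := by
        rintro h0
        rw [h0, zero_smul] at h2
        exact hk0 h2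
      rw [Matrix.sub_mulVec, Matrix.smul_mulVec, Matrix.one_mulVec, sub_eq_zero] at hk
      have h3 : Ring.inverse (R.bordered v w z (R.u z)) *ᵥ (Complex.ofReal ∘ v) = a⁻¹ • k := by
        rw [h2, smul_smul, inv_mul_cancel₀ ha0, one_smul]
      rw [h3, Matrix.mulVec_smul, ← hk, smul_comm]
    · obtain ⟨k, hk0, hk⟩ := Matrix.exists_vecMul_eq_zero_iff.2 hdz
      set a := k ⬝ᵥ (Complex.ofReal ∘ v) with ha
      have h1 : k ᵥ* R.bordered v w z (R.u z) = a • (Complex.ofReal ∘ w) := by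
        rw [bordered, Matrix.vecMul_add, vecMul_vecMulVec, hk, zero_add]
      have h2 := congrArg (· ᵥ* Ring.inverse (R.bordered v w z (R.u z))) h1
      simp only [Matrix.vecMul_vecMul, Ring.mul_inverse_cancel _ hz, Matrix.vecMul_one,
        Matrix.smul_vecMul] at h2
      have ha0 : a ≠ 0 := by
        rintro h0
        rw [h0, zero_smul] at h2
        exact hk0 h2
      rw [Matrix.vecMul_sub, Matrix.vecMul_smul, Matrix.vecMul_one, sub_eq_zero] at hk
      have h3 : (Complex.ofReal ∘ w) ᵥ* Ring.inverse (R.bordered v w z (R.u z)) = a⁻¹ • k := by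
        rw [h2, smul_smul, inv_mul_cancel₀ ha0, one_smul]
      rw [h3, Matrix.smul_vecMul, ← hk, smul_comm]

end IsPerronPair

end LinearRepresentation

end SymbolStatistics

/-! ### Expansion of the branch and of the matrix powers near `0`. -/

namespace SymbolStatistics

open Matrix Filter Topology
open scoped Matrix.Norms.Operator

lemma le_of_forall_pow_le_mul_pow {a b C : ℝ} (hb : 0 < b) (h : ∀ n : ℕ, a ^ n ≤ C * b ^ n) :
    a ≤ b := by
  by_contra! hab
  have h1 : 1 < a / b := (one_lt_div hb).2 hab
  obtain ⟨n, hn⟩ := ((tendsto_pow_atTop_atTop_of_one_lt h1).eventually_gt_atTop C).exists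
  rw [div_pow, lt_div_iff₀ (pow_pos hb n)] at hn
  exact absurd (h n) (not_le.2 hn)

/-- The conclusion has the form of the hypothesis, so that it can be iterated to reach the second
derivative. -/
lemma eventually_im_deriv_eq_zero {f : ℂ → ℂ} (hf : AnalyticAt ℂ f 0)
    (hreal : ∀ᶠ t : ℝ in 𝓝 0, (f t).im = 0) : ∀ᶠ t : ℝ in 𝓝 0, (deriv f t).im = 0 := by
  have hlim : Tendsto (fun t : ℝ => (t : ℂ)) (𝓝 0) (𝓝 0) := by
    simpa using (Complex.continuous_ofReal.tendsto 0)
  filter_upwards [hreal.eventually_nhds, hlim.eventually hf.eventually_analyticAt] with t ht ht'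
  have h1 : HasDerivAt (fun s : ℝ => f s) (deriv f t) t :=
    ht'.differentiableAt.hasDerivAt.comp_ofReal
  have h2 : HasDerivAt (fun s : ℝ => (f s).im) (deriv f t).im t :=
    Complex.imCLM.hasFDerivAt.comp_hasDerivAt t h1
  exact h2.unique ((hasDerivAt_const t (0 : ℝ)).congr_of_eventuallyEq ht)

lemma isBigO_pow_three {g : ℂ → ℂ} (hg : AnalyticAt ℂ g 0) (h0 : g 0 = 0) (h1 : deriv g 0 = 0)
    (h2 : deriv (deriv g) 0 = 0) : g =O[𝓝 0] fun z => z ^ 3 := by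
  have h3 : (3 : ℕ) ≤ analyticOrderAt g 0 := by
    rw [natCast_le_analyticOrderAt_iff_iteratedDeriv_eq_zero hg]
    intro i hi
    interval_cases i
    · simpa using h0
    · simpa using h1
    · rw [iteratedDeriv_succ, iteratedDeriv_one]; exact h2
  obtain ⟨k, hk, hgk⟩ := (natCast_le_analyticOrderAt hg).1 h3
  have h4 : (fun z => (z - 0) ^ 3 • k z) =O[𝓝 0] fun z : ℂ => z ^ 3 := by
    have h5 : k =O[𝓝 0] fun _ => (1 : ℂ) := hk.continuousAt.isBigO_one ℂ
    have h6 := (Asymptotics.isBigO_refl (fun z : ℂ => z ^ 3) (𝓝 0)).mul h5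
    simpa using h6
  exact (Filter.EventuallyEq.isBigO hgk).trans h4

namespace LinearRepresentation

namespace IsPerronPair

variable {ι : Type*} [Fintype ι] [DecidableEq ι] {R : LinearRepresentation ι} {v w : ι → ℝ}
  (h : R.IsPerronPair v w)

include h

/-- For real `t` the matrix is real, so the conjugate of `x` is an eigenvector for the conjugate of
`u`. Pairing it with the left eigenvector `y` for `u` forces equality, the pairing being nonzero
near `0`. Since `beta` and `gamma` are defined by real parts, this is what recovers the full
derivatives of `u` from them. -/
lemma eventually_im_u_eq_zero : ∀ᶠ t : ℝ in 𝓝 0, (R.u t).im = 0 := by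
  obtain ⟨x, y, hx, hy, hx0, hy0, hxy⟩ := h.exists_eigenvectors
  have hlim : Tendsto (fun t : ℝ => (t : ℂ)) (𝓝 0) (𝓝 0) := by
    simpa using (Complex.continuous_ofReal.tendsto 0)
  have hne : ∀ᶠ z : ℂ in 𝓝 0, y z ⬝ᵥ star (x z) ≠ 0 := by
    have hc : ContinuousAt (fun z => y z ⬝ᵥ star (x z)) 0 := by
      have hx' := hx.continuousAt
      have hy' := hy.continuousAt
      fun_prop
    refine hc.eventually_ne ?_
    have : star (Complex.ofReal ∘ v) = Complex.ofReal ∘ v := by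
      ext i
      simp
    rw [hx0, hy0, this, h.dotProduct_ofReal]
    exact one_ne_zero
  filter_upwards [hlim.eventually hne, hlim.eventually hxy] with t ht ⟨hP, hP'⟩
  have h1 : R.charMatrix (Complex.exp t) *ᵥ star (x t) = star (R.u t) • star (x t) := by
    have h2 := congrArg star hP
    rw [star_smul] at h2
    rw [← h2]
    ext i
    simp only [mulVec, dotProduct, Pi.star_apply, star_sum, star_mul']
    refine Finset.sum_congr rfl fun j _ => ?_
    congr 1
    rw [charMatrix_apply, ← Complex.ofReal_exp]
    simp only [Complex.star_def, map_add, map_mul, Complex.conj_ofReal]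
  have h3 := Matrix.dotProduct_mulVec (y t) (R.charMatrix (Complex.exp t)) (star (x t))
  rw [h1, hP', dotProduct_smul, smul_dotProduct, smul_eq_mul, smul_eq_mul] at h3
  have h4 := mul_right_cancel₀ ht h3
  exact Complex.conj_eq_iff_im.1 h4

lemma deriv_u_zero : deriv R.u 0 = (perronEigenvalue R.M * R.beta : ℝ) := by
  have h1 := (eventually_im_deriv_eq_zero h.isEigenvalueBranch_u.1 h.eventually_im_u_eq_zero).self_of_nhds
  rw [beta, mul_div_cancel₀ _ h.pos.ne']
  apply Complex.ext
  · simp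
  · simpa using h1

lemma deriv_deriv_u_zero : deriv (deriv R.u) 0 =
    (perronEigenvalue R.M * (R.gamma + R.beta ^ 2) : ℝ) := by
  have h1 := (eventually_im_deriv_eq_zero h.isEigenvalueBranch_u.1.deriv
    (eventually_im_deriv_eq_zero h.isEigenvalueBranch_u.1 h.eventually_im_u_eq_zero)).self_of_nhds
  rw [gamma, sub_add_cancel, mul_div_cancel₀ _ h.pos.ne', iteratedDeriv_succ, iteratedDeriv_one]
  apply Complex.ext
  · simp
  · simpa using h1

/-- Third order expansion of `u(z) / λ`. -/
lemma u_div_sub_exp_isBigO :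
    (fun z => R.u z / perronEigenvalue R.M - Complex.exp (R.beta * z + R.gamma * z ^ 2 / 2))
      =O[𝓝 0] fun z => z ^ 3 := by
  obtain ⟨hu, hu0, -⟩ := h.isEigenvalueBranch_u
  set l := perronEigenvalue R.M with hl
  have hl0 : (l : ℂ) ≠ 0 := by exact_mod_cast h.pos.ne'
  have hq : ∀ z : ℂ, HasDerivAt (fun z : ℂ => (R.beta : ℂ) * z + R.gamma * z ^ 2 / 2)
      (R.beta + R.gamma * z) z := by
    intro z
    have := ((hasDerivAt_id z).const_mul (R.beta : ℂ)).add
      ((((hasDerivAt_id z).pow 2).const_mul (R.gamma : ℂ)).div_const 2)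
    refine this.congr_deriv ?_
    simp
    ring
  have hd : ∀ᶠ z in 𝓝 (0 : ℂ), HasDerivAt
      (fun z => R.u z / l - Complex.exp (R.beta * z + R.gamma * z ^ 2 / 2))
      (deriv R.u z / l - Complex.exp (R.beta * z + R.gamma * z ^ 2 / 2) *
        (R.beta + R.gamma * z)) z := by
    filter_upwards [hu.eventually_analyticAt] with z hz
    exact (hz.differentiableAt.hasDerivAt.div_const _).sub (hq z).cexp
  have hd1 : deriv (fun z => R.u z / l - Complex.exp (R.beta * z + R.gamma * z ^ 2 / 2))
      =ᶠ[𝓝 0] fun z => deriv R.u z / l - Complex.exp (R.beta * z + R.gamma * z ^ 2 / 2) *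
        (R.beta + R.gamma * z) := by
    filter_upwards [hd] with z hz using hz.deriv
  -- At `0`, `exp (βz + γz²/2)` has value `1` and derivatives `β` and `γ + β²`, the same as `u/λ`.
  refine isBigO_pow_three ?_ ?_ ?_ ?_
  · refine (hu.div_const).sub ?_
    exact AnalyticAt.cexp (by fun_prop)
  · simp [hu0, hl0]
  · rw [hd1.self_of_nhds]
    simp only
    rw [h.deriv_u_zero]
    push_cast
    rw [mul_div_cancel_left₀ _ hl0]
    simp
  · rw [hd1.deriv_eq]
    have h1 : HasDerivAt (fun z : ℂ => (R.beta : ℂ) + R.gamma * z) R.gamma 0 := by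
      simpa using ((hasDerivAt_id (0 : ℂ)).const_mul (R.gamma : ℂ)).const_add (R.beta : ℂ)
    have h2 := (hu.deriv.differentiableAt.hasDerivAt.div_const (l : ℂ)).sub ((hq 0).cexp.mul h1)
    refine h2.deriv.trans ?_
    rw [h.deriv_deriv_u_zero]
    push_cast
    rw [mul_div_cancel_left₀ _ hl0]
    simp
    ring

/-- Spectral expansion of the powers of `e^z A + B` for `z` near `0`. -/
lemma exists_spectral_expansion : ∃ (E : ℂ → Matrix ι ι ℂ) (C r : ℝ),
    E 0 = (vecMulVec v w).map Complex.ofReal ∧ DifferentiableAt ℂ E 0 ∧ 0 < C ∧ 0 < r ∧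
    r < perronEigenvalue R.M ∧ ∀ᶠ z in 𝓝 (0 : ℂ), (∀ n : ℕ,
      ‖R.charMatrix (Complex.exp z) ^ n - R.u z ^ n • E z‖ ≤ C * r ^ n) ∧
      ∃ x ≠ 0, R.charMatrix (Complex.exp z) *ᵥ x = R.u z • x := by
  obtain ⟨x, y, hx, hy, hx0, hy0, hxy⟩ := h.exists_eigenvectors
  obtain ⟨hu, hu0, -⟩ := h.isEigenvalueBranch_u
  have hl := h.pos
  set l := perronEigenvalue R.M with hldef
  -- The spectral projection onto the eigenline of `u z`.
  set E : ℂ → Matrix ι ι ℂ := fun z => (y z ⬝ᵥ x z)⁻¹ • vecMulVec (x z) (y z) with hE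
  have hdot0 : y 0 ⬝ᵥ x 0 = 1 := by rw [hx0, hy0, h.dotProduct_ofReal]
  have hxi : ∀ i, DifferentiableAt ℂ (fun z => x z i) 0 := fun i => differentiableAt_pi.1 hx i
  have hyi : ∀ i, DifferentiableAt ℂ (fun z => y z i) 0 := fun i => differentiableAt_pi.1 hy i
  have hdotd : DifferentiableAt ℂ (fun z => y z ⬝ᵥ x z) 0 := by
    simp only [dotProduct]
    fun_prop
  have hne : ∀ᶠ z in 𝓝 (0 : ℂ), y z ⬝ᵥ x z ≠ 0 :=
    hdotd.continuousAt.eventually_ne (by rw [hdot0]; exact one_ne_zero)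
  have hE0 : E 0 = (vecMulVec v w).map Complex.ofReal := by
    simp only [hE]
    rw [hdot0, hx0, hy0]
    ext i j
    simp [vecMulVec_apply]
  have hvd : DifferentiableAt ℂ (fun z => vecMulVec (x z) (y z)) 0 := by
    have h1 : ∀ z, vecMulVec (x z) (y z) = ∑ i, ∑ j, (x z i * y z j) • Matrix.single i j (1 : ℂ) := by
      intro z
      conv_lhs => rw [Matrix.matrix_eq_sum_single (vecMulVec (x z) (y z))]
      simp [vecMulVec_apply]
    simp only [h1]
    fun_prop
  have hEd : DifferentiableAt ℂ E 0 := (hdotd.inv (by rw [hdot0]; exact one_ne_zero)).smul hvd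
  obtain ⟨m, hm0, hm⟩ := h.gap
  obtain ⟨r, hr0, hrl, hr⟩ : ∃ r, 0 < r ∧ r < l ∧
      ‖((R.M - l • vecMulVec v w) ^ m).map Complex.ofReal‖ < r ^ m := by
    have h1 : ∀ᶠ r in 𝓝[<] l, ‖((R.M - l • vecMulVec v w) ^ m).map Complex.ofReal‖ < r ^ m :=
      ((continuous_pow m).continuousAt.eventually_const_lt hm).filter_mono nhdsWithin_le_nhds
    have h2 : ∀ᶠ r in 𝓝[<] l, 0 < r := (lt_mem_nhds hl).filter_mono nhdsWithin_le_nhds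
    obtain ⟨r, h3, h4, h5⟩ := (h1.and (h2.and self_mem_nhdsWithin)).exists
    exact ⟨r, h4, h5, h3⟩
  -- At `0` this is the matrix of the spectral gap. The bound on its `m`-th power is an open
  -- condition, so it holds uniformly for `z` near `0`.
  set D : ℂ → Matrix ι ι ℂ := fun z => R.charMatrix (Complex.exp z) - R.u z • E z with hD
  have hPc : ContinuousAt (fun z => R.charMatrix (Complex.exp z)) 0 := by
    unfold charMatrix
    fun_prop
  have hDc : ContinuousAt D 0 := hPc.sub (hu.continuousAt.smul hEd.continuousAt)
  have hD0 : D 0 = (R.M - l • vecMulVec v w).map Complex.ofReal := by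
    simp only [hD]
    rw [hE0, hu0, Complex.exp_zero, charMatrix_one]
    ext i j
    simp
  have hDm : ∀ᶠ z in 𝓝 (0 : ℂ), ‖D z ^ m‖ < r ^ m := by
    refine ((hDc.pow m).norm).eventually_lt_const ?_
    change ‖D 0 ^ m‖ < r ^ m
    rw [hD0, ← map_ofReal_pow]
    exact hr
  have hDK : ∀ᶠ z in 𝓝 (0 : ℂ), ‖D z‖ < ‖D 0‖ + r := hDc.norm.eventually_lt_const (by linarith)
  have hEK : ∀ᶠ z in 𝓝 (0 : ℂ), ‖1 - E z‖ < ‖1 - E 0‖ + 1 :=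
    (continuousAt_const.sub hEd.continuousAt).norm.eventually_lt_const (by simp)
  have hxne : ∀ᶠ z in 𝓝 (0 : ℂ), x z ≠ 0 := by
    filter_upwards [hne] with z hz h0
    rw [h0, dotProduct_zero] at hz
    exact hz rfl
  refine ⟨E, (‖(1 : Matrix ι ι ℂ)‖ + 1) * ((‖D 0‖ + r) / r) ^ m * (‖1 - E 0‖ + 1), r, hE0, hEd,
    by positivity, hr0, hrl, ?_⟩
  filter_upwards [hxy, hne, hDm, hDK, hEK, hxne] with z ⟨hPx, hyP⟩ hz hzm hzK hzE hzx
  refine ⟨fun n => ?_, x z, hzx, hPx⟩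
  have hEE : E z * E z = E z := by
    simp only [hE]
    rw [smul_mul_smul_comm, vecMulVec_mul_vecMulVec, vecMulVec_smul, smul_smul]
    congr 1
    field_simp
  have hPE : R.charMatrix (Complex.exp z) * E z = R.u z • E z := by
    simp only [hE]
    rw [mul_smul_comm, mul_vecMulVec, hPx, smul_vecMulVec, smul_comm]
  have hEP : E z * R.charMatrix (Complex.exp z) = R.u z • E z := by
    simp only [hE]
    rw [smul_mul_assoc, vecMulVec_mul, hyP, vecMulVec_smul, smul_comm]
  -- The remainder is `D ^ n (1 - E)`, also for `n = 0`.
  rw [← sub_smul_pow_mul hEE hPE hEP]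
  have h1 := norm_pow_le_of_norm_pow_le hm0 hr0 (K := ‖D 0‖ + r) (by linarith [norm_nonneg (D 0)])
    hzK.le hzm.le n
  refine (norm_mul_le _ _).trans ?_
  calc ‖D z ^ n‖ * ‖1 - E z‖
      ≤ (‖(1 : Matrix ι ι ℂ)‖ * ((‖D 0‖ + r) / r) ^ m * r ^ n) * (‖1 - E 0‖ + 1) := by
        gcongr
    _ ≤ ((‖(1 : Matrix ι ι ℂ)‖ + 1) * ((‖D 0‖ + r) / r) ^ m * r ^ n) * (‖1 - E 0‖ + 1) := by
        gcongr
        linarith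
    _ = _ := by ring

end IsPerronPair

end LinearRepresentation

end SymbolStatistics

/-! ### Scaled powers on the unit circle and positivity of `γ`. -/

namespace SymbolStatistics

open Matrix Filter Topology
open scoped Matrix.Norms.Operator

/-- Local expansion of the powers of a matrix function `T` of a real variable: Gaussian decay on
`[-π, π]`, and near `0` a dominant term `y ^ n E`, where `y` agrees to third order with the
characteristic function of a normal law with mean `β` and variance `γ`. -/
structure IsLocalExpansion {ι : Type*} [Fintype ι] [DecidableEq ι] (T : ℝ → Matrix ι ι ℂ)
    (Q : Matrix ι ι ℂ) (β γ : ℝ) (y : ℝ → ℂ) (E : ℝ → Matrix ι ι ℂ) (C c ρ δ : ℝ) : Prop where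
  pow_le : ∀ (n : ℕ) (t : ℝ), |t| ≤ Real.pi → ‖T t ^ n‖ ≤ C * Real.exp (-c * n * t ^ 2)
  pow_sub_le : ∀ (n : ℕ) (t : ℝ), |t| ≤ δ → ‖T t ^ n - y t ^ n • E t‖ ≤ C * ρ ^ n
  sub_le : ∀ t : ℝ, |t| ≤ δ → ‖E t - Q‖ ≤ C * |t|
  sub_exp_le : ∀ t : ℝ, |t| ≤ δ →
    ‖y t - Complex.exp (β * t * Complex.I - γ * t ^ 2 / 2)‖ ≤ C * |t| ^ 3
  norm_le : ∀ t : ℝ, |t| ≤ δ → ‖y t‖ ≤ Real.exp (-c * t ^ 2)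

lemma IsLocalExpansion.mono {ι : Type*} [Fintype ι] [DecidableEq ι] {T : ℝ → Matrix ι ι ℂ}
    {Q : Matrix ι ι ℂ} {β γ : ℝ} {y : ℝ → ℂ} {E : ℝ → Matrix ι ι ℂ} {C c ρ δ C' c' ρ' δ' : ℝ}
    (h : IsLocalExpansion T Q β γ y E C c ρ δ) (hC : 0 ≤ C) (hρ : 0 ≤ ρ) (hCC : C ≤ C')
    (hcc : c' ≤ c) (hρρ : ρ ≤ ρ') (hδδ : δ' ≤ δ) :
    IsLocalExpansion T Q β γ y E C' c' ρ' δ' where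
  pow_le n t ht := by
    refine (h.pow_le n t ht).trans ?_
    have := hC.trans hCC
    gcongr
  pow_sub_le n t ht := by
    refine (h.pow_sub_le n t (ht.trans hδδ)).trans ?_
    have := hC.trans hCC
    gcongr
  sub_le t ht := (h.sub_le t (ht.trans hδδ)).trans (by gcongr)
  sub_exp_le t ht := (h.sub_exp_le t (ht.trans hδδ)).trans (by gcongr)
  norm_le t ht := (h.norm_le t (ht.trans hδδ)).trans (by gcongr)

/-- A function with Gaussian decay that agrees to third order with `exp (iβt - γt²/2)` forces
`γ > 0`. -/
lemma pos_of_exp_approx {β γ C c δ : ℝ} {y : ℝ → ℂ} (hC : 0 < C) (hc : 0 < c) (hδ : 0 < δ)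
    (h₁ : ∀ t : ℝ, |t| ≤ δ →
      ‖y t - Complex.exp (β * t * Complex.I - γ * t ^ 2 / 2)‖ ≤ C * |t| ^ 3)
    (h₂ : ∀ t : ℝ, |t| ≤ δ → ‖y t‖ ≤ Real.exp (-c * t ^ 2)) : 0 < γ := by
  by_contra! hγ
  -- If `γ ≤ 0`, the exponential has modulus at least `1`. For `t < min 1 (1/c)` one has `e^{-ct²} ≤
  -- 1 - ct²/2`, and `t < c / (2C)` makes the error `C t³` less than `ct²/2`: a contradiction.
  obtain ⟨t, ht0, ht⟩ := exists_between (show 0 < min δ (min 1 (min (1 / c) (c / (2 * C)))) by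
    positivity)
  rw [lt_min_iff, lt_min_iff, lt_min_iff] at ht
  obtain ⟨htδ, ht1, htc, htC⟩ := ht
  have habs : |t| = t := abs_of_pos ht0
  have h3 := h₁ t (by rw [habs]; exact htδ.le)
  have h4 := h₂ t (by rw [habs]; exact htδ.le)
  have h5 : ‖Complex.exp (β * t * Complex.I - γ * t ^ 2 / 2)‖ = Real.exp (-γ * t ^ 2 / 2) := by
    rw [Complex.norm_exp]
    congr 1
    have : (β * t * Complex.I - γ * t ^ 2 / 2 : ℂ) =
        ((-γ * t ^ 2 / 2 : ℝ) : ℂ) + ((β * t : ℝ) : ℂ) * Complex.I := by push_cast; ring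
    rw [this]
    simp [-Complex.ofReal_mul, -Complex.ofReal_div]
  have h6 : 1 ≤ Real.exp (-γ * t ^ 2 / 2) := Real.one_le_exp (by nlinarith [sq_nonneg t])
  have h7 : ‖Complex.exp (β * t * Complex.I - γ * t ^ 2 / 2)‖ ≤
      ‖y t‖ + ‖y t - Complex.exp (β * t * Complex.I - γ * t ^ 2 / 2)‖ := by
    have := norm_sub_norm_le (Complex.exp (β * t * Complex.I - γ * t ^ 2 / 2)) (y t)
    rw [norm_sub_rev] at this
    linarith
  rw [habs] at h3
  set s := c * t ^ 2 with hs
  have hs0 : 0 < s := by positivity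
  have hs1 : s ≤ 1 := by
    have h8 : c * t < 1 := by rw [lt_div_iff₀ hc] at htc; linarith
    nlinarith
  have h9 : Real.exp (-c * t ^ 2) ≤ 1 - s / 2 := by
    have h10 : -c * t ^ 2 = -s := by rw [hs]; ring
    rw [h10, Real.exp_neg]
    have h11 := Real.add_one_le_exp s
    rw [inv_le_comm₀ (Real.exp_pos s) (by linarith)]
    refine le_trans ?_ h11
    rw [inv_le_iff_one_le_mul₀ (by linarith)]
    nlinarith
  have h12 : C * t ^ 3 < s / 2 := by
    rw [lt_div_iff₀ (by positivity)] at htC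
    have h13 : 0 < t ^ 2 := by positivity
    nlinarith
  linarith

namespace LinearRepresentation

variable {ι : Type*} [Fintype ι] [DecidableEq ι] (R : LinearRepresentation ι)

/-- The matrix `(e^{it} A + B) / λ`. -/
noncomputable def scaledMatrix (t : ℝ) : Matrix ι ι ℂ :=
  (perronEigenvalue R.M : ℂ)⁻¹ • R.charMatrix (Complex.exp (t * Complex.I))

/-- The expansions at `z = it` are divided by powers of `λ` and combined with the Gaussian decay,
which is what bounds `|y|` and yields `γ > 0`. -/
lemma exists_isLocalExpansion [Nonempty ι]
    (hpos : ∃ N, ∀ n, N ≤ n → ∀ i j, 0 < (R.M ^ n) i j) (hap : IsAperiodicPair R.A R.B) :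
    0 < perronEigenvalue R.M ∧ 0 < R.gamma ∧ ∃ v w : ι → ℝ, (∀ i, 0 < v i) ∧ (∀ i, 0 < w i) ∧
    ∃ (y : ℝ → ℂ) (E : ℝ → Matrix ι ι ℂ) (C c ρ δ : ℝ),
      0 < C ∧ 0 < c ∧ 0 < ρ ∧ ρ < 1 ∧ 0 < δ ∧
      IsLocalExpansion R.scaledMatrix ((vecMulVec v w).map Complex.ofReal) R.beta R.gamma
        y E C c ρ δ := by
  obtain ⟨v, w, h⟩ := R.exists_isPerronPair hpos
  have hl := h.pos
  obtain ⟨C₁, c, hC₁, hc, hdecay⟩ := exists_norm_charMatrix_pow_le hpos hap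
  obtain ⟨E, C₂, r, hE0, hEd, hC₂, hr0, hrl, hE⟩ := h.exists_spectral_expansion
  obtain ⟨C₃, hC₃⟩ := hEd.isBigO_sub.bound
  obtain ⟨C₄, hC₄⟩ := h.u_div_sub_exp_isBigO.bound
  set l := perronEigenvalue R.M with hldef
  have hlc : (l : ℂ) ≠ 0 := by exact_mod_cast hl.ne'
  have hlim : Tendsto (fun t : ℝ => (t * Complex.I : ℂ)) (𝓝 0) (𝓝 0) := by
    have : Continuous fun t : ℝ => (t * Complex.I : ℂ) := by fun_prop
    simpa using this.tendsto 0
  obtain ⟨δ₀, hδ₀, hδ⟩ := Metric.eventually_nhds_iff.1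
    (hlim.eventually (hE.and (hC₃.and hC₄)))
  -- Half of `δ₀` puts the closed interval inside the open ball; the cap `π` keeps it in the range
  -- of the decay estimate.
  set δ := min (δ₀ / 2) Real.pi with hδdef
  have hδpos : 0 < δ := lt_min (by linarith) Real.pi_pos
  have hloc : ∀ t : ℝ, |t| ≤ δ → _ := fun t ht => hδ (y := t) (by
    rw [Real.dist_eq, sub_zero]
    have := ht.trans (min_le_left _ _)
    linarith)
  have hnormI : ∀ t : ℝ, ‖(t * Complex.I : ℂ)‖ = |t| := fun t => by simp
  have hscale : ∀ (t : ℝ) (n : ℕ), R.scaledMatrix t ^ n =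
      ((l : ℂ) ^ n)⁻¹ • R.charMatrix (Complex.exp (t * Complex.I)) ^ n := fun t n => by
    rw [scaledMatrix, smul_pow, inv_pow]
  have hlnorm : ∀ n : ℕ, ‖((l : ℂ) ^ n)⁻¹‖ = (l ^ n)⁻¹ := fun n => by
    rw [norm_inv, norm_pow, Complex.norm_real, Real.norm_eq_abs, abs_of_pos hl]
  have hpowle : ∀ (n : ℕ) (t : ℝ), |t| ≤ Real.pi →
      ‖R.scaledMatrix t ^ n‖ ≤ C₁ * Real.exp (-c * n * t ^ 2) := fun n t ht => by
    rw [hscale, norm_smul, hlnorm, inv_mul_le_iff₀ (pow_pos hl n)]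
    refine (hdecay n t ht).trans (le_of_eq ?_)
    ring
  set C := max (max C₁ C₂) (max C₃ C₄) with hC
  have hCpos : 0 < C := hC₁.trans_le ((le_max_left _ _).trans (le_max_left _ _))
  have hexpand : IsLocalExpansion R.scaledMatrix ((vecMulVec v w).map Complex.ofReal) R.beta R.gamma
      (fun t => R.u (t * Complex.I) / l) (fun t => E (t * Complex.I)) C c (r / l) δ := by
    refine ⟨fun n t ht => (hpowle n t ht).trans ?_, fun n t ht => ?_, fun t ht => ?_,
      fun t ht => ?_, fun t ht => ?_⟩
    · gcongr
      exact (le_max_left _ _).trans (le_max_left _ _)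
    · have h1 := (hloc t ht).1.1 n
      rw [hscale]
      have h2 : ((l : ℂ) ^ n)⁻¹ • R.charMatrix (Complex.exp (t * Complex.I)) ^ n -
          (R.u (t * Complex.I) / l) ^ n • E (t * Complex.I) = ((l : ℂ) ^ n)⁻¹ •
          (R.charMatrix (Complex.exp (t * Complex.I)) ^ n -
            R.u (t * Complex.I) ^ n • E (t * Complex.I)) := by
        rw [smul_sub, smul_smul, div_pow, div_eq_inv_mul]
      rw [h2, norm_smul, hlnorm, inv_mul_le_iff₀ (pow_pos hl n), div_pow]
      refine h1.trans ?_
      have h3 : l ^ n * (C * (r ^ n / l ^ n)) = C * r ^ n := by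
        field_simp
      rw [h3]
      gcongr
      exact (le_max_right _ _).trans (le_max_left _ _)
    · have h1 := (hloc t ht).2.1
      rw [hE0, sub_zero, hnormI] at h1
      refine h1.trans ?_
      gcongr
      exact (le_max_left _ _).trans (le_max_right _ _)
    · have h1 := (hloc t ht).2.2
      have h2 : (R.beta * (t * Complex.I) + R.gamma * (t * Complex.I) ^ 2 / 2 : ℂ) =
          R.beta * t * Complex.I - R.gamma * t ^ 2 / 2 := by
        rw [mul_pow, Complex.I_sq]; ring
      rw [norm_pow, hnormI, h2] at h1
      refine h1.trans ?_
      gcongr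
      exact (le_max_right _ _).trans (le_max_right _ _)
    -- The value `y` is an eigenvalue of the scaled matrix, so `|y|^n ≤ C₁ e^{-cnt²}` for every `n`;
    -- taking `n`-th roots removes the constant.
    · obtain ⟨x, hx0, hx⟩ := (hloc t ht).1.2
      have hxs : R.scaledMatrix t *ᵥ x = (R.u (t * Complex.I) / l) • x := by
        rw [scaledMatrix, Matrix.smul_mulVec, hx, smul_smul, div_eq_inv_mul]
      refine le_of_forall_pow_le_mul_pow (C := C₁) (Real.exp_pos _) fun n => ?_
      have h1 := Matrix.linfty_opNorm_mulVec (R.scaledMatrix t ^ n) x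
      rw [pow_mulVec_of_eigen hxs, norm_smul, norm_pow] at h1
      refine (le_of_mul_le_mul_right h1 (norm_pos_iff.2 hx0)).trans
        ((hpowle n t (ht.trans (min_le_right _ _))).trans (le_of_eq ?_))
      rw [← Real.exp_nat_mul]
      congr 2
      ring
  refine ⟨hl, pos_of_exp_approx hCpos hc hδpos hexpand.sub_exp_le hexpand.norm_le, v, w,
    h.right_pos, h.left_pos, _, _, C, c, r / l, δ, hCpos, hc, div_pos hr0 hl,
    (div_lt_one hl).2 hrl, hδpos, hexpand⟩

end LinearRepresentation

end SymbolStatistics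

/-! ### Comparison of scalar powers with Gaussian characteristic functions. -/

namespace SymbolStatistics

open Matrix Filter Topology
open scoped Matrix.Norms.Operator

/-- Telescoping. The factor `q` on the left avoids the exponent `n - 1`. -/
lemma mul_norm_pow_sub_pow_le {a b : ℂ} {q : ℝ} (ha : ‖a‖ ≤ q) (hb : ‖b‖ ≤ q) (n : ℕ) :
    q * ‖a ^ n - b ^ n‖ ≤ n * q ^ n * ‖a - b‖ := by
  have hq : 0 ≤ q := (norm_nonneg a).trans ha
  induction n with
  | zero => simp
  | succ n ih =>
    have h1 : a ^ (n + 1) - b ^ (n + 1) = a * (a ^ n - b ^ n) + (a - b) * b ^ n := by ring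
    have h2 : ‖b ^ n‖ ≤ q ^ n := by rw [norm_pow]; gcongr
    calc q * ‖a ^ (n + 1) - b ^ (n + 1)‖
        ≤ q * (‖a‖ * ‖a ^ n - b ^ n‖ + ‖a - b‖ * ‖b ^ n‖) := by
          rw [h1, ← norm_mul, ← norm_mul]
          gcongr
          exact norm_add_le _ _
      _ ≤ q * (q * ‖a ^ n - b ^ n‖ + ‖a - b‖ * q ^ n) := by gcongr
      _ = q * (q * ‖a ^ n - b ^ n‖) + q ^ (n + 1) * ‖a - b‖ := by ring
      _ ≤ q * (n * q ^ n * ‖a - b‖) + q ^ (n + 1) * ‖a - b‖ := by gcongr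
      _ = _ := by push_cast; ring

lemma norm_exp_ofReal_mul_I_sub_le (θ : ℝ) (x : ℝ) :
    ‖Complex.exp (θ * Complex.I - x)‖ = Real.exp (-x) := by
  rw [Complex.norm_exp]
  simp

lemma abs_exp_neg_sub_exp_neg_le {x y m : ℝ} (hx : m ≤ x) (hy : m ≤ y) :
    |Real.exp (-x) - Real.exp (-y)| ≤ |x - y| * Real.exp (-m) := by
  wlog hxy : x ≤ y generalizing x y
  · rw [abs_sub_comm, abs_sub_comm x y]
    exact this hy hx (le_of_not_ge hxy)
  have h1 : Real.exp (-y) ≤ Real.exp (-x) := Real.exp_le_exp.2 (by linarith)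
  rw [abs_of_nonneg (by linarith), abs_of_nonpos (by linarith)]
  have h2 := Real.add_one_le_exp (x - y)
  have h3 : Real.exp (-y) = Real.exp (-x) * Real.exp (x - y) := by
    rw [← Real.exp_add]; congr 1; ring
  have h4 : Real.exp (-x) ≤ Real.exp (-m) := Real.exp_le_exp.2 (by linarith)
  have h5 := Real.exp_pos (-x)
  rw [h3]
  nlinarith

lemma norm_exp_sub_exp_le {θ₁ θ₂ x₁ x₂ m : ℝ} (h₁ : m ≤ x₁) (h₂ : m ≤ x₂) :
    ‖Complex.exp (θ₁ * Complex.I - x₁) - Complex.exp (θ₂ * Complex.I - x₂)‖ ≤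
      (|θ₁ - θ₂| + |x₁ - x₂|) * Real.exp (-m) := by
  have h3 : Complex.exp (θ₁ * Complex.I - x₁) - Complex.exp (θ₂ * Complex.I - x₂) =
      Complex.exp (θ₁ * Complex.I) * ((Real.exp (-x₁) - Real.exp (-x₂) : ℝ) : ℂ) +
      Complex.exp (θ₂ * Complex.I) * (Complex.exp (Complex.I * (θ₁ - θ₂ : ℝ)) - 1) *
        (Real.exp (-x₂) : ℝ) := by
    have h4 : Complex.exp (θ₁ * Complex.I) =
        Complex.exp (θ₂ * Complex.I) * Complex.exp (Complex.I * (θ₁ - θ₂ : ℝ)) := by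
      rw [← Complex.exp_add]
      congr 1
      push_cast
      ring
    rw [sub_eq_add_neg _ (x₁ : ℂ), Complex.exp_add, sub_eq_add_neg _ (x₂ : ℂ), Complex.exp_add, h4]
    push_cast
    ring
  rw [h3]
  refine (norm_add_le _ _).trans ?_
  rw [norm_mul, norm_mul, norm_mul, Complex.norm_exp_ofReal_mul_I, Complex.norm_exp_ofReal_mul_I,
    one_mul, one_mul, Complex.norm_real, Complex.norm_real, Real.norm_eq_abs, Real.norm_eq_abs,
    abs_of_pos (Real.exp_pos _), add_mul]
  have h4 := abs_exp_neg_sub_exp_neg_le h₁ h₂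
  have h5 : ‖Complex.exp (Complex.I * (θ₁ - θ₂ : ℝ)) - 1‖ ≤ |θ₁ - θ₂| :=
    Real.norm_exp_I_mul_ofReal_sub_one_le
  have h6 : ‖Complex.exp (Complex.I * (θ₁ - θ₂ : ℝ)) - 1‖ * Real.exp (-x₂) ≤
      |θ₁ - θ₂| * Real.exp (-m) :=
    mul_le_mul h5 (Real.exp_le_exp.2 (by linarith)) (Real.exp_pos _).le (abs_nonneg _)
  linarith

/-- In the variable `x = √n |t|` the polynomial factor is `(x + x³) / √n`, and half of the Gaussian
absorbs `x + x³`. -/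
lemma exists_add_cube_mul_exp_le {c : ℝ} (hc : 0 < c) : ∃ K, 0 < K ∧ ∀ (n : ℕ) (t : ℝ), 1 ≤ n →
    (|t| + n * |t| ^ 3) * Real.exp (-c * n * t ^ 2) ≤
      K * (√n)⁻¹ * Real.exp (-(c / 2) * n * t ^ 2) := by
  set d := min 1 (c / 4) with hd
  have hd0 : 0 < d := by positivity
  refine ⟨(d ^ 2)⁻¹, by positivity, fun n t hn => ?_⟩
  have hn0 : (0 : ℝ) < n := by exact_mod_cast hn
  set r := √(n : ℝ) with hr
  have hr0 : 0 < r := Real.sqrt_pos.2 hn0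
  have hr2 : r ^ 2 = n := Real.sq_sqrt hn0.le
  set x := r * |t| with hx
  have hx0 : 0 ≤ x := by positivity
  have hx2 : x ^ 2 = n * t ^ 2 := by rw [hx, mul_pow, hr2, sq_abs]
  have h1 : |t| + n * |t| ^ 3 = (x + x ^ 3) * r⁻¹ := by
    rw [← hr2, hx]; field_simp
  have h2 : Real.exp (-c * n * t ^ 2) =
      Real.exp (-(c / 2) * n * t ^ 2) * (Real.exp (c / 4 * x ^ 2) ^ 2)⁻¹ := by
    rw [← Real.exp_nat_mul, ← Real.exp_neg, ← Real.exp_add, hx2]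
    congr 1
    push_cast
    ring
  have h3 : d * (1 + x ^ 2) ≤ Real.exp (c / 4 * x ^ 2) := by
    have h4 := Real.add_one_le_exp (c / 4 * x ^ 2)
    have h5 : d ≤ 1 := min_le_left _ _
    have h6 : d * x ^ 2 ≤ c / 4 * x ^ 2 := by gcongr; exact min_le_right _ _
    linarith
  have h4 : x + x ^ 3 ≤ (d ^ 2)⁻¹ * Real.exp (c / 4 * x ^ 2) ^ 2 := by
    rw [← div_eq_inv_mul, le_div_iff₀ (by positivity)]
    have h5 : (d * (1 + x ^ 2)) ^ 2 ≤ Real.exp (c / 4 * x ^ 2) ^ 2 := by gcongr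
    have h6 : x + x ^ 3 ≤ (1 + x ^ 2) ^ 2 := by
      nlinarith [sq_nonneg (x - 1), sq_nonneg (x ^ 2 - x), sq_nonneg x]
    have h7 : (x + x ^ 3) * d ^ 2 ≤ (1 + x ^ 2) ^ 2 * d ^ 2 := by gcongr
    nlinarith
  rw [h1, h2]
  have h5 : 0 < Real.exp (c / 4 * x ^ 2) ^ 2 := by positivity
  calc (x + x ^ 3) * r⁻¹ * (Real.exp (-(c / 2) * n * t ^ 2) * (Real.exp (c / 4 * x ^ 2) ^ 2)⁻¹)
      ≤ ((d ^ 2)⁻¹ * Real.exp (c / 4 * x ^ 2) ^ 2) * r⁻¹ *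
        (Real.exp (-(c / 2) * n * t ^ 2) * (Real.exp (c / 4 * x ^ 2) ^ 2)⁻¹) := by gcongr
    _ = _ := by field_simp

/-- The characteristic function at `t` of the normal law with mean `β n` and variance
`γ₁ s + γ₂ (n - s)`. -/
noncomputable def gaussianTerm (β γ₁ γ₂ : ℝ) (n : ℕ) (s t : ℝ) : ℂ :=
  Complex.exp ((β * n * t : ℝ) * Complex.I - ((γ₁ * s + γ₂ * (n - s)) * t ^ 2 / 2 : ℝ))

lemma norm_gaussianTerm_le {β γ₁ γ₂ c : ℝ} (h₁ : c ≤ γ₁ / 2) (h₂ : c ≤ γ₂ / 2) {n : ℕ} {s : ℝ}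
    (hs : 0 ≤ s) (hsn : s ≤ n) (t : ℝ) :
    ‖gaussianTerm β γ₁ γ₂ n s t‖ ≤ Real.exp (-c * n * t ^ 2) := by
  rw [gaussianTerm, norm_exp_ofReal_mul_I_sub_le]
  refine Real.exp_le_exp.2 ?_
  have h3 : c * s ≤ γ₁ / 2 * s := by gcongr
  have h4 : c * (n - s) ≤ γ₂ / 2 * (n - s) := mul_le_mul_of_nonneg_right h₂ (by linarith)
  have h5 := mul_le_mul_of_nonneg_right (add_le_add h3 h4) (sq_nonneg t)
  nlinarith

-- Replacing `y₁, y₂` by their Gaussian approximations costs `n |t|³ e^{-cnt²}`. The result has mean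
-- `β(i + j)` and variance `γ₁ i + γ₂ j`; passing to `n = i + j + 1`, which counts the transition
-- letter, and to any real `s` in `[i, i + 1]` costs `|t| e^{-cnt²}`. The freedom in `s` later turns
-- the sum over `i` into an integral.
set_option maxHeartbeats 1000000 in
lemma norm_dominant_sub_gaussianTerm_le {β γ₁ γ₂ c C t : ℝ} (hc : 0 < c) (h₁ : c ≤ γ₁ / 2)
    (h₂ : c ≤ γ₂ / 2) (hC : 0 ≤ C) (ht : |t| ≤ Real.pi) {y₁ y₂ : ℂ}
    (hy₁ : ‖y₁‖ ≤ Real.exp (-c * t ^ 2)) (hy₂ : ‖y₂‖ ≤ Real.exp (-c * t ^ 2))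
    (he₁ : ‖y₁ - Complex.exp (β * t * Complex.I - γ₁ * t ^ 2 / 2)‖ ≤ C * |t| ^ 3)
    (he₂ : ‖y₂ - Complex.exp (β * t * Complex.I - γ₂ * t ^ 2 / 2)‖ ≤ C * |t| ^ 3)
    (i j : ℕ) {s : ℝ} (hs : i ≤ s) (hs' : s ≤ i + 1) :
    ‖y₁ ^ i * y₂ ^ j - gaussianTerm β γ₁ γ₂ (i + j + 1) s t‖ ≤
      (C * Real.exp (c * Real.pi ^ 2) ^ 2 + (|β| + (γ₁ + γ₂) * Real.pi / 2) *
        Real.exp (c * Real.pi ^ 2)) *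
      ((|t| + (i + j + 1 : ℕ) * |t| ^ 3) * Real.exp (-c * (i + j + 1 : ℕ) * t ^ 2)) := by
  set q := Real.exp (-c * t ^ 2) with hq
  set κ := Real.exp (c * Real.pi ^ 2) with hκ
  have hq0 : 0 < q := Real.exp_pos _
  have hκ0 : 0 < κ := Real.exp_pos _
  have ht2 : t ^ 2 ≤ Real.pi ^ 2 := sq_le_sq' (by linarith [abs_le.1 ht]) (abs_le.1 ht).2
  -- For `|t| ≤ π` one missing factor `q` costs at most `κ`; this converts the exponent `i + j` into
  -- `n`.
  have hqκ : 1 ≤ κ * q := by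
    rw [hκ, hq, ← Real.exp_add]
    refine Real.one_le_exp ?_
    nlinarith
  have hqpow : ∀ n : ℕ, q ^ n = Real.exp (-c * n * t ^ 2) := fun n => by
    rw [hq, ← Real.exp_nat_mul]; congr 1; ring
  set e₁ := Complex.exp (β * t * Complex.I - γ₁ * t ^ 2 / 2) with he₁def
  set e₂ := Complex.exp (β * t * Complex.I - γ₂ * t ^ 2 / 2) with he₂def
  have hexp : ∀ γ : ℝ, c ≤ γ / 2 →
      ‖Complex.exp (β * t * Complex.I - γ * t ^ 2 / 2)‖ ≤ q := fun γ hγ => by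
    have h3 : (β * t * Complex.I - γ * t ^ 2 / 2 : ℂ) =
        ((β * t : ℝ) : ℂ) * Complex.I - ((γ * t ^ 2 / 2 : ℝ) : ℂ) := by push_cast; ring
    rw [h3, norm_exp_ofReal_mul_I_sub_le]
    refine Real.exp_le_exp.2 ?_
    nlinarith [mul_le_mul_of_nonneg_right hγ (sq_nonneg t)]
  have hne₁ := hexp γ₁ h₁
  have hne₂ := hexp γ₂ h₂
  have hp₁ := mul_norm_pow_sub_pow_le hy₁ hne₁ i
  have hp₂ := mul_norm_pow_sub_pow_le hy₂ hne₂ j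
  set n := i + j + 1 with hn
  have hmain : ‖y₁ ^ i * y₂ ^ j - e₁ ^ i * e₂ ^ j‖ ≤ C * κ ^ 2 * (n * |t| ^ 3 * q ^ n) := by
    have h3 : y₁ ^ i * y₂ ^ j - e₁ ^ i * e₂ ^ j =
        (y₁ ^ i - e₁ ^ i) * y₂ ^ j + e₁ ^ i * (y₂ ^ j - e₂ ^ j) := by ring
    have h4 : ‖y₂ ^ j‖ ≤ q ^ j := by rw [norm_pow]; gcongr
    have h5 : ‖e₁ ^ i‖ ≤ q ^ i := by rw [norm_pow]; gcongr
    have h6 : q * ‖y₁ ^ i * y₂ ^ j - e₁ ^ i * e₂ ^ j‖ ≤ (i + j) * q ^ (i + j) * (C * |t| ^ 3) := by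
      calc q * ‖y₁ ^ i * y₂ ^ j - e₁ ^ i * e₂ ^ j‖
          ≤ q * (‖y₁ ^ i - e₁ ^ i‖ * ‖y₂ ^ j‖ + ‖e₁ ^ i‖ * ‖y₂ ^ j - e₂ ^ j‖) := by
            rw [h3, ← norm_mul, ← norm_mul]
            gcongr
            exact norm_add_le _ _
        _ ≤ q * (‖y₁ ^ i - e₁ ^ i‖ * q ^ j + q ^ i * ‖y₂ ^ j - e₂ ^ j‖) := by gcongr
        _ = (q * ‖y₁ ^ i - e₁ ^ i‖) * q ^ j + q ^ i * (q * ‖y₂ ^ j - e₂ ^ j‖) := by ring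
        _ ≤ (i * q ^ i * ‖y₁ - e₁‖) * q ^ j + q ^ i * (j * q ^ j * ‖y₂ - e₂‖) := by gcongr
        _ ≤ (i * q ^ i * (C * |t| ^ 3)) * q ^ j + q ^ i * (j * q ^ j * (C * |t| ^ 3)) := by gcongr
        _ = _ := by rw [pow_add]; ring
    have h7 : ((i : ℝ) + j) ≤ n := by rw [hn]; push_cast; linarith
    have h8 : q ^ (i + j) ≤ κ * q ^ n := by
      rw [hn, pow_succ, mul_left_comm]
      exact le_mul_of_one_le_right (by positivity) hqκ
    calc ‖y₁ ^ i * y₂ ^ j - e₁ ^ i * e₂ ^ j‖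
        ≤ (κ * q) * ‖y₁ ^ i * y₂ ^ j - e₁ ^ i * e₂ ^ j‖ :=
          le_mul_of_one_le_left (norm_nonneg _) hqκ
      _ = κ * (q * ‖y₁ ^ i * y₂ ^ j - e₁ ^ i * e₂ ^ j‖) := by ring
      _ ≤ κ * ((i + j) * q ^ (i + j) * (C * |t| ^ 3)) := by gcongr
      _ ≤ κ * (n * (κ * q ^ n) * (C * |t| ^ 3)) := by gcongr
      _ = _ := by ring
  have hgauss : ‖e₁ ^ i * e₂ ^ j - gaussianTerm β γ₁ γ₂ n s t‖ ≤
      (|β| + (γ₁ + γ₂) * Real.pi / 2) * κ * (|t| * q ^ n) := by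
    have h3 : e₁ ^ i * e₂ ^ j = Complex.exp ((β * (i + j) * t : ℝ) * Complex.I -
        ((γ₁ * i + γ₂ * j) * t ^ 2 / 2 : ℝ)) := by
      rw [he₁def, he₂def, ← Complex.exp_nat_mul, ← Complex.exp_nat_mul, ← Complex.exp_add]
      congr 1
      push_cast
      ring
    have hncast : (n : ℝ) = i + j + 1 := by rw [hn]; push_cast; ring
    have hi0 : (0 : ℝ) ≤ i := Nat.cast_nonneg i
    have hj0 : (0 : ℝ) ≤ j := Nat.cast_nonneg j
    have hγ₁ : 0 < γ₁ := by linarith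
    have hγ₂ : 0 < γ₂ := by linarith
    rw [h3, gaussianTerm]
    have h4 := norm_exp_sub_exp_le (θ₁ := β * (i + j) * t) (θ₂ := β * n * t)
      (x₁ := (γ₁ * i + γ₂ * j) * t ^ 2 / 2) (x₂ := (γ₁ * s + γ₂ * (n - s)) * t ^ 2 / 2)
      (m := c * (i + j) * t ^ 2) (by
        nlinarith [mul_le_mul_of_nonneg_right h₁ (mul_nonneg hi0 (sq_nonneg t)),
          mul_le_mul_of_nonneg_right h₂ (mul_nonneg hj0 (sq_nonneg t))]) (by
        have h5 : 0 ≤ n - s := by linarith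
        nlinarith [mul_le_mul_of_nonneg_right h₁ (mul_nonneg (hi0.trans hs) (sq_nonneg t)),
          mul_le_mul_of_nonneg_right h₂ (mul_nonneg h5 (sq_nonneg t)),
          mul_nonneg hc.le (sq_nonneg t)])
    refine h4.trans ?_
    have h5 : |β * (i + j) * t - β * n * t| = |β| * |t| := by
      rw [hncast, ← abs_mul, ← abs_neg]; congr 1; ring
    have h6 : |(γ₁ * i + γ₂ * j) * t ^ 2 / 2 - (γ₁ * s + γ₂ * (n - s)) * t ^ 2 / 2| ≤
        (γ₁ + γ₂) * Real.pi / 2 * |t| := by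
      have h7 : (γ₁ * i + γ₂ * j) * t ^ 2 / 2 - (γ₁ * s + γ₂ * (n - s)) * t ^ 2 / 2 =
          (γ₁ * (i - s) + γ₂ * (s - i - 1)) * (t ^ 2 / 2) := by rw [hncast]; ring
      have h8 : |γ₁ * (i - s) + γ₂ * (s - i - 1)| ≤ γ₁ + γ₂ := by
        have h9 : γ₁ * (s - i) ≤ γ₁ := mul_le_of_le_one_right hγ₁.le (by linarith)
        have h10 : 0 ≤ γ₁ * (s - i) := mul_nonneg hγ₁.le (by linarith)
        have h11 : γ₂ * (i + 1 - s) ≤ γ₂ := mul_le_of_le_one_right hγ₂.le (by linarith)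
        have h12 : 0 ≤ γ₂ * (i + 1 - s) := mul_nonneg hγ₂.le (by linarith)
        rw [abs_le]; constructor <;> linarith
      have h9 : t ^ 2 ≤ Real.pi * |t| := by
        rw [← sq_abs, sq]
        exact mul_le_mul_of_nonneg_right ht (abs_nonneg t)
      rw [h7, abs_mul, abs_of_nonneg (show 0 ≤ t ^ 2 / 2 by positivity)]
      calc |γ₁ * (i - s) + γ₂ * (s - i - 1)| * (t ^ 2 / 2)
          ≤ (γ₁ + γ₂) * (Real.pi * |t| / 2) := by gcongr
        _ = _ := by ring
    have h7 : Real.exp (-(c * (i + j) * t ^ 2)) ≤ κ * q ^ n := by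
      have h8 : Real.exp (-(c * (i + j) * t ^ 2)) = q ^ (i + j) := by
        rw [hqpow]; push_cast; congr 1; ring
      rw [h8, hn, pow_succ, mul_left_comm]
      exact le_mul_of_one_le_right (by positivity) hqκ
    calc _ ≤ (|β| * |t| + (γ₁ + γ₂) * Real.pi / 2 * |t|) * (κ * q ^ n) := by
          rw [h5]
          gcongr
      _ = _ := by ring
  have hfin := (norm_sub_le_norm_sub_add_norm_sub (y₁ ^ i * y₂ ^ j) (e₁ ^ i * e₂ ^ j)
    (gaussianTerm β γ₁ γ₂ n s t)).trans (add_le_add hmain hgauss)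
  refine hfin.trans ?_
  rw [← hqpow]
  have hγ₁ : 0 < γ₁ := by linarith
  have hγ₂ : 0 < γ₂ := by linarith
  have hpi := Real.pi_pos
  have ha : 0 ≤ C * κ ^ 2 * (|t| * q ^ n) := by positivity
  have hb : 0 ≤ (|β| + (γ₁ + γ₂) * Real.pi / 2) * κ * (n * |t| ^ 3 * q ^ n) := by positivity
  linarith

end SymbolStatistics

/-! ### Products of powers from the two components. -/

namespace SymbolStatistics

open Matrix Filter Topology
open scoped Matrix.Norms.Operator

lemma norm_mul_mul_le {k l m n : Type*} [Fintype k] [Fintype l] [Fintype m] [Fintype n]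
    (A : Matrix k l ℂ) (B : Matrix l m ℂ) (D : Matrix m n ℂ) {a b d : ℝ} (hA : ‖A‖ ≤ a)
    (hB : ‖B‖ ≤ b) (hD : ‖D‖ ≤ d) : ‖A * B * D‖ ≤ a * b * d := by
  have ha := (norm_nonneg A).trans hA
  have hb := (norm_nonneg B).trans hB
  calc ‖A * B * D‖ ≤ ‖A * B‖ * ‖D‖ := Matrix.linfty_opNorm_mul _ _
    _ ≤ (‖A‖ * ‖B‖) * ‖D‖ := by gcongr; exact Matrix.linfty_opNorm_mul _ _
    _ ≤ a * b * d := by gcongr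

-- Near `0`, each power is replaced by its dominant part, with errors `ρ^i` and `ρ^j`. Then `E₁`,
-- `S`, `E₂` are replaced by `Q₁`, `S 0`, `Q₂` at a cost `O(|t|)`, and the scalar factor by the
-- Gaussian. Away from `0`, both terms are already of size `e^{-cnt²}`.
set_option maxHeartbeats 2000000 in
lemma exists_norm_pow_mul_pow_sub_le {ι₁ ι₂ : Type*} [Fintype ι₁] [DecidableEq ι₁] [Fintype ι₂]
    [DecidableEq ι₂] {T₁ : ℝ → Matrix ι₁ ι₁ ℂ} {T₂ : ℝ → Matrix ι₂ ι₂ ℂ} {Q₁ : Matrix ι₁ ι₁ ℂ}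
    {Q₂ : Matrix ι₂ ι₂ ℂ} {β γ₁ γ₂ : ℝ} {y₁ y₂ : ℝ → ℂ} {E₁ : ℝ → Matrix ι₁ ι₁ ℂ}
    {E₂ : ℝ → Matrix ι₂ ι₂ ℂ} {C c ρ δ D : ℝ} (h₁ : IsLocalExpansion T₁ Q₁ β γ₁ y₁ E₁ C c ρ δ)
    (h₂ : IsLocalExpansion T₂ Q₂ β γ₂ y₂ E₂ C c ρ δ) (hC : 0 < C) (hc : 0 < c) (hρ : 0 < ρ)
    (hδ : 0 < δ) (hγ₁ : c ≤ γ₁ / 2) (hγ₂ : c ≤ γ₂ / 2) {S : ℝ → Matrix ι₁ ι₂ ℂ}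
    (hD : 0 ≤ D) (hS : ∀ t, ‖S t‖ ≤ D) (hS' : ∀ t, ‖S t - S 0‖ ≤ D * |t|) :
    ∃ K, 0 < K ∧ ∀ t : ℝ, |t| ≤ Real.pi → ∀ (i j : ℕ) (s : ℝ), i ≤ s → s ≤ i + 1 →
      ‖T₁ t ^ i * S t * T₂ t ^ j - gaussianTerm β γ₁ γ₂ (i + j + 1) s t • (Q₁ * S 0 * Q₂)‖ ≤
        K * (ρ ^ i + ρ ^ j) + K * ((√(i + j + 1 : ℕ))⁻¹ *
          Real.exp (-(c / 2) * (i + j + 1 : ℕ) * t ^ 2)) := by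
  obtain ⟨K₃, hK₃, hW⟩ := exists_add_cube_mul_exp_le hc
  set κ := Real.exp (c * Real.pi ^ 2) with hκ
  have hκ0 : 0 < κ := Real.exp_pos _
  have hpi := Real.pi_pos
  set B₁ := ‖Q₁‖ + C * Real.pi with hB₁
  set B₂ := ‖Q₂‖ + C * Real.pi with hB₂
  set K₂ := C * D * B₂ + ‖Q₁‖ * D * B₂ + ‖Q₁‖ * D * C with hK₂
  set Kd := C * κ ^ 2 + (|β| + (γ₁ + γ₂) * Real.pi / 2) * κ with hKd
  set Q₀ := Q₁ * S 0 * Q₂ with hQ₀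
  have hB₁0 : 0 ≤ B₁ := by positivity
  have hB₂0 : 0 ≤ B₂ := by positivity
  have hK₂0 : 0 ≤ K₂ := by positivity
  have hKd0 : 0 ≤ Kd := by
    have : 0 < γ₁ + γ₂ := by linarith
    positivity
  set K₁ := D * C ^ 2 + B₁ * D * C with hK₁
  have hK₁0 : 0 ≤ K₁ := by positivity
  -- The summands come from freezing the matrices, from the Gaussian approximation, and from `|t| >
  -- δ`, where `1 ≤ |t| / δ`.
  set K₄ := κ * K₂ + Kd * ‖Q₀‖ + (C ^ 2 * D * κ + ‖Q₀‖) / δ with hK₄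
  have hK₄0 : 0 ≤ K₄ := by positivity
  refine ⟨K₁ + K₄ * K₃ + 1, by positivity, fun t ht i j s hs hs' => ?_⟩
  set n := i + j + 1 with hn
  set f := gaussianTerm β γ₁ γ₂ n s t with hf
  set e := Real.exp (-c * n * t ^ 2) with he
  have he0 : 0 < e := Real.exp_pos _
  have ht2 : t ^ 2 ≤ Real.pi ^ 2 := sq_le_sq' (by linarith [abs_le.1 ht]) (abs_le.1 ht).2
  have hdecay : Real.exp (-c * i * t ^ 2) * Real.exp (-c * j * t ^ 2) ≤ κ * e := by
    rw [hκ, he, ← Real.exp_add, ← Real.exp_add]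
    refine Real.exp_le_exp.2 ?_
    rw [hn]
    push_cast
    nlinarith
  have hkey : ‖T₁ t ^ i * S t * T₂ t ^ j - f • Q₀‖ ≤
      K₁ * (ρ ^ i + ρ ^ j) + K₄ * ((|t| + n * |t| ^ 3) * e) := by
    have hK₁ρ : 0 ≤ K₁ * (ρ ^ i + ρ ^ j) := by positivity
    rcases le_or_gt |t| δ with hδt | hδt
    · have hEb₁ : ‖E₁ t‖ ≤ B₁ := by
        have h3 := norm_le_norm_add_norm_sub' (E₁ t) Q₁
        have h4 := h₁.sub_le t hδt
        have h5 : C * |t| ≤ C * Real.pi := by gcongr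
        linarith
      have hEb₂ : ‖E₂ t‖ ≤ B₂ := by
        have h3 := norm_le_norm_add_norm_sub' (E₂ t) Q₂
        have h4 := h₂.sub_le t hδt
        have h5 : C * |t| ≤ C * Real.pi := by gcongr
        linarith
      have hy₁ := h₁.norm_le t hδt
      have hy₂ := h₂.norm_le t hδt
      have hy₁i : ‖y₁ t ^ i‖ ≤ Real.exp (-c * i * t ^ 2) := by
        rw [norm_pow]
        refine (pow_le_pow_left₀ (norm_nonneg _) hy₁ i).trans (le_of_eq ?_)
        rw [← Real.exp_nat_mul]; congr 1; ring
      have hy₂j : ‖y₂ t ^ j‖ ≤ Real.exp (-c * j * t ^ 2) := by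
        rw [norm_pow]
        refine (pow_le_pow_left₀ (norm_nonneg _) hy₂ j).trans (le_of_eq ?_)
        rw [← Real.exp_nat_mul]; congr 1; ring
      have hsplit : T₁ t ^ i * S t * T₂ t ^ j - f • Q₀ =
          (T₁ t ^ i - y₁ t ^ i • E₁ t) * S t * T₂ t ^ j +
          (y₁ t ^ i • E₁ t) * S t * (T₂ t ^ j - y₂ t ^ j • E₂ t) +
          (y₁ t ^ i * y₂ t ^ j) • ((E₁ t - Q₁) * S t * E₂ t + Q₁ * (S t - S 0) * E₂ t +
            Q₁ * S 0 * (E₂ t - Q₂)) + (y₁ t ^ i * y₂ t ^ j - f) • Q₀ := by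
        rw [hQ₀]
        simp only [Matrix.sub_mul, Matrix.mul_sub, Matrix.smul_mul, Matrix.mul_smul, smul_add,
          smul_sub, sub_smul, smul_smul]
        rw [mul_comm (y₂ t ^ j) (y₁ t ^ i)]
        abel
      have hp₂ : ‖T₂ t ^ j‖ ≤ C := (h₂.pow_le j t ht).trans
        (mul_le_of_le_one_right hC.le (Real.exp_le_one_iff.2 (by
          have : 0 ≤ c * j * t ^ 2 := by positivity
          linarith)))
      have hn1 : ‖(T₁ t ^ i - y₁ t ^ i • E₁ t) * S t * T₂ t ^ j‖ ≤ C * ρ ^ i * D * C :=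
        norm_mul_mul_le _ _ _ (h₁.pow_sub_le i t hδt) (hS t) hp₂
      have hyE : ‖y₁ t ^ i • E₁ t‖ ≤ B₁ := by
        rw [norm_smul]
        refine le_trans ?_ hEb₁
        refine mul_le_of_le_one_left (norm_nonneg _) (hy₁i.trans (Real.exp_le_one_iff.2 ?_))
        have : 0 ≤ c * i * t ^ 2 := by positivity
        linarith
      have hn2 : ‖(y₁ t ^ i • E₁ t) * S t * (T₂ t ^ j - y₂ t ^ j • E₂ t)‖ ≤
          B₁ * D * (C * ρ ^ j) :=
        norm_mul_mul_le _ _ _ hyE (hS t) (h₂.pow_sub_le j t hδt)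
      have hn3 : ‖(E₁ t - Q₁) * S t * E₂ t + Q₁ * (S t - S 0) * E₂ t +
            Q₁ * S 0 * (E₂ t - Q₂)‖ ≤ K₂ * |t| := by
        have h3 := norm_mul_mul_le _ _ _ (h₁.sub_le t hδt) (hS t) hEb₂
        have h4 := norm_mul_mul_le _ _ _ (le_refl ‖Q₁‖) (hS' t) hEb₂
        have h5 := norm_mul_mul_le _ _ _ (le_refl ‖Q₁‖) (hS 0) (h₂.sub_le t hδt)
        refine (norm_add₃_le).trans ?_
        rw [hK₂]
        linarith
      have hn3' : ‖(y₁ t ^ i * y₂ t ^ j) • ((E₁ t - Q₁) * S t * E₂ t + Q₁ * (S t - S 0) * E₂ t +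
            Q₁ * S 0 * (E₂ t - Q₂))‖ ≤ κ * e * (K₂ * |t|) := by
        rw [norm_smul, norm_mul]
        have : ‖y₁ t ^ i‖ * ‖y₂ t ^ j‖ ≤ κ * e := (by gcongr : _ ≤ _).trans hdecay
        gcongr
      have hn4 : ‖(y₁ t ^ i * y₂ t ^ j - f) • Q₀‖ ≤
          Kd * ((|t| + n * |t| ^ 3) * e) * ‖Q₀‖ := by
        rw [norm_smul]
        gcongr
        exact norm_dominant_sub_gaussianTerm_le hc hγ₁ hγ₂ hC.le ht hy₁ hy₂
          (h₁.sub_exp_le t hδt) (h₂.sub_exp_le t hδt) i j hs hs'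
      rw [hsplit]
      refine (norm_add_le _ _).trans ?_
      have h3 := norm_add₃_le (a := (T₁ t ^ i - y₁ t ^ i • E₁ t) * S t * T₂ t ^ j)
        (b := (y₁ t ^ i • E₁ t) * S t * (T₂ t ^ j - y₂ t ^ j • E₂ t))
        (c := (y₁ t ^ i * y₂ t ^ j) • ((E₁ t - Q₁) * S t * E₂ t + Q₁ * (S t - S 0) * E₂ t +
            Q₁ * S 0 * (E₂ t - Q₂)))
      have h4 : κ * e * (K₂ * |t|) ≤ κ * K₂ * ((|t| + n * |t| ^ 3) * e) := by
        have : 0 ≤ κ * K₂ * e * (n * |t| ^ 3) := by positivity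
        linarith
      have h5 : C * ρ ^ i * D * C + B₁ * D * (C * ρ ^ j) ≤ K₁ * (ρ ^ i + ρ ^ j) := by
        have h6 : 0 ≤ D * C ^ 2 * ρ ^ j := by positivity
        have h7 : 0 ≤ B₁ * D * C * ρ ^ i := by positivity
        rw [hK₁]
        linarith
      have h6 : 0 ≤ (C ^ 2 * D * κ + ‖Q₀‖) / δ * ((|t| + n * |t| ^ 3) * e) := by positivity
      rw [hK₄]
      linarith
    · have h3 := norm_mul_mul_le _ _ _ (h₁.pow_le i t ht) (hS t) (h₂.pow_le j t ht)
      have h4 : ‖f • Q₀‖ ≤ e * ‖Q₀‖ := by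
        rw [norm_smul]
        gcongr
        refine norm_gaussianTerm_le hγ₁ hγ₂ ((Nat.cast_nonneg i).trans hs) (hs'.trans ?_) t
        rw [hn]
        push_cast
        linarith [(Nat.cast_nonneg j : (0 : ℝ) ≤ j)]
      have h5 : C * Real.exp (-c * i * t ^ 2) * D * (C * Real.exp (-c * j * t ^ 2)) ≤
          C ^ 2 * D * (κ * e) := by
        calc _ = C ^ 2 * D * (Real.exp (-c * i * t ^ 2) * Real.exp (-c * j * t ^ 2)) := by ring
          _ ≤ _ := by gcongr
      have h6 : (C ^ 2 * D * κ + ‖Q₀‖) * e ≤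
          (C ^ 2 * D * κ + ‖Q₀‖) / δ * ((|t| + n * |t| ^ 3) * e) := by
        have h7 : δ ≤ |t| + n * |t| ^ 3 := hδt.le.trans (le_add_of_nonneg_right (by positivity))
        calc (C ^ 2 * D * κ + ‖Q₀‖) * e = (C ^ 2 * D * κ + ‖Q₀‖) / δ * (δ * e) := by
              field_simp
          _ ≤ _ := by gcongr
      have h7 : 0 ≤ (κ * K₂ + Kd * ‖Q₀‖) * ((|t| + n * |t| ^ 3) * e) := by positivity
      refine (norm_sub_le _ _).trans ?_
      rw [hK₄]
      linarith
  have hWn := hW n t (by omega)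
  have h3 : K₄ * ((|t| + n * |t| ^ 3) * e) ≤
      K₄ * (K₃ * (√(n : ℝ))⁻¹ * Real.exp (-(c / 2) * n * t ^ 2)) := by gcongr
  have h4 : 0 ≤ (K₄ * K₃ + 1) * (ρ ^ i + ρ ^ j) := by positivity
  have h5 : 0 ≤ (K₁ + 1) * ((√(n : ℝ))⁻¹ * Real.exp (-(c / 2) * n * t ^ 2)) := by positivity
  refine hkey.trans ?_
  linarith

end SymbolStatistics

/-! ### Fourier coefficients and the Gaussian density. -/

namespace SymbolStatistics

open Matrix Filter Topology MeasureTheory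
open scoped Matrix.Norms.Operator

/-- The density at `k` of the normal law with mean `β n` and variance `γ₁ s + γ₂ (n - s)`. -/
noncomputable def gaussianDensity (β γ₁ γ₂ : ℝ) (n k : ℕ) (s : ℝ) : ℝ :=
  Real.exp (-(k - β * n) ^ 2 / (2 * (γ₁ * s + γ₂ * (n - s)))) /
    √(2 * Real.pi * (γ₁ * s + γ₂ * (n - s)))

lemma variance_pos {γ₁ γ₂ : ℝ} (h₁ : 0 < γ₁) (h₂ : 0 < γ₂) {n : ℕ} (hn : 1 ≤ n) {s : ℝ}
    (hs : 0 ≤ s) (hsn : s ≤ n) : 0 < γ₁ * s + γ₂ * (n - s) := by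
  have hn0 : (0 : ℝ) < n := by exact_mod_cast hn
  rcases hs.eq_or_lt with h | h
  · rw [← h]
    simpa using mul_pos h₂ hn0
  · have h3 := mul_pos h₁ h
    have h4 := mul_nonneg h₂.le (sub_nonneg.2 hsn)
    linarith

lemma exp_mul_gaussianTerm (β γ₁ γ₂ : ℝ) (n k : ℕ) (s t : ℝ) :
    Complex.exp (-(k * t) * Complex.I) * gaussianTerm β γ₁ γ₂ n s t =
      Complex.exp (Complex.I * ((β * n - k : ℝ) : ℂ) * t) *
        Complex.exp (-(((γ₁ * s + γ₂ * (n - s)) / 2 : ℝ) : ℂ) * t ^ 2) := by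
  rw [gaussianTerm, ← Complex.exp_add, ← Complex.exp_add]
  congr 1
  push_cast
  ring

lemma integrable_exp_mul_gaussianTerm {β γ₁ γ₂ : ℝ} {n : ℕ} (k : ℕ) {s : ℝ}
    (hσ : 0 < γ₁ * s + γ₂ * (n - s)) :
    Integrable fun t : ℝ => Complex.exp (-(k * t) * Complex.I) * gaussianTerm β γ₁ γ₂ n s t := by
  have h := integrable_cexp_quadratic (b := (((γ₁ * s + γ₂ * (n - s)) / 2 : ℝ) : ℂ))
    (by rw [Complex.ofReal_re]; positivity) (Complex.I * ((β * n - k : ℝ) : ℂ)) 0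
  refine h.congr (Eventually.of_forall fun t => ?_)
  simp only
  rw [exp_mul_gaussianTerm, ← Complex.exp_add]
  congr 1
  ring

lemma integral_exp_mul_gaussianTerm {β γ₁ γ₂ : ℝ} {n : ℕ} (k : ℕ) {s : ℝ}
    (hσ : 0 < γ₁ * s + γ₂ * (n - s)) :
    ∫ t : ℝ, Complex.exp (-(k * t) * Complex.I) * gaussianTerm β γ₁ γ₂ n s t =
      (2 * Real.pi * gaussianDensity β γ₁ γ₂ n k s : ℝ) := by
  simp only [exp_mul_gaussianTerm]
  rw [gaussianDensity]
  set σ := γ₁ * s + γ₂ * (n - s) with hσdef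
  rw [fourierIntegral_gaussian (by rw [Complex.ofReal_re]; positivity)]
  have hpi := Real.pi_pos
  have h1 : ((Real.pi : ℂ) / ((σ / 2 : ℝ) : ℂ)) ^ (1 / 2 : ℂ) =
      ((2 * Real.pi / √(2 * Real.pi * σ) : ℝ) : ℂ) := by
    have h2 : (1 / 2 : ℂ) = ((1 / 2 : ℝ) : ℂ) := by push_cast; rfl
    rw [← Complex.ofReal_div, h2, ← Complex.ofReal_cpow (by positivity), ← Real.sqrt_eq_rpow]
    congr 1
    rw [eq_div_iff (by positivity), ← Real.sqrt_mul (by positivity)]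
    have h3 : Real.pi / (σ / 2) * (2 * Real.pi * σ) = (2 * Real.pi) ^ 2 := by
      field_simp
    rw [h3, Real.sqrt_sq (by positivity)]
  have h2 : Complex.exp (-((β * n - k : ℝ) : ℂ) ^ 2 / (4 * ((σ / 2 : ℝ) : ℂ))) =
      (Real.exp (-(k - β * n) ^ 2 / (2 * σ)) : ℝ) := by
    rw [Complex.ofReal_exp]
    congr 1
    have : (σ : ℂ) ≠ 0 := by exact_mod_cast hσ.ne'
    push_cast
    field_simp
    ring
  rw [h1, h2, ← Complex.ofReal_mul]
  congr 1
  ring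

lemma integral_exp_neg_mul_nat {c : ℝ} (n : ℕ) :
    ∫ t : ℝ, Real.exp (-(c / 2) * n * t ^ 2) = √(2 * Real.pi / c) * (√(n : ℝ))⁻¹ := by
  have h1 : ∀ t : ℝ, -(c / 2) * n * t ^ 2 = -(c / 2 * n) * t ^ 2 := fun t => by ring
  simp only [h1]
  rw [integral_gaussian, ← Real.sqrt_inv, ← Real.sqrt_mul' _ (by positivity)]
  congr 1
  rcases eq_or_ne c 0 with rfl | hc
  · simp
  rcases eq_or_ne (n : ℝ) 0 with hn | hn
  · simp [hn]
  field_simp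

/-- The Fourier coefficients of a function on `[-π, π]` that is close to a multiple of a Gaussian
characteristic function are close to a multiple of the Gaussian density. -/
lemma exists_norm_fourierCoeff_sub_le {β γ₁ γ₂ c : ℝ} (hc : 0 < c) (h₁ : c ≤ γ₁ / 2)
    (h₂ : c ≤ γ₂ / 2) : ∃ K, 0 < K ∧ ∀ (n k : ℕ) (s A B : ℝ) (g₀ : ℂ) (g : ℝ → ℂ), 1 ≤ n → 0 ≤ s →
      s ≤ n → 0 ≤ A → 0 ≤ B → Continuous g →
      (∀ t : ℝ, |t| ≤ Real.pi → ‖g t - gaussianTerm β γ₁ γ₂ n s t * g₀‖ ≤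
        A + B * ((√(n : ℝ))⁻¹ * Real.exp (-(c / 2) * n * t ^ 2))) →
      ‖(∫ t in (-Real.pi)..Real.pi, Complex.exp (-(k * t) * Complex.I) * g t) -
        (2 * Real.pi * gaussianDensity β γ₁ γ₂ n k s : ℝ) * g₀‖ ≤
        2 * Real.pi * A + K * (B + ‖g₀‖) * (n : ℝ)⁻¹ := by
  obtain ⟨K₃, hK₃, hW⟩ := exists_add_cube_mul_exp_le hc
  have hpi := Real.pi_pos
  refine ⟨√(2 * Real.pi / c) * (1 + K₃), by positivity,
    fun n k s A B g₀ g hn hs hsn hA hB hg hbound => ?_⟩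
  have hn0 : (0 : ℝ) < n := by exact_mod_cast hn
  have hσ := variance_pos (by linarith : 0 < γ₁) (by linarith : 0 < γ₂) hn hs hsn
  set r := (√(n : ℝ))⁻¹ with hr
  have hr0 : 0 < r := by positivity
  have hr2 : r * r = (n : ℝ)⁻¹ := by
    rw [hr, ← mul_inv, Real.mul_self_sqrt hn0.le]
  set G : ℝ → ℝ := fun t => Real.exp (-(c / 2) * n * t ^ 2) with hG
  have hGint : Integrable G := by
    have h1 : ∀ t : ℝ, G t = Real.exp (-(c / 2 * n) * t ^ 2) := fun t => by
      simp only [hG]; congr 1; ring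
    simp only [funext h1]
    exact integrable_exp_neg_mul_sq (by positivity)
  have hG0 : ∀ t, 0 ≤ G t := fun t => (Real.exp_pos _).le
  have hGval : ∫ t, G t = √(2 * Real.pi / c) * r := integral_exp_neg_mul_nat n
  set e : ℝ → ℂ := fun t => Complex.exp (-(k * t) * Complex.I) with he
  have he1 : ∀ t, ‖e t‖ = 1 := fun t => by
    have : (-(k * t) * Complex.I : ℂ) = ((-(k * t) : ℝ) : ℂ) * Complex.I := by push_cast; ring
    simp only [he]
    rw [this, Complex.norm_exp_ofReal_mul_I]
  have hec : Continuous e := by fun_prop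
  set f : ℝ → ℂ := fun t => e t * gaussianTerm β γ₁ γ₂ n s t * g₀ with hf
  have hfint : Integrable f := (integrable_exp_mul_gaussianTerm k hσ).mul_const g₀
  have hfval : ∫ t, f t = (2 * Real.pi * gaussianDensity β γ₁ γ₂ n k s : ℝ) * g₀ := by
    simp only [hf]
    rw [integral_mul_const, integral_exp_mul_gaussianTerm k hσ]
  set S := Set.Ioc (-Real.pi) Real.pi with hS
  have hSmeas : MeasurableSet S := measurableSet_Ioc
  have hmem : ∀ t ∈ S, |t| ≤ Real.pi := fun t ht => abs_le.2 ⟨ht.1.le, ht.2⟩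
  have hmem' : ∀ t ∈ Sᶜ, Real.pi ≤ |t| := fun t ht => by
    by_contra! h
    exact ht ⟨(abs_lt.1 h).1, (abs_lt.1 h).2.le⟩
  have hegint : IntegrableOn (fun t => e t * g t) S :=
    (intervalIntegrable_iff_integrableOn_Ioc_of_le (by linarith)).1
      ((hec.mul hg).intervalIntegrable _ _)
  rw [intervalIntegral.integral_of_le (by linarith), ← hfval,
    ← integral_add_compl hSmeas hfint, ← sub_sub, ← integral_sub hegint hfint.integrableOn]
  have hconst : Integrable (fun _ : ℝ => A) (volume.restrict S) :=
    integrableOn_const (by simp [hS]) (by simp)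
  have hb1 : ‖∫ t in S, (e t * g t - f t)‖ ≤ ∫ t in S, (A + B * (r * G t)) := by
    refine norm_integral_le_of_norm_le ?_ ?_
    · exact hconst.add ((hGint.const_mul r).const_mul B).integrableOn
    · refine ae_restrict_of_forall_mem hSmeas fun t ht => ?_
      have h3 : e t * g t - f t = e t * (g t - gaussianTerm β γ₁ γ₂ n s t * g₀) := by
        simp only [hf]; ring
      rw [h3, norm_mul, he1, one_mul]
      exact hbound t (hmem t ht)
  -- Integrating the Gaussian produces a second factor `n^{-1/2}`, whence the rate `1/n`.
  have hb1' : ∫ t in S, (A + B * (r * G t)) ≤ 2 * Real.pi * A + B * (r * ∫ t, G t) := by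
    rw [integral_add hconst ((hGint.const_mul r).const_mul B).integrableOn, setIntegral_const,
      integral_const_mul, integral_const_mul]
    have h4 : ∫ t in S, G t ≤ ∫ t, G t :=
      setIntegral_le_integral hGint (Eventually.of_forall hG0)
    have h5 : volume.real S • A = 2 * Real.pi * A := by
      rw [hS, Real.volume_real_Ioc_of_le (by linarith), smul_eq_mul]; ring
    rw [h5]
    gcongr
  have hb2 : ‖∫ t in Sᶜ, f t‖ ≤ ∫ t in Sᶜ, ‖g₀‖ * (K₃ * r * G t) := by
    refine norm_integral_le_of_norm_le ((hGint.const_mul _).const_mul _).integrableOn ?_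
    refine ae_restrict_of_forall_mem hSmeas.compl fun t ht => ?_
    simp only [hf]
    rw [norm_mul, norm_mul, he1, one_mul, mul_comm]
    refine mul_le_mul_of_nonneg_left ?_ (norm_nonneg _)
    refine (norm_gaussianTerm_le h₁ h₂ hs hsn t).trans ?_
    refine le_trans ?_ (hW n t hn)
    -- On the tail `|t| ≥ π > 1`, so inserting the factor `|t| + n|t|³` is harmless and gives access
    -- to the `n^{-1/2}` gain of `hW`.
    refine le_mul_of_one_le_left (Real.exp_pos _).le ?_
    have h6 : 1 ≤ |t| := le_trans (by linarith [Real.pi_gt_three]) (hmem' t ht)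
    exact h6.trans (le_add_of_nonneg_right (by positivity))
  have hb2' : ∫ t in Sᶜ, ‖g₀‖ * (K₃ * r * G t) ≤ ‖g₀‖ * (K₃ * r * ∫ t, G t) := by
    rw [integral_const_mul, integral_const_mul]
    have h4 : ∫ t in Sᶜ, G t ≤ ∫ t, G t :=
      setIntegral_le_integral hGint (Eventually.of_forall hG0)
    gcongr
  refine (norm_sub_le _ _).trans ((add_le_add (hb1.trans hb1') (hb2.trans hb2')).trans ?_)
  rw [hGval, ← hr2]
  have h7 : 0 ≤ √(2 * Real.pi / c) * (r * r) * (K₃ * B + ‖g₀‖) := by positivity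
  linarith

lemma continuousOn_gaussianDensity {β γ₁ γ₂ : ℝ} (h₁ : 0 < γ₁) (h₂ : 0 < γ₂) {n : ℕ} (hn : 1 ≤ n)
    (k : ℕ) : ContinuousOn (gaussianDensity β γ₁ γ₂ n k) (Set.Icc 0 n) := by
  have hσ : ∀ s ∈ Set.Icc (0 : ℝ) n, γ₁ * s + γ₂ * (n - s) ≠ 0 := fun s hs =>
    (variance_pos h₁ h₂ hn hs.1 hs.2).ne'
  have hσ' : ∀ s ∈ Set.Icc (0 : ℝ) n, √(2 * Real.pi * (γ₁ * s + γ₂ * (n - s))) ≠ 0 := fun s hs => by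
    have := variance_pos h₁ h₂ hn hs.1 hs.2
    have := Real.pi_pos
    positivity
  unfold gaussianDensity
  refine ContinuousOn.div (Real.continuous_exp.comp_continuousOn (ContinuousOn.div (by fun_prop)
    (by fun_prop) fun s hs => ?_)) (by fun_prop) hσ'
  exact mul_ne_zero two_ne_zero (hσ s hs)

/-- Sum over the position of the transition of the Fourier coefficients. -/
lemma exists_norm_sum_fourierCoeff_sub_le {β γ₁ γ₂ c ρ K : ℝ} (hc : 0 < c) (h₁ : c ≤ γ₁ / 2)
    (h₂ : c ≤ γ₂ / 2) (hρ : 0 < ρ) (hρ1 : ρ < 1) (hK : 0 < K) {g : ℕ → ℕ → ℝ → ℂ} {g₀ : ℂ}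
    (hg : ∀ i j, Continuous (g i j))
    (hbound : ∀ t : ℝ, |t| ≤ Real.pi → ∀ (i j : ℕ) (s : ℝ), i ≤ s → s ≤ i + 1 →
      ‖g i j t - gaussianTerm β γ₁ γ₂ (i + j + 1) s t * g₀‖ ≤
        K * (ρ ^ i + ρ ^ j) + K * ((√(i + j + 1 : ℕ))⁻¹ *
          Real.exp (-(c / 2) * (i + j + 1 : ℕ) * t ^ 2))) :
    ∃ K', 0 < K' ∧ ∀ n k : ℕ, 1 ≤ n →
      ‖∑ i ∈ Finset.range n, (∫ t in (-Real.pi)..Real.pi,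
          Complex.exp (-(k * t) * Complex.I) * g i (n - 1 - i) t) -
        (2 * Real.pi * ∫ s in (0 : ℝ)..n, gaussianDensity β γ₁ γ₂ n k s : ℝ) * g₀‖ ≤ K' := by
  obtain ⟨K₁, hK₁, hcoeff⟩ := exists_norm_fourierCoeff_sub_le (β := β) hc h₁ h₂
  have hpi := Real.pi_pos
  have h1ρ : 0 < 1 - ρ := by linarith
  -- The first summand bounds the geometric series in `ρ^i` and `ρ^(n-1-i)`, the second collects `n`
  -- errors of size `1/n`.
  refine ⟨2 * Real.pi * (K * (2 / (1 - ρ))) + K₁ * (K + ‖g₀‖), by positivity,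
    fun n k hn => ?_⟩
  have hn0 : (0 : ℝ) < n := by exact_mod_cast hn
  have hcont := continuousOn_gaussianDensity (β := β) (by linarith : 0 < γ₁) (by linarith : 0 < γ₂)
    hn k
  have hii : ∀ i < n, IntervalIntegrable (gaussianDensity β γ₁ γ₂ n k) volume (i : ℕ)
      ((i + 1 : ℕ) : ℝ) := by
    intro i hi
    refine ContinuousOn.intervalIntegrable (hcont.mono ?_)
    rw [Set.uIcc_of_le (by push_cast; linarith)]
    refine Set.Icc_subset_Icc (Nat.cast_nonneg i) ?_
    exact_mod_cast hi
  have hterm : ∀ i ∈ Finset.range n, ‖(∫ t in (-Real.pi)..Real.pi,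
      Complex.exp (-(k * t) * Complex.I) * g i (n - 1 - i) t) -
      (2 * Real.pi * ∫ s in (i : ℝ)..((i + 1 : ℕ) : ℝ), gaussianDensity β γ₁ γ₂ n k s : ℝ) * g₀‖ ≤
      2 * Real.pi * (K * (ρ ^ i + ρ ^ (n - 1 - i))) + K₁ * (K + ‖g₀‖) * (n : ℝ)⁻¹ := by
    intro i hi
    have hi' := Finset.mem_range.1 hi
    have hij : i + (n - 1 - i) + 1 = n := by omega
    have hin : (i : ℝ) + 1 ≤ n := by exact_mod_cast hi'
    set a := ∫ t in (-Real.pi)..Real.pi, Complex.exp (-(k * t) * Complex.I) * g i (n - 1 - i) t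
      with ha
    have hpt : ∀ s ∈ Set.uIoc (i : ℝ) ((i + 1 : ℕ) : ℝ),
        ‖a - (2 * Real.pi * gaussianDensity β γ₁ γ₂ n k s : ℝ) * g₀‖ ≤
        2 * Real.pi * (K * (ρ ^ i + ρ ^ (n - 1 - i))) + K₁ * (K + ‖g₀‖) * (n : ℝ)⁻¹ := by
      intro s hs
      rw [Set.uIoc_of_le (by push_cast; linarith)] at hs
      have hs2 : s ≤ i + 1 := by have := hs.2; push_cast at this; exact this
      refine hcoeff n k s _ K g₀ (g i (n - 1 - i)) hn ((Nat.cast_nonneg i).trans hs.1.le)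
        (hs2.trans hin) (by positivity) hK.le (hg _ _) fun t ht => ?_
      have := hbound t ht i (n - 1 - i) s hs.1.le hs2
      rwa [hij] at this
    -- The estimate holds for every `s` in a unit interval, so it may be averaged over `s`: the
    -- coefficient is compared with the exact integral, without any Riemann sum error.
    have hint : a - (2 * Real.pi * ∫ s in (i : ℝ)..((i + 1 : ℕ) : ℝ),
        gaussianDensity β γ₁ γ₂ n k s : ℝ) * g₀ = ∫ s in (i : ℝ)..((i + 1 : ℕ) : ℝ),
        (a - (2 * Real.pi * gaussianDensity β γ₁ γ₂ n k s : ℝ) * g₀) := by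
      have h3 : IntervalIntegrable (fun s => ((2 * Real.pi * gaussianDensity β γ₁ γ₂ n k s : ℝ) : ℂ)
          * g₀) volume (i : ℕ) ((i + 1 : ℕ) : ℝ) := by
        refine IntervalIntegrable.mul_const ?_ g₀
        have := (hii i hi').const_mul (2 * Real.pi)
        exact ⟨this.1.ofReal, this.2.ofReal⟩
      rw [intervalIntegral.integral_sub intervalIntegrable_const h3,
        intervalIntegral.integral_const, intervalIntegral.integral_mul_const,
        intervalIntegral.integral_ofReal, intervalIntegral.integral_const_mul]
      push_cast
      simp
    rw [hint]
    have h4 := intervalIntegral.norm_integral_le_of_norm_le_const hpt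
    have h5 : |((i + 1 : ℕ) : ℝ) - i| = 1 := by push_cast; simp
    rwa [h5, mul_one] at h4
  have hsum : (∫ s in (0 : ℝ)..n, gaussianDensity β γ₁ γ₂ n k s) = ∑ i ∈ Finset.range n,
      ∫ s in (i : ℝ)..((i + 1 : ℕ) : ℝ), gaussianDensity β γ₁ γ₂ n k s := by
    rw [intervalIntegral.sum_integral_adjacent_intervals (a := fun i : ℕ => (i : ℝ))
      (fun i hi => hii i hi)]
    simp
  have hgeom : ∀ m, ∑ i ∈ Finset.range m, ρ ^ i ≤ 1 / (1 - ρ) := fun m => by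
    rw [geom_sum_eq hρ1.ne, ← neg_div_neg_eq, neg_sub, neg_sub]
    gcongr
    linarith [pow_pos hρ m]
  have hgeom' : ∑ i ∈ Finset.range n, ρ ^ (n - 1 - i) ≤ 1 / (1 - ρ) := by
    rw [Finset.sum_range_reflect (fun i => ρ ^ i) n]
    exact hgeom n
  rw [hsum, Finset.mul_sum, Complex.ofReal_sum, Finset.sum_mul, ← Finset.sum_sub_distrib]
  refine (norm_sum_le _ _).trans ((Finset.sum_le_sum hterm).trans ?_)
  rw [Finset.sum_add_distrib, ← Finset.mul_sum, ← Finset.mul_sum, Finset.sum_add_distrib,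
    Finset.sum_const, Finset.card_range, nsmul_eq_mul]
  have h6 : (n : ℝ) * (K₁ * (K + ‖g₀‖) * (n : ℝ)⁻¹) = K₁ * (K + ‖g₀‖) := by
    field_simp
  have h7 : ∑ i ∈ Finset.range n, ρ ^ i + ∑ i ∈ Finset.range n, ρ ^ (n - 1 - i) ≤
      2 / (1 - ρ) := by
    have := add_le_add (hgeom n) hgeom'
    rwa [← add_div, one_add_one_eq_two] at this
  rw [h6]
  gcongr

end SymbolStatistics

/-! ### Fourier inversion, the rescaled mixture and block powers. -/

namespace SymbolStatistics

open Matrix Filter Topology MeasureTheory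
open scoped Matrix.Norms.Operator

lemma integral_exp_int_mul_I (m : ℤ) :
    ∫ t in (-Real.pi)..Real.pi, Complex.exp ((m : ℂ) * Complex.I * t) =
      if m = 0 then (2 * Real.pi : ℂ) else 0 := by
  split_ifs with h
  · subst h
    simp
    ring
  · have hc : (m : ℂ) * Complex.I ≠ 0 := mul_ne_zero (by exact_mod_cast h) Complex.I_ne_zero
    rw [integral_exp_mul_complex hc, div_eq_zero_iff]
    left
    rw [sub_eq_zero, Complex.exp_eq_exp_iff_exists_int]
    exact ⟨m, by push_cast; ring⟩

/-- `mixtureDensity` is the rescaled average of the Gaussian densities. -/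
lemma integral_gaussianDensity {β γ₁ γ₂ : ℝ} (h₁ : 0 < γ₁) (h₂ : 0 < γ₂) (hne : γ₁ ≠ γ₂) {n : ℕ}
    (hn : 1 ≤ n) (k : ℕ) :
    √((γ₁ + γ₂) / 2 * n) * ∫ s in (0 : ℝ)..n, gaussianDensity β γ₁ γ₂ n k s =
      n * mixtureDensity γ₁ γ₂ ((k - β * n) / √((γ₁ + γ₂) / 2 * n)) := by
  set γ := (γ₁ + γ₂) / 2 with hγ
  have hγ0 : 0 < γ := by positivity
  have hn0 : (0 : ℝ) < n := by exact_mod_cast hn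
  set r := √(γ * n) with hr
  have hr0 : 0 < r := Real.sqrt_pos.2 (by positivity)
  have hr2 : r ^ 2 = γ * n := Real.sq_sqrt (by positivity)
  set x := (k - β * n) / r with hx
  have hsub : γ₁ - γ₂ ≠ 0 := sub_ne_zero.2 hne
  have hsub' : γ₂ - γ₁ ≠ 0 := sub_ne_zero.2 (Ne.symm hne)
  have hscale : ∀ s : ℝ, gaussianDensity β γ₁ γ₂ n k s =
      r⁻¹ * (Real.exp (-x ^ 2 / (2 * (γ₂ / γ + (γ₁ - γ₂) / (γ * n) * s))) /
        √(2 * Real.pi * (γ₂ / γ + (γ₁ - γ₂) / (γ * n) * s))) := by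
    intro s
    have hσ : γ₁ * s + γ₂ * (n - s) = r ^ 2 * (γ₂ / γ + (γ₁ - γ₂) / (γ * n) * s) := by
      rw [hr2]
      field_simp
      ring
    rw [gaussianDensity, hσ]
    set σ := γ₂ / γ + (γ₁ - γ₂) / (γ * n) * s with hσdef
    have h3 : -((k : ℝ) - β * n) ^ 2 / (2 * (r ^ 2 * σ)) = -x ^ 2 / (2 * σ) := by
      rw [hx, div_pow]
      rcases eq_or_ne σ 0 with h | h
      · simp [h]
      · field_simp
    have h4 : √(2 * Real.pi * (r ^ 2 * σ)) = r * √(2 * Real.pi * σ) := by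
      rw [show 2 * Real.pi * (r ^ 2 * σ) = r ^ 2 * (2 * Real.pi * σ) by ring,
        Real.sqrt_mul (by positivity), Real.sqrt_sq hr0.le]
    rw [h3, h4, div_mul_eq_div_div_swap, div_eq_inv_mul]
  -- The substitution `s ↦ γ₂/γ + (γ₁ - γ₂) s / (γ n)` is nondegenerate because `γ₁ ≠ γ₂`; it sends
  -- `0` to `γ₂/γ` and `n` to `γ₁/γ`, hence the reversal of the limits below.
  have hc : (γ₁ - γ₂) / (γ * n) ≠ 0 := by positivity
  simp only [hscale]
  rw [intervalIntegral.integral_const_mul, intervalIntegral.integral_comp_add_mul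
    (fun s => Real.exp (-x ^ 2 / (2 * s)) / √(2 * Real.pi * s)) hc, mixtureDensity, ← hγ, smul_eq_mul]
  have h5 : γ₂ / γ + (γ₁ - γ₂) / (γ * n) * 0 = γ₂ / γ := by simp
  have h6 : γ₂ / γ + (γ₁ - γ₂) / (γ * n) * n = γ₁ / γ := by field_simp; ring
  rw [h5, h6, intervalIntegral.integral_symm]
  have h7 : ((γ₁ - γ₂) / (γ * n))⁻¹ = -(n * (γ / (γ₂ - γ₁))) := by
    rw [inv_div, ← neg_sub γ₂ γ₁, div_neg]
    ring
  rw [h7]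
  generalize (∫ s in (γ₁ / γ)..(γ₂ / γ), Real.exp (-x ^ 2 / (2 * s)) /
    √(2 * Real.pi * s)) = J
  field_simp

lemma exists_abs_mixtureDensity_le {γ₁ γ₂ : ℝ} (h₁ : 0 < γ₁) (h₂ : 0 < γ₂) :
    ∃ K, 0 < K ∧ ∀ x, |mixtureDensity γ₁ γ₂ x| ≤ K := by
  set γ := (γ₁ + γ₂) / 2 with hγ
  have hγ0 : 0 < γ := by positivity
  set m := min (γ₁ / γ) (γ₂ / γ) with hm
  have hm0 : 0 < m := lt_min (by positivity) (by positivity)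
  have hpi := Real.pi_pos
  refine ⟨|γ / (γ₂ - γ₁)| * ((√(2 * Real.pi * m))⁻¹ * |γ₂ / γ - γ₁ / γ|) + 1, by positivity,
    fun x => ?_⟩
  rw [mixtureDensity, ← hγ, abs_mul]
  refine le_trans ?_ (le_add_of_nonneg_right zero_le_one)
  refine mul_le_mul_of_nonneg_left ?_ (abs_nonneg _)
  rw [← Real.norm_eq_abs]
  refine intervalIntegral.norm_integral_le_of_norm_le_const fun s hs => ?_
  have hsm : m < s := hs.1
  have hs0 : 0 < s := hm0.trans hsm
  rw [Real.norm_eq_abs, abs_of_nonneg (by positivity), div_eq_mul_inv]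
  have h3 : Real.exp (-x ^ 2 / (2 * s)) ≤ 1 := by
    rw [Real.exp_le_one_iff, neg_div]
    have : 0 ≤ x ^ 2 / (2 * s) := by positivity
    linarith
  calc _ ≤ 1 * (√(2 * Real.pi * s))⁻¹ := by gcongr
    _ ≤ _ := by rw [one_mul]; gcongr

/-- Powers of a block triangular matrix. -/
lemma fromBlocks_zero_pow {m n : Type*} [Fintype m] [DecidableEq m] [Fintype n] [DecidableEq n]
    (A : Matrix m m ℂ) (B : Matrix m n ℂ) (D : Matrix n n ℂ) (k : ℕ) :
    fromBlocks A B 0 D ^ k =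
      fromBlocks (A ^ k) (∑ i ∈ Finset.range k, A ^ i * B * D ^ (k - 1 - i)) 0 (D ^ k) := by
  induction k with
  | zero => simp
  | succ k ih =>
    rw [pow_succ, ih, fromBlocks_multiply, Finset.sum_range_succ]
    simp only [Matrix.mul_zero, Matrix.zero_mul, add_zero, zero_add, ← pow_succ]
    congr 1
    rw [add_comm, Nat.add_sub_cancel, Nat.sub_self, pow_zero, Matrix.mul_one, Matrix.sum_mul]
    congr 1
    refine Finset.sum_congr rfl fun i hi => ?_
    have hi' := Finset.mem_range.1 hi
    rw [Matrix.mul_assoc, ← pow_succ]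
    congr 2
    omega

namespace LinearRepresentation

section

variable {ι : Type*} [Fintype ι] [DecidableEq ι] (R : LinearRepresentation ι)

lemma dotProduct_charMatrix_pow (z : ℂ) (n : ℕ) :
    (Complex.ofReal ∘ R.xi) ⬝ᵥ (R.charMatrix z ^ n *ᵥ (Complex.ofReal ∘ R.eta)) =
      ∑ w : Fin n → Letter, z ^ ((List.ofFn w).count Letter.a) *
        (R.series (List.ofFn w) : ℂ) := by
  rw [← sum_words_eq_pow, Matrix.sum_mulVec, dotProduct_sum]
  refine Finset.sum_congr rfl fun w _ => ?_
  rw [Matrix.smul_mulVec, dotProduct_smul, smul_eq_mul, series]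
  congr 1
  simp [mulVec, dotProduct]

/-- Orthogonality of the exponentials on `[-π, π]` selects the words with exactly `k` letters `a`.
-/
lemma integral_charMatrix_pow (n k : ℕ) :
    ∫ t in (-Real.pi)..Real.pi, Complex.exp (-(k * t) * Complex.I) *
      ((Complex.ofReal ∘ R.xi) ⬝ᵥ (R.charMatrix (Complex.exp (t * Complex.I)) ^ n *ᵥ
        (Complex.ofReal ∘ R.eta))) =
      (2 * Real.pi * ∑ w : Fin n → Letter with (List.ofFn w).count Letter.a = k,
        R.series (List.ofFn w) : ℝ) := by
  have h1 : ∀ t : ℝ, Complex.exp (-(k * t) * Complex.I) *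
      ((Complex.ofReal ∘ R.xi) ⬝ᵥ (R.charMatrix (Complex.exp (t * Complex.I)) ^ n *ᵥ
        (Complex.ofReal ∘ R.eta))) = ∑ w : Fin n → Letter,
      Complex.exp ((((List.ofFn w).count Letter.a - k : ℤ) : ℂ) * Complex.I * t) *
        (R.series (List.ofFn w) : ℂ) := by
    intro t
    rw [dotProduct_charMatrix_pow, Finset.mul_sum]
    refine Finset.sum_congr rfl fun w _ => ?_
    rw [← mul_assoc, ← Complex.exp_nat_mul, ← Complex.exp_add]
    congr 2
    push_cast
    ring
  simp only [h1]
  rw [intervalIntegral.integral_finsetSum fun w _ => by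
    apply Continuous.intervalIntegrable; fun_prop]
  simp only [intervalIntegral.integral_mul_const, integral_exp_int_mul_I]
  rw [Finset.sum_filter, Complex.ofReal_mul, Complex.ofReal_sum, Finset.mul_sum]
  refine Finset.sum_congr rfl fun w _ => ?_
  have h2 : ((List.ofFn w).count Letter.a - k : ℤ) = 0 ↔ (List.ofFn w).count Letter.a = k := by
    omega
  simp only [h2]
  split_ifs <;> simp

end

section Bicomponent

variable {ι₁ ι₂ : Type*} [Fintype ι₁] [DecidableEq ι₁] [Fintype ι₂] [DecidableEq ι₂]
  (R₁ : LinearRepresentation ι₁) (R₂ : LinearRepresentation ι₂)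
  (A₀ B₀ : Matrix ι₁ ι₂ ℝ) (hA₀ : ∀ i j, 0 ≤ A₀ i j) (hB₀ : ∀ i j, 0 ≤ B₀ i j)

/-- The connecting block `e^{it} A₀ + B₀`. -/
noncomputable def connectingMatrix (A₀ B₀ : Matrix ι₁ ι₂ ℝ) (t : ℝ) : Matrix ι₁ ι₂ ℂ :=
  Complex.exp (t * Complex.I) • A₀.map Complex.ofReal + B₀.map Complex.ofReal

omit [Fintype ι₁] [DecidableEq ι₁] [Fintype ι₂] [DecidableEq ι₂] in
lemma connectingMatrix_zero :
    connectingMatrix A₀ B₀ 0 = (A₀ + B₀).map Complex.ofReal := by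
  ext i j
  simp [connectingMatrix]

omit [DecidableEq ι₁] [DecidableEq ι₂] in
lemma norm_connectingMatrix_le (t : ℝ) :
    ‖connectingMatrix A₀ B₀ t‖ ≤ ‖A₀.map Complex.ofReal‖ + ‖B₀.map Complex.ofReal‖ := by
  refine (norm_add_le _ _).trans (le_of_eq ?_)
  rw [norm_smul, Complex.norm_exp_ofReal_mul_I, one_mul]

omit [DecidableEq ι₁] [DecidableEq ι₂] in
lemma norm_connectingMatrix_sub_le (t : ℝ) :
    ‖connectingMatrix A₀ B₀ t - connectingMatrix A₀ B₀ 0‖ ≤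
      (‖A₀.map Complex.ofReal‖ + ‖B₀.map Complex.ofReal‖) * |t| := by
  have h1 : connectingMatrix A₀ B₀ t - connectingMatrix A₀ B₀ 0 =
      (Complex.exp (Complex.I * t) - 1) • A₀.map Complex.ofReal := by
    simp only [connectingMatrix, Complex.ofReal_zero, zero_mul, Complex.exp_zero, one_smul,
      sub_smul, mul_comm Complex.I]
    abel
  rw [h1, norm_smul, mul_comm]
  have h2 : ‖Complex.exp (Complex.I * t) - 1‖ ≤ |t| := Real.norm_exp_I_mul_ofReal_sub_one_le
  have h3 := norm_nonneg (B₀.map Complex.ofReal)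
  gcongr
  linarith

omit [Fintype ι₁] [DecidableEq ι₁] [Fintype ι₂] [DecidableEq ι₂] in
lemma charMatrix_bicomponent (t : ℝ) :
    (R₁.bicomponent R₂ A₀ B₀ hA₀ hB₀).charMatrix (Complex.exp (t * Complex.I)) =
      fromBlocks (R₁.charMatrix (Complex.exp (t * Complex.I))) (connectingMatrix A₀ B₀ t) 0
        (R₂.charMatrix (Complex.exp (t * Complex.I))) := by
  ext (i | i) (j | j) <;> simp [charMatrix, bicomponent, connectingMatrix]

/-- The generating function of the bicomponent model in terms of its components. -/
lemma dotProduct_bicomponent_pow (t : ℝ) (n : ℕ) :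
    (Complex.ofReal ∘ (R₁.bicomponent R₂ A₀ B₀ hA₀ hB₀).xi) ⬝ᵥ
      ((R₁.bicomponent R₂ A₀ B₀ hA₀ hB₀).charMatrix (Complex.exp (t * Complex.I)) ^ n *ᵥ
        (Complex.ofReal ∘ (R₁.bicomponent R₂ A₀ B₀ hA₀ hB₀).eta)) =
    (Complex.ofReal ∘ R₁.xi) ⬝ᵥ (R₁.charMatrix (Complex.exp (t * Complex.I)) ^ n *ᵥ
        (Complex.ofReal ∘ R₁.eta)) +
    ∑ i ∈ Finset.range n, (Complex.ofReal ∘ R₁.xi) ⬝ᵥ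
      ((R₁.charMatrix (Complex.exp (t * Complex.I)) ^ i * connectingMatrix A₀ B₀ t *
        R₂.charMatrix (Complex.exp (t * Complex.I)) ^ (n - 1 - i)) *ᵥ (Complex.ofReal ∘ R₂.eta)) +
    (Complex.ofReal ∘ R₂.xi) ⬝ᵥ (R₂.charMatrix (Complex.exp (t * Complex.I)) ^ n *ᵥ
        (Complex.ofReal ∘ R₂.eta)) := by
  have h1 : Complex.ofReal ∘ (R₁.bicomponent R₂ A₀ B₀ hA₀ hB₀).xi =
      Sum.elim (Complex.ofReal ∘ R₁.xi) (Complex.ofReal ∘ R₂.xi) := by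
    ext (i | i) <;> rfl
  have h2 : Complex.ofReal ∘ (R₁.bicomponent R₂ A₀ B₀ hA₀ hB₀).eta =
      Sum.elim (Complex.ofReal ∘ R₁.eta) (Complex.ofReal ∘ R₂.eta) := by
    ext (i | i) <;> rfl
  rw [charMatrix_bicomponent, fromBlocks_zero_pow, h1, h2, fromBlocks_mulVec,
    sumElim_dotProduct_sumElim]
  simp only [Sum.elim_comp_inl, Sum.elim_comp_inr, Matrix.zero_mulVec, zero_add, dotProduct_add,
    Matrix.sum_mulVec, dotProduct_sum]

end Bicomponent

end LinearRepresentation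

lemma dotProduct_mulVec_pos {ι₁ ι₂ : Type*} [Fintype ι₁] [Fintype ι₂]
    {X : Matrix ι₁ ι₂ ℝ} (hX : ∀ i j, 0 < X i j) {a : ι₁ → ℝ} {b : ι₂ → ℝ} (ha : ∀ i, 0 ≤ a i)
    (ha0 : a ≠ 0) (hb : ∀ i, 0 ≤ b i) (hb0 : b ≠ 0) : 0 < a ⬝ᵥ (X *ᵥ b) := by
  obtain ⟨i, hi⟩ := Function.ne_iff.1 ha0
  have h1 := mulVec_pos_of_pos hX hb hb0
  exact Finset.sum_pos' (fun k _ => mul_nonneg (ha k) (h1 k).le)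
    ⟨i, Finset.mem_univ _, mul_pos (lt_of_le_of_ne (ha i) (Ne.symm hi)) (h1 i)⟩

/-- One positive entry of the connecting matrix suffices; this makes the limit constant `g`
positive. -/
lemma mul_mul_apply_pos {ι₁ ι₂ : Type*} [Fintype ι₁] [Fintype ι₂] {Q₁ : Matrix ι₁ ι₁ ℝ}
    {Q₂ : Matrix ι₂ ι₂ ℝ} {S : Matrix ι₁ ι₂ ℝ} (hQ₁ : ∀ i j, 0 < Q₁ i j) (hQ₂ : ∀ i j, 0 < Q₂ i j)
    (hS : ∀ i j, 0 ≤ S i j) (hS0 : S ≠ 0) (i : ι₁) (j : ι₂) : 0 < (Q₁ * S * Q₂) i j := by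
  obtain ⟨k, hk⟩ := Function.ne_iff.1 hS0
  obtain ⟨l, hl⟩ := Function.ne_iff.1 hk
  have h1 : ∀ l, 0 ≤ (Q₁ * S) i l := fun l =>
    Finset.sum_nonneg fun k _ => mul_nonneg (hQ₁ i k).le (hS k l)
  have h2 : 0 < (Q₁ * S) i l :=
    Finset.sum_pos' (fun k _ => mul_nonneg (hQ₁ i k).le (hS k l))
      ⟨k, Finset.mem_univ _, mul_pos (hQ₁ i k) (lt_of_le_of_ne (hS k l) (Ne.symm hl))⟩
  exact Finset.sum_pos' (fun l _ => mul_nonneg (h1 l) (hQ₂ l j).le)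
    ⟨l, Finset.mem_univ _, mul_pos h2 (hQ₂ l j)⟩

end SymbolStatistics

/-! ### From weights to probabilities; transition and pure terms. -/

namespace SymbolStatistics

open Matrix Filter Topology MeasureTheory
open scoped Matrix.Norms.Operator

lemma norm_dotProduct_mulVec_le {ι₁ ι₂ : Type*} [Fintype ι₁] [Fintype ι₂] (X : Matrix ι₁ ι₂ ℂ)
    (a : ι₁ → ℂ) (b : ι₂ → ℂ) : ‖a ⬝ᵥ (X *ᵥ b)‖ ≤ (∑ i, ‖a i‖) * ‖b‖ * ‖X‖ := by
  rw [dotProduct, mul_assoc, Finset.sum_mul]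
  refine (norm_sum_le _ _).trans (Finset.sum_le_sum fun i _ => ?_)
  rw [norm_mul, mul_comm ‖b‖]
  gcongr
  exact (norm_le_pi_norm (X *ᵥ b) i).trans (Matrix.linfty_opNorm_mulVec X b)

/-- From estimates of the coefficients and of the total mass to the local limit estimate. -/
lemma exists_abs_sqrt_mul_div_sub_le {γ g K₁ K₂ F : ℝ} (hγ : 0 < γ) (hg : 0 < g) (hK₁ : 0 ≤ K₁)
    (hK₂ : 0 ≤ K₂) (hF : 0 ≤ F) : ∃ (C : ℝ) (N : ℕ), 1 ≤ N ∧ ∀ n : ℕ, N ≤ n → ∀ x z Φ f : ℝ,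
      |x - Φ * g| ≤ K₁ → |z - n * g| ≤ K₂ * √(n : ℝ) → √(γ * n) * Φ = n * f → |f| ≤ F →
      |√(γ * n) * (x / z) - f| ≤ C * (n : ℝ) ^ (-(1 / 2) : ℝ) := by
  -- For `n` beyond this threshold, `K₂ √n ≤ n g / 2`, so the denominator `z` is at least `n g / 2`.
  obtain ⟨N, hN⟩ := exists_nat_gt ((2 * K₂ / g) ^ 2)
  refine ⟨2 * (√γ * K₁ + F * K₂) / g, N + 1, by omega, fun n hn x z Φ f hx hz hΦ hf => ?_⟩
  have hn1 : 1 ≤ n := by omega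
  have hn0 : (0 : ℝ) < n := by exact_mod_cast hn1
  set r := √(n : ℝ) with hr
  have hr0 : 0 < r := Real.sqrt_pos.2 hn0
  have hr2 : r * r = n := Real.mul_self_sqrt hn0.le
  have hpow : (n : ℝ) ^ (-(1 / 2) : ℝ) = r⁻¹ := by
    rw [Real.rpow_neg hn0.le, ← Real.sqrt_eq_rpow]
  have hγr : √(γ * n) = √γ * r := Real.sqrt_mul hγ.le _
  have hrK : 2 * K₂ / g < r := by
    refine lt_of_pow_lt_pow_left₀ 2 hr0.le ?_
    rw [sq r, hr2]
    refine hN.trans ?_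
    exact_mod_cast hn
  have hzlow : n * g / 2 ≤ z := by
    have h1 := (abs_le.1 hz).1
    rw [div_lt_iff₀ hg] at hrK
    have h2 : K₂ * r ≤ n * g / 2 := by
      rw [← hr2]
      nlinarith
    linarith
  have hz0 : 0 < z := lt_of_lt_of_le (by positivity) hzlow
  have hnum : |√(γ * n) * x - f * z| ≤ (√γ * K₁ + F * K₂) * r := by
    -- The main terms `√(γn) Φ g` and `f n g` cancel by the relation between `Φ` and `f`.
    have h1 : √(γ * n) * x - f * z = √(γ * n) * (x - Φ * g) - f * (z - n * g) := by
      linear_combination g * hΦ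
    rw [h1]
    refine (abs_sub _ _).trans ?_
    rw [abs_mul, abs_mul, abs_of_nonneg (Real.sqrt_nonneg _), hγr]
    have h2 : √γ * r * |x - Φ * g| ≤ √γ * r * K₁ := by gcongr
    have h3 : |f| * |z - n * g| ≤ F * (K₂ * r) := by gcongr
    linarith
  have h4 : √(γ * n) * (x / z) - f = (√(γ * n) * x - f * z) / z := by
    field_simp
  rw [h4, abs_div, abs_of_pos hz0, div_le_iff₀ hz0, hpow]
  refine hnum.trans ?_
  have h5 : 0 ≤ √γ * K₁ + F * K₂ := by positivity
  calc (√γ * K₁ + F * K₂) * r = 2 * (√γ * K₁ + F * K₂) / g * r⁻¹ * (n * g / 2) := by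
        rw [← hr2]; field_simp
    _ ≤ _ := by gcongr

namespace LinearRepresentation

lemma charMatrix_eq_smul_scaledMatrix {ι : Type*} [Fintype ι] [DecidableEq ι]
    (R : LinearRepresentation ι) (hl : 0 < perronEigenvalue R.M) (t : ℝ) :
    R.charMatrix (Complex.exp (t * Complex.I)) =
      (perronEigenvalue R.M : ℂ) • R.scaledMatrix t := by
  have : (perronEigenvalue R.M : ℂ) ≠ 0 := by exact_mod_cast hl.ne'
  rw [scaledMatrix, smul_smul, mul_inv_cancel₀ this, one_smul]

lemma continuous_scaledMatrix {ι : Type*} [Fintype ι] [DecidableEq ι]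
    (R : LinearRepresentation ι) : Continuous R.scaledMatrix := by
  unfold scaledMatrix charMatrix
  fun_prop

lemma continuous_connectingMatrix {ι₁ ι₂ : Type*} [Fintype ι₁] [Fintype ι₂]
    (A₀ B₀ : Matrix ι₁ ι₂ ℝ) : Continuous (connectingMatrix A₀ B₀) := by
  unfold connectingMatrix
  fun_prop

variable {ι₁ ι₂ : Type*} [Fintype ι₁] [DecidableEq ι₁] [Fintype ι₂] [DecidableEq ι₂]
  (R₁ : LinearRepresentation ι₁) (R₂ : LinearRepresentation ι₂)
  (A₀ B₀ : Matrix ι₁ ι₂ ℝ) (hA₀ : ∀ i j, 0 ≤ A₀ i j) (hB₀ : ∀ i j, 0 ≤ B₀ i j)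

/-- The contribution of the words that leave the first component after `i` letters and stay for
`j` letters in the second one. -/
noncomputable def transitionTerm (i j : ℕ) (t : ℝ) : ℂ :=
  (Complex.ofReal ∘ R₁.xi) ⬝ᵥ ((R₁.scaledMatrix t ^ i * connectingMatrix A₀ B₀ t *
    R₂.scaledMatrix t ^ j) *ᵥ (Complex.ofReal ∘ R₂.eta))

/-- The contribution of the words that stay in one component. -/
noncomputable def pureTerm (n : ℕ) (t : ℝ) : ℂ :=
  (Complex.ofReal ∘ R₁.xi) ⬝ᵥ (R₁.scaledMatrix t ^ n *ᵥ (Complex.ofReal ∘ R₁.eta)) +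
    (Complex.ofReal ∘ R₂.xi) ⬝ᵥ (R₂.scaledMatrix t ^ n *ᵥ (Complex.ofReal ∘ R₂.eta))

lemma continuous_transitionTerm (i j : ℕ) : Continuous (transitionTerm R₁ R₂ A₀ B₀ i j) := by
  have h1 := R₁.continuous_scaledMatrix.pow i
  have h2 := R₂.continuous_scaledMatrix.pow j
  have h3 := continuous_connectingMatrix A₀ B₀
  exact continuous_const.dotProduct (((h1.matrix_mul h3).matrix_mul h2).matrix_mulVec
    continuous_const)

lemma continuous_pureTerm (n : ℕ) : Continuous (pureTerm R₁ R₂ n) :=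
  (continuous_const.dotProduct
    ((R₁.continuous_scaledMatrix.pow n).matrix_mulVec continuous_const)).add
  (continuous_const.dotProduct
    ((R₂.continuous_scaledMatrix.pow n).matrix_mulVec continuous_const))

/-- The two powers in a transition term have total exponent `n - 1`, the remaining letter being the
transition. So `λ ^ (n - 1)` factors out everywhere and the pure terms keep one more `λ`. -/
lemma dotProduct_bicomponent_pow_eq (hl : 0 < perronEigenvalue R₁.M)
    (hl' : perronEigenvalue R₁.M = perronEigenvalue R₂.M) (t : ℝ) {n : ℕ} (hn : 1 ≤ n) :
    (Complex.ofReal ∘ (R₁.bicomponent R₂ A₀ B₀ hA₀ hB₀).xi) ⬝ᵥ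
      ((R₁.bicomponent R₂ A₀ B₀ hA₀ hB₀).charMatrix (Complex.exp (t * Complex.I)) ^ n *ᵥ
        (Complex.ofReal ∘ (R₁.bicomponent R₂ A₀ B₀ hA₀ hB₀).eta)) =
    ((perronEigenvalue R₁.M ^ (n - 1) : ℝ) : ℂ) * (perronEigenvalue R₁.M * pureTerm R₁ R₂ n t +
      ∑ i ∈ Finset.range n, transitionTerm R₁ R₂ A₀ B₀ i (n - 1 - i) t) := by
  rw [dotProduct_bicomponent_pow, R₁.charMatrix_eq_smul_scaledMatrix hl,
    R₂.charMatrix_eq_smul_scaledMatrix (hl' ▸ hl), ← hl']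
  set l := perronEigenvalue R₁.M
  have h1 : ((l ^ (n - 1) : ℝ) : ℂ) * l = (l : ℂ) ^ n := by
    push_cast
    rw [← pow_succ, Nat.sub_add_cancel hn]
  have h2 : ∀ i ∈ Finset.range n, (Complex.ofReal ∘ R₁.xi) ⬝ᵥ
      ((((l : ℂ) • R₁.scaledMatrix t) ^ i * connectingMatrix A₀ B₀ t *
        ((l : ℂ) • R₂.scaledMatrix t) ^ (n - 1 - i)) *ᵥ (Complex.ofReal ∘ R₂.eta)) =
      ((l ^ (n - 1) : ℝ) : ℂ) * transitionTerm R₁ R₂ A₀ B₀ i (n - 1 - i) t := by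
    intro i hi
    have hi' := Finset.mem_range.1 hi
    rw [smul_pow, smul_pow, Matrix.smul_mul, Matrix.smul_mul, Matrix.mul_smul, smul_smul,
      Matrix.smul_mulVec, dotProduct_smul, ← pow_add, smul_eq_mul, transitionTerm]
    congr 1
    push_cast
    congr 1
    omega
  rw [Finset.sum_congr rfl h2, ← Finset.mul_sum, mul_add, ← mul_assoc, h1, pureTerm, smul_pow,
    smul_pow, Matrix.smul_mulVec, Matrix.smul_mulVec, dotProduct_smul, dotProduct_smul,
    smul_eq_mul, smul_eq_mul]
  ring

lemma prob_eq {ι : Type*} [Fintype ι] [DecidableEq ι] (R : LinearRepresentation ι) (n k : ℕ) :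
    R.prob n k = (∑ w : Fin n → Letter with (List.ofFn w).count Letter.a = k,
      R.series (List.ofFn w)) / ∑ w : Fin n → Letter, R.series (List.ofFn w) := by
  rw [prob, Finset.sum_div]
  rfl

end LinearRepresentation

end SymbolStatistics

/-! ### Assembly of the local limit theorem. -/

namespace SymbolStatistics

open Matrix Filter Topology MeasureTheory
open scoped Matrix.Norms.Operator

namespace LinearRepresentation

variable {ι₁ ι₂ : Type*} [Fintype ι₁] [DecidableEq ι₁] [Fintype ι₂] [DecidableEq ι₂]
  (R₁ : LinearRepresentation ι₁) (R₂ : LinearRepresentation ι₂)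
  (A₀ B₀ : Matrix ι₁ ι₂ ℝ) (hA₀ : ∀ i j, 0 ≤ A₀ i j) (hB₀ : ∀ i j, 0 ≤ B₀ i j)

/-- The constant `g` is `ξ₁' v₁ w₁' (A₀ + B₀) v₂ w₂' η₂`, which is positive since the Perron vectors
are positive and the other factors are nonnegative and nonzero. -/
lemma exists_norm_transitionTerm_sub_le [Nonempty ι₁] [Nonempty ι₂]
    (hA₀ : ∀ i j, 0 ≤ A₀ i j) (hB₀ : ∀ i j, 0 ≤ B₀ i j) (hM₀ : A₀ + B₀ ≠ 0)
    (hξ : R₁.xi ≠ 0) (hη : R₂.eta ≠ 0)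
    (hpos₁ : ∃ N, ∀ n, N ≤ n → ∀ i j, 0 < (R₁.M ^ n) i j)
    (hpos₂ : ∃ N, ∀ n, N ≤ n → ∀ i j, 0 < (R₂.M ^ n) i j)
    (hap₁ : IsAperiodicPair R₁.A R₁.B) (hap₂ : IsAperiodicPair R₂.A R₂.B)
    {β : ℝ} (hβ₁ : R₁.beta = β) (hβ₂ : R₂.beta = β) :
    0 < perronEigenvalue R₁.M ∧ 0 < R₁.gamma ∧ 0 < R₂.gamma ∧
    ∃ c ρ K g : ℝ, 0 < c ∧ c ≤ R₁.gamma / 2 ∧ c ≤ R₂.gamma / 2 ∧ 0 < ρ ∧ ρ < 1 ∧ 0 < K ∧ 0 < g ∧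
      (∀ t : ℝ, |t| ≤ Real.pi → ∀ (i j : ℕ) (s : ℝ), i ≤ s → s ≤ i + 1 →
        ‖transitionTerm R₁ R₂ A₀ B₀ i j t -
          gaussianTerm β R₁.gamma R₂.gamma (i + j + 1) s t * (g : ℂ)‖ ≤
          K * (ρ ^ i + ρ ^ j) + K * ((√(i + j + 1 : ℕ))⁻¹ *
            Real.exp (-(c / 2) * (i + j + 1 : ℕ) * t ^ 2))) ∧
      ∀ (n : ℕ) (t : ℝ), |t| ≤ Real.pi → ‖pureTerm R₁ R₂ n t‖ ≤ K := by
  obtain ⟨hl₁, hγ₁, v₁, w₁, hv₁, hw₁, y₁, E₁, C₁, c₁, ρ₁, δ₁, hC₁, hc₁, hρ₁, hρ₁', hδ₁, h₁⟩ :=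
    R₁.exists_isLocalExpansion hpos₁ hap₁
  obtain ⟨-, hγ₂, v₂, w₂, hv₂, hw₂, y₂, E₂, C₂, c₂, ρ₂, δ₂, hC₂, hc₂, hρ₂, hρ₂', hδ₂, h₂⟩ :=
    R₂.exists_isLocalExpansion hpos₂ hap₂
  rw [hβ₁] at h₁
  rw [hβ₂] at h₂
  -- A single `c` serves both decay rates and stays below both half-variances, so that the Gaussian
  -- terms decay at least as fast.
  set c := min (min c₁ c₂) (min (R₁.gamma / 2) (R₂.gamma / 2)) with hc
  have hc0 : 0 < c := lt_min (lt_min hc₁ hc₂) (lt_min (half_pos hγ₁) (half_pos hγ₂))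
  have hcγ₁ : c ≤ R₁.gamma / 2 := (min_le_right _ _).trans (min_le_left _ _)
  have hcγ₂ : c ≤ R₂.gamma / 2 := (min_le_right _ _).trans (min_le_right _ _)
  set C := max C₁ C₂
  set ρ := max ρ₁ ρ₂
  set δ := min δ₁ δ₂
  have hC0 : 0 < C := lt_max_of_lt_left hC₁
  have hρ0 : 0 < ρ := lt_max_of_lt_left hρ₁
  have h₁' := h₁.mono (C' := C) (c' := c) (ρ' := ρ) (δ' := δ) hC₁.le hρ₁.le (le_max_left _ _)
    ((min_le_left _ _).trans (min_le_left _ _)) (le_max_left _ _) (min_le_left _ _)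
  have h₂' := h₂.mono (C' := C) (c' := c) (ρ' := ρ) (δ' := δ) hC₂.le hρ₂.le (le_max_right _ _)
    ((min_le_left _ _).trans (min_le_right _ _)) (le_max_right _ _) (min_le_right _ _)
  obtain ⟨K, hK, hbound⟩ := exists_norm_pow_mul_pow_sub_le h₁' h₂' hC0 hc0 hρ0 (lt_min hδ₁ hδ₂)
    hcγ₁ hcγ₂ (S := connectingMatrix A₀ B₀) (by positivity) (norm_connectingMatrix_le A₀ B₀)
    (norm_connectingMatrix_sub_le A₀ B₀)
  set a₁ := ∑ i, ‖(Complex.ofReal ∘ R₁.xi) i‖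
  set a₂ := ∑ i, ‖(Complex.ofReal ∘ R₂.xi) i‖
  set b₁ := ‖(Complex.ofReal ∘ R₁.eta)‖
  set b₂ := ‖(Complex.ofReal ∘ R₂.eta)‖
  set G : Matrix ι₁ ι₂ ℝ := vecMulVec v₁ w₁ * (A₀ + B₀) * vecMulVec v₂ w₂ with hG
  have hG0 : ∀ i j, 0 < G i j := mul_mul_apply_pos (fun i j => mul_pos (hv₁ i) (hw₁ j))
    (fun i j => mul_pos (hv₂ i) (hw₂ j)) (fun i j => add_nonneg (hA₀ i j) (hB₀ i j)) hM₀
  have hGC : (vecMulVec v₁ w₁).map Complex.ofReal * connectingMatrix A₀ B₀ 0 *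
      (vecMulVec v₂ w₂).map Complex.ofReal = G.map Complex.ofReal := by
    rw [connectingMatrix_zero, hG, map_ofReal_mul, map_ofReal_mul]
  have hg : (((R₁.xi ⬝ᵥ (G *ᵥ R₂.eta) : ℝ)) : ℂ) =
      (Complex.ofReal ∘ R₁.xi) ⬝ᵥ (G.map Complex.ofReal *ᵥ (Complex.ofReal ∘ R₂.eta)) := by
    simp [dotProduct, mulVec]
  refine ⟨hl₁, hγ₁, hγ₂, c, ρ, a₁ * b₂ * K + (a₁ * b₁ * C + a₂ * b₂ * C) + 1, _, hc0, hcγ₁, hcγ₂,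
    hρ0, max_lt hρ₁' hρ₂', by positivity, dotProduct_mulVec_pos hG0 R₁.xi_nonneg hξ R₂.eta_nonneg hη,
    fun t ht i j s hs hs' => ?_, fun n t ht => ?_⟩
  · have h := hbound t ht i j s hs hs'
    rw [hGC] at h
    have hx : transitionTerm R₁ R₂ A₀ B₀ i j t -
        gaussianTerm β R₁.gamma R₂.gamma (i + j + 1) s t * (R₁.xi ⬝ᵥ (G *ᵥ R₂.eta) : ℝ) =
        (Complex.ofReal ∘ R₁.xi) ⬝ᵥ ((R₁.scaledMatrix t ^ i * connectingMatrix A₀ B₀ t *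
          R₂.scaledMatrix t ^ j - gaussianTerm β R₁.gamma R₂.gamma (i + j + 1) s t •
            G.map Complex.ofReal) *ᵥ (Complex.ofReal ∘ R₂.eta)) := by
      rw [hg, transitionTerm, Matrix.sub_mulVec, dotProduct_sub, Matrix.smul_mulVec,
        dotProduct_smul, smul_eq_mul]
    rw [hx]
    refine (norm_dotProduct_mulVec_le _ _ _).trans ((mul_le_mul_of_nonneg_left h
      (by positivity)).trans ?_)
    rw [← mul_add, ← mul_add, ← mul_assoc]
    refine mul_le_mul_of_nonneg_right ?_ (by positivity)
    have : 0 ≤ a₁ * b₁ * C + a₂ * b₂ * C := by positivity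
    linarith
  · have hexp : Real.exp (-c * n * t ^ 2) ≤ 1 := by
      rw [Real.exp_le_one_iff, neg_mul, neg_mul]
      exact neg_nonpos.2 (by positivity)
    have e₁ := (h₁'.pow_le n t ht).trans (mul_le_of_le_one_right hC0.le hexp)
    have e₂ := (h₂'.pow_le n t ht).trans (mul_le_of_le_one_right hC0.le hexp)
    have f₁ := (norm_dotProduct_mulVec_le (R₁.scaledMatrix t ^ n) (Complex.ofReal ∘ R₁.xi)
      (Complex.ofReal ∘ R₁.eta)).trans (mul_le_mul_of_nonneg_left e₁ (by positivity))
    have f₂ := (norm_dotProduct_mulVec_le (R₂.scaledMatrix t ^ n) (Complex.ofReal ∘ R₂.xi)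
      (Complex.ofReal ∘ R₂.eta)).trans (mul_le_mul_of_nonneg_left e₂ (by positivity))
    have f₃ : 0 ≤ a₁ * b₂ * K := by positivity
    refine (norm_add_le _ _).trans ?_
    linarith

/-- The weight of the words with `k` occurrences of `a`, from the Fourier coefficients of the
transition terms. -/
lemma abs_sum_series_div_sub_le (hl : 0 < perronEigenvalue R₁.M)
    (hl' : perronEigenvalue R₁.M = perronEigenvalue R₂.M) {K K' Φ g : ℝ} {n k : ℕ} (hn : 1 ≤ n)
    (hpure : ∀ t : ℝ, |t| ≤ Real.pi → ‖pureTerm R₁ R₂ n t‖ ≤ K)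
    (hsum : ‖∑ i ∈ Finset.range n, (∫ t in (-Real.pi)..Real.pi,
        Complex.exp (-(k * t) * Complex.I) * transitionTerm R₁ R₂ A₀ B₀ i (n - 1 - i) t) -
        (2 * Real.pi * Φ : ℝ) * (g : ℂ)‖ ≤ K') :
    |(∑ w : Fin n → Letter with (List.ofFn w).count Letter.a = k,
      (R₁.bicomponent R₂ A₀ B₀ hA₀ hB₀).series (List.ofFn w)) / perronEigenvalue R₁.M ^ (n - 1) -
      Φ * g| ≤ perronEigenvalue R₁.M * K + K' := by
  set l := perronEigenvalue R₁.M
  set x := ∑ w : Fin n → Letter with (List.ofFn w).count Letter.a = k,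
      (R₁.bicomponent R₂ A₀ B₀ hA₀ hB₀).series (List.ofFn w) with hx
  have hpi := Real.pi_pos
  have hL : 0 < l ^ (n - 1) := pow_pos hl _
  have h1 := (R₁.bicomponent R₂ A₀ B₀ hA₀ hB₀).integral_charMatrix_pow n k
  rw [← hx] at h1
  have hexp : Continuous fun t : ℝ => Complex.exp (-(k * t) * Complex.I) := by fun_prop
  have h2 : ∀ t : ℝ, Complex.exp (-(k * t) * Complex.I) *
      ((Complex.ofReal ∘ (R₁.bicomponent R₂ A₀ B₀ hA₀ hB₀).xi) ⬝ᵥ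
        ((R₁.bicomponent R₂ A₀ B₀ hA₀ hB₀).charMatrix (Complex.exp (t * Complex.I)) ^ n *ᵥ
          (Complex.ofReal ∘ (R₁.bicomponent R₂ A₀ B₀ hA₀ hB₀).eta))) =
      ((l ^ (n - 1) : ℝ) : ℂ) * (l * (Complex.exp (-(k * t) * Complex.I) * pureTerm R₁ R₂ n t) +
        ∑ i ∈ Finset.range n, Complex.exp (-(k * t) * Complex.I) *
          transitionTerm R₁ R₂ A₀ B₀ i (n - 1 - i) t) := by
    intro t
    rw [dotProduct_bicomponent_pow_eq R₁ R₂ A₀ B₀ hA₀ hB₀ hl hl' t hn, ← Finset.mul_sum]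
    ring
  have hcont : ∀ i j, Continuous fun t : ℝ => Complex.exp (-(k * t) * Complex.I) *
      transitionTerm R₁ R₂ A₀ B₀ i j t :=
    fun i j => hexp.mul (continuous_transitionTerm R₁ R₂ A₀ B₀ i j)
  have hcont' : Continuous fun t : ℝ => Complex.exp (-(k * t) * Complex.I) *
      pureTerm R₁ R₂ n t := hexp.mul (continuous_pureTerm R₁ R₂ n)
  have hcont'' : Continuous fun t : ℝ => (l : ℂ) * (Complex.exp (-(k * t) * Complex.I) *
      pureTerm R₁ R₂ n t) := continuous_const.mul hcont'
  simp only [h2] at h1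
  rw [intervalIntegral.integral_const_mul, intervalIntegral.integral_add
    (hcont''.intervalIntegrable _ _)
    ((continuous_finsetSum _ fun i _ => hcont i _).intervalIntegrable _ _),
    intervalIntegral.integral_const_mul,
    intervalIntegral.integral_finsetSum fun i _ => (hcont i _).intervalIntegrable _ _] at h1
  set P := ∫ t in (-Real.pi)..Real.pi, Complex.exp (-(k * t) * Complex.I) * pureTerm R₁ R₂ n t
  set V := ∑ i ∈ Finset.range n, ∫ t in (-Real.pi)..Real.pi,
    Complex.exp (-(k * t) * Complex.I) * transitionTerm R₁ R₂ A₀ B₀ i (n - 1 - i) t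
  have hP : ‖P‖ ≤ K * (2 * Real.pi) := by
    refine (intervalIntegral.norm_integral_le_of_norm_le_const (C := K) fun t ht => ?_).trans
      (le_of_eq ?_)
    · rw [Set.uIoc_of_le (by linarith)] at ht
      rw [norm_mul, show (-((k : ℂ) * t) * Complex.I) = ((-(k * t) : ℝ) : ℂ) * Complex.I by
        push_cast; ring, Complex.norm_exp_ofReal_mul_I, one_mul]
      exact hpure t (abs_le.2 ⟨ht.1.le, ht.2⟩)
    · rw [abs_of_pos (by linarith)]
      ring
  have hL' : ((l ^ (n - 1) : ℝ) : ℂ) ≠ 0 := by exact_mod_cast hL.ne'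
  -- The pure terms contribute only the bounded quantity `l * P`, while the transition terms have a
  -- main part of order `√n`.
  have h3 : ((2 * Real.pi * (x / l ^ (n - 1) - Φ * g) : ℝ) : ℂ) =
      l * P + (V - (2 * Real.pi * Φ : ℝ) * (g : ℂ)) := by
    have h4 : ((2 * Real.pi * (x / l ^ (n - 1) - Φ * g) : ℝ) : ℂ) =
        ((2 * Real.pi * x : ℝ) : ℂ) / ((l ^ (n - 1) : ℝ) : ℂ) -
          (2 * Real.pi * Φ : ℝ) * (g : ℂ) := by
      push_cast
      ring
    rw [h4, ← h1, mul_div_cancel_left₀ _ hL']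
    ring
  have h5 := congrArg norm h3
  rw [Complex.norm_real, Real.norm_eq_abs, abs_mul, abs_of_pos (by positivity)] at h5
  have h6 : 2 * Real.pi * |x / l ^ (n - 1) - Φ * g| ≤ l * (K * (2 * Real.pi)) + K' := by
    rw [h5]
    refine (norm_add_le _ _).trans (add_le_add ?_ hsum)
    rw [norm_mul, Complex.norm_real, Real.norm_eq_abs, abs_of_pos hl]
    gcongr
  have hK' : 0 ≤ K' := (norm_nonneg _).trans hsum
  have h7 : K' ≤ K' * (2 * Real.pi) :=
    le_mul_of_one_le_right hK' (by linarith [Real.pi_gt_three])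
  have h8 : 2 * Real.pi * |x / l ^ (n - 1) - Φ * g| ≤ 2 * Real.pi * (l * K + K') := by linarith
  exact le_of_mul_le_mul_left h8 (by positivity)

/-- The total weight of the words of length `n`. -/
lemma abs_sum_series_div_sub_mul_le (hl : 0 < perronEigenvalue R₁.M)
    (hl' : perronEigenvalue R₁.M = perronEigenvalue R₂.M) {K ρ g : ℝ} {n : ℕ} (hn : 1 ≤ n)
    (hρ : 0 < ρ) (hρ1 : ρ < 1) (hK : 0 < K)
    (hpure : ‖pureTerm R₁ R₂ n 0‖ ≤ K)
    (hterm : ∀ i j : ℕ, ‖transitionTerm R₁ R₂ A₀ B₀ i j 0 - (g : ℂ)‖ ≤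
      K * (ρ ^ i + ρ ^ j) + K * (√(i + j + 1 : ℕ))⁻¹) :
    |(∑ w : Fin n → Letter, (R₁.bicomponent R₂ A₀ B₀ hA₀ hB₀).series (List.ofFn w)) /
      perronEigenvalue R₁.M ^ (n - 1) - n * g| ≤
      (perronEigenvalue R₁.M * K + K * (2 / (1 - ρ)) + K) * √(n : ℝ) := by
  set l := perronEigenvalue R₁.M
  have hn0 : (0 : ℝ) < n := by exact_mod_cast hn
  have hL : 0 < l ^ (n - 1) := pow_pos hl _
  have hL' : ((l ^ (n - 1) : ℝ) : ℂ) ≠ 0 := by exact_mod_cast hL.ne'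
  have h1ρ : 0 < 1 - ρ := by linarith
  have h1 := (R₁.bicomponent R₂ A₀ B₀ hA₀ hB₀).dotProduct_charMatrix_pow
    (Complex.exp ((0 : ℝ) * Complex.I)) n
  rw [dotProduct_bicomponent_pow_eq R₁ R₂ A₀ B₀ hA₀ hB₀ hl hl' 0 hn] at h1
  have h2 : ∑ w : Fin n → Letter, Complex.exp ((0 : ℝ) * Complex.I) ^
      ((List.ofFn w).count Letter.a) *
        ((R₁.bicomponent R₂ A₀ B₀ hA₀ hB₀).series (List.ofFn w) : ℂ) =
      ((∑ w : Fin n → Letter,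
        (R₁.bicomponent R₂ A₀ B₀ hA₀ hB₀).series (List.ofFn w) : ℝ) : ℂ) := by
    simp
  rw [h2] at h1
  set z := ∑ w : Fin n → Letter, (R₁.bicomponent R₂ A₀ B₀ hA₀ hB₀).series (List.ofFn w)
  have h3 : ((z / l ^ (n - 1) - n * g : ℝ) : ℂ) = l * pureTerm R₁ R₂ n 0 +
      ∑ i ∈ Finset.range n, (transitionTerm R₁ R₂ A₀ B₀ i (n - 1 - i) 0 - (g : ℂ)) := by
    rw [Finset.sum_sub_distrib, Finset.sum_const, Finset.card_range, nsmul_eq_mul,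
      Complex.ofReal_sub, Complex.ofReal_div, ← h1, mul_div_cancel_left₀ _ hL']
    push_cast
    ring
  have h4 : ∑ i ∈ Finset.range n, ‖transitionTerm R₁ R₂ A₀ B₀ i (n - 1 - i) 0 - (g : ℂ)‖ ≤
      K * (2 / (1 - ρ)) + K * √(n : ℝ) := by
    have h5 : ∀ i ∈ Finset.range n, ‖transitionTerm R₁ R₂ A₀ B₀ i (n - 1 - i) 0 - (g : ℂ)‖ ≤
        K * (ρ ^ i + ρ ^ (n - 1 - i)) + K * (√(n : ℝ))⁻¹ := by
      intro i hi
      have hi' := Finset.mem_range.1 hi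
      have := hterm i (n - 1 - i)
      rwa [show i + (n - 1 - i) + 1 = n by omega] at this
    refine (Finset.sum_le_sum h5).trans ?_
    have hgeom : ∑ i ∈ Finset.range n, ρ ^ i ≤ 1 / (1 - ρ) := by
      rw [one_div, ← tsum_geometric_of_lt_one hρ.le hρ1]
      exact (summable_geometric_of_lt_one hρ.le hρ1).sum_le_tsum _ fun i _ => by positivity
    rw [Finset.sum_add_distrib, ← Finset.mul_sum, Finset.sum_add_distrib,
      Finset.sum_range_reflect (fun i => ρ ^ i) n, Finset.sum_const, Finset.card_range,
      nsmul_eq_mul]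
    -- At `t = 0` there is no integration to gain a second `n^{-1/2}`; the resulting error `O(√n)`
    -- is enough for the denominator.
    have h6 : (n : ℝ) * (K * (√(n : ℝ))⁻¹) = K * √(n : ℝ) := by
      rw [← div_eq_mul_inv, mul_div_left_comm, Real.div_sqrt]
    rw [h6]
    have h7 : ∑ i ∈ Finset.range n, ρ ^ i + ∑ i ∈ Finset.range n, ρ ^ i ≤ 2 / (1 - ρ) := by
      rw [show (2 : ℝ) / (1 - ρ) = 1 / (1 - ρ) + 1 / (1 - ρ) by ring]
      exact add_le_add hgeom hgeom
    gcongr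
  have hr1 : 1 ≤ √(n : ℝ) := Real.one_le_sqrt.2 (by exact_mod_cast hn)
  have h8 : |z / l ^ (n - 1) - n * g| ≤ l * K + (K * (2 / (1 - ρ)) + K * √(n : ℝ)) := by
    rw [← Real.norm_eq_abs, ← Complex.norm_real, h3]
    refine (norm_add_le _ _).trans (add_le_add ?_ ((norm_sum_le _ _).trans h4))
    rw [norm_mul, Complex.norm_real, Real.norm_eq_abs, abs_of_pos hl]
    gcongr
  have h9 : 0 ≤ l * K + K * (2 / (1 - ρ)) := by positivity
  nlinarith [mul_le_mul_of_nonneg_left hr1 h9]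

end LinearRepresentation

open LinearRepresentation in
/-- The local limit theorem for the equipotent communicating bicomponent model. -/
theorem exists_abs_sqrt_mul_prob_sub_mixtureDensity_le {ι₁ ι₂ : Type*} [Fintype ι₁]
    [DecidableEq ι₁] [Fintype ι₂] [DecidableEq ι₂]
    (R₁ : LinearRepresentation ι₁) (R₂ : LinearRepresentation ι₂)
    (A₀ B₀ : Matrix ι₁ ι₂ ℝ) (hA₀ : ∀ i j, 0 ≤ A₀ i j) (hB₀ : ∀ i j, 0 ≤ B₀ i j)
    (hmodel : IsEquipotentCommunicating R₁ R₂ A₀ B₀ hA₀ hB₀)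
    (hap₁ : IsAperiodicPair R₁.A R₁.B) (hap₂ : IsAperiodicPair R₂.A R₂.B)
    (β γ : ℝ) (hβ₁ : R₁.beta = β) (hβ₂ : R₂.beta = β)
    (hγne : R₁.gamma ≠ R₂.gamma) (hγ : γ = (R₁.gamma + R₂.gamma) / 2) :
    ∃ (C : ℝ) (N : ℕ), ∀ n : ℕ, N ≤ n → ∀ k : ℕ,
      |√(γ * n) * (R₁.bicomponent R₂ A₀ B₀ hA₀ hB₀).prob n k
          - mixtureDensity R₁.gamma R₂.gamma ((k - β * n) / √(γ * n))|
        ≤ C * (n : ℝ) ^ (-(1 / 2) : ℝ) := by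
  obtain ⟨i₀, -⟩ := Function.ne_iff.1 hmodel.xi₁_ne_zero
  obtain ⟨j₀, -⟩ := Function.ne_iff.1 hmodel.eta₂_ne_zero
  have : Nonempty ι₁ := ⟨i₀⟩
  have : Nonempty ι₂ := ⟨j₀⟩
  obtain ⟨hl, hγ₁, hγ₂, c, ρ, K, g, hc, hcγ₁, hcγ₂, hρ, hρ1, hK, hg, hbound, hpure⟩ :=
    exists_norm_transitionTerm_sub_le R₁ R₂ A₀ B₀ hA₀ hB₀ hmodel.M₀_ne_zero hmodel.xi₁_ne_zero
      hmodel.eta₂_ne_zero (exists_forall_pow_pos hmodel.irreducible₁ hmodel.aperiodic₁)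
      (exists_forall_pow_pos hmodel.irreducible₂ hmodel.aperiodic₂) hap₁ hap₂ hβ₁ hβ₂
  obtain ⟨K', hK', hsum⟩ := exists_norm_sum_fourierCoeff_sub_le hc hcγ₁ hcγ₂ hρ hρ1 hK
    (continuous_transitionTerm R₁ R₂ A₀ B₀) hbound
  obtain ⟨F, hF, hfF⟩ := exists_abs_mixtureDensity_le hγ₁ hγ₂
  have hγ0 : 0 < γ := by rw [hγ]; positivity
  have h1ρ : 0 < 1 - ρ := by linarith
  have hterm : ∀ i j : ℕ, ‖transitionTerm R₁ R₂ A₀ B₀ i j 0 - (g : ℂ)‖ ≤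
      K * (ρ ^ i + ρ ^ j) + K * (√(i + j + 1 : ℕ))⁻¹ := by
    intro i j
    have := hbound 0 (by simpa using Real.pi_pos.le) i j i le_rfl (by linarith)
    -- At `t = 0` the characteristic function and the Gaussian weight are both `1`.
    simpa [gaussianTerm] using this
  obtain ⟨C, N, hN, hfinal⟩ := exists_abs_sqrt_mul_div_sub_le (γ := γ) (g := g)
    (K₁ := perronEigenvalue R₁.M * K + K')
    (K₂ := perronEigenvalue R₁.M * K + K * (2 / (1 - ρ)) + K) hγ0 hg (by positivity)
    (by positivity) hF.le
  refine ⟨C, N, fun n hn k => ?_⟩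
  have hn1 : 1 ≤ n := hN.trans hn
  have hL : perronEigenvalue R₁.M ^ (n - 1) ≠ 0 := (pow_pos hl _).ne'
  have hdensity := integral_gaussianDensity (β := β) hγ₁ hγ₂ hγne hn1 k
  rw [← hγ] at hdensity
  -- Numerator and denominator are both divided by `λ ^ (n - 1)`, the scale of the two estimates.
  rw [prob_eq, ← div_div_div_cancel_right₀ hL]
  exact hfinal n hn _ _ _ _
    (abs_sum_series_div_sub_le R₁ R₂ A₀ B₀ hA₀ hB₀ hl hmodel.eigenvalue_eq hn1
      (fun t ht => hpure n t ht) (hsum n k hn1))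
    (abs_sum_series_div_sub_mul_le R₁ R₂ A₀ B₀ hA₀ hB₀ hl hmodel.eigenvalue_eq hn1 hρ hρ1 hK
      (hpure n 0 (by simpa using Real.pi_pos.le)) hterm) hdensity (hfF _)

end SymbolStatistics

theorem mainTheorem4 {ι₁ ι₂ : Type*} [Fintype ι₁] [DecidableEq ι₁] [Fintype ι₂] [DecidableEq ι₂]
    (R₁ : LinearRepresentation ι₁) (R₂ : LinearRepresentation ι₂)
    (A₀ B₀ : Matrix ι₁ ι₂ ℝ) (hA₀ : ∀ i j, 0 ≤ A₀ i j) (hB₀ : ∀ i j, 0 ≤ B₀ i j)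
    (hmodel : IsEquipotentCommunicating R₁ R₂ A₀ B₀ hA₀ hB₀)
    (hap₁ : IsAperiodicPair R₁.A R₁.B) (hap₂ : IsAperiodicPair R₂.A R₂.B)
    (β γ : ℝ) (hβ₁ : R₁.beta = β) (hβ₂ : R₂.beta = β)
    (hγne : R₁.gamma ≠ R₂.gamma) (hγ : γ = (R₁.gamma + R₂.gamma) / 2) :
    ∃ (C : ℝ) (N : ℕ), ∀ n : ℕ, N ≤ n → ∀ k : ℕ, k ≤ n →
      |√(γ * n) * (R₁.bicomponent R₂ A₀ B₀ hA₀ hB₀).prob n k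
          - mixtureDensity R₁.gamma R₂.gamma ((k - β * n) / √(γ * n))|
        ≤ C * (n : ℝ) ^ (-(1 / 2) : ℝ) :=
  let ⟨C, N, h⟩ := exists_abs_sqrt_mul_prob_sub_mixtureDensity_le R₁ R₂ A₀ B₀ hA₀ hB₀ hmodel
    hap₁ hap₂ β γ hβ₁ hβ₂ hγne hγ
  ⟨C, N, fun n hn k _ => h n hn k⟩
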